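/- All categories are linear over $\mathbb{C}$. A *fusion category* is a finitely semisimple rigid monoidal category with bilinear tensor product and simple unit; for a fusion category $\mathcal{X}$ with a pivotal structure, $\dim$ denotes the categorical dimension, $\Lambda_{\mathcal X}$ a finite set of representatives of the simple objects, and $\Omega_{\mathcal X}=\sum_{X\in\Lambda_{\mathcal X}}\dim(X)\,X$ the Kirby colour. Dimensions and the action of functors on objects are extended linearly to formal linear combinations of objects. A *unitary fusion category* is a fusion category with a conjugate-linear monoidal dagger structure that makes it a $C^*$-category; it carries the canonical spherical structure defined by the dagger and the chosen duals. A *unitary functor* is a ($\mathbb{C}$-linear) functor that preserves the dagger. Let $\mathcal{D}$ be a pivotal fusion category with a braiding. An object $X$ of $\mathcal{D}$ is *transparent* if $c_{Y,X}\circ c_{X,Y}=\mathrm{id}$ for all objects $Y$; the transparent objects form the symmetric centre $\mathcal{D}'$. The transparent part $x'$ of a formal linear combination $x$ of objects is obtained by decomposing all objects into simple ones and keeping the transparent ones. Let $L$ be a diagram (with blackboard framing) of an oriented framed link with components partitioned into $h_1$ dotted and $h_2$ undotted ones. In particular, $L$ may be the diagram of the special framed link of a handle decomposition, with one 0-handle,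 one 4-handle, $h_1$ 1-handles (dotted) and $h_2$ 2-handles (undotted), of a smooth oriented closed four-manifold $M$. Let $h_3$ be the nullity of the linking matrix of $L$ and $\chi=2-h_1+h_2-h_3$; for the link of such a handle decomposition, $h_3$ is the number of 3-handles and $\chi$ is the Euler characteristic of $M$. For a functor $F\colon\mathcal{C}\to\mathcal{D}$ from a pivotal fusion category $\mathcal{C}$, let $\langle L(\Omega_{\mathcal D},F\Omega_{\mathcal C})\rangle$ be the evaluation of $L$ in $\mathcal{D}$ with dotted components labelled by $\Omega_{\mathcal D}$ and undotted ones by $F\Omega_{\mathcal C}$, and define $$I_F(L)=\frac{\langle L(\Omega_{\mathcal D},F\Omega_{\mathcal C})\rangle}{(\dim\Omega_{\mathcal C})^{h_2-h_1}\,\bigl(\dim\Omega_{\mathcal D}\cdot\dim (F\Omega_{\mathcal C})'\bigr)^{h_1}} .$$ For a full ribbon inclusion $F\colon\mathcal{C}\hookrightarrow\mathcal{D}$, Petit's dichromatic invariant is $$I_0(L)=\frac{\langle L(\Omega_{\mathcal D},F\Omega_{\mathcal C})\rangle}{(\dim\Omega_{\mathcal C})^{h_3}\,\bigl(\dim\Omega_{\mathcal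 D}\cdot\dim (F\Omega_{\mathcal C})'\bigr)^{(h_1+h_2-h_3)/2}} .$$ For a strong monoidal functor $F$, the image category $\operatorname{Im}F$ is the full fusion subcategory of the target on all objects that are isomorphic to a subobject (equivalently, a direct summand) of some $FX$. It inherits the pivotal structure from the target, as well as the braiding and the twist. **Theorem.** Let $F\colon\mathcal{C}\to\mathcal{D}$ be a strong monoidal unitary functor of unitary fusion categories, where $\mathcal{D}$ is also ribbon (compatibly with its canonical spherical structure) and its symmetric centre $\mathcal{D}'$ has trivial twist. 1. Let $F_2\colon\operatorname{Im}F\hookrightarrow\mathcal{D}$ be the full inclusion. For every $L$ as above, $I_F(L)=I_{F_2}(L)$, and, with $I_0$ denoting Petit's dichromatic invariant for $F_2$, $$I_F(L)=I_0(L)\cdot\left(\frac{\sqrt{\dim\Omega_{\mathcal D}\cdot\dim(F_2\Omega_{\operatorname{Im}F})'}}{\dim\Omega_{\operatorname{Im}F}}\right)^{\chi-2}.$$ 2. Suppose that $\mathcal{D}$ is moreover modularisable, i.e. all transparent objects have dimension in $\mathbb{N}$, and let $H\colon\mathcal{D}\to\widetilde{\mathcal D}$ be a modularisation, i.e. a linear,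 faithful, dominant ribbon functor to a modular (ribbon fusion) category $\widetilde{\mathcal D}$, where *dominant* means that every object of $\widetilde{\mathcal D}$ is a subobject of some $HX$. Then, with $G\colon\operatorname{Im}(H\circ F)\hookrightarrow\widetilde{\mathcal D}$ the full inclusion, $I_F(L)=I_G(L)$ for every $L$ as above. That is, $I_F$ is the invariant of a full inclusion into a modular category. -/

import Mathlib

open CategoryTheory MonoidalCategory Limits

universe v u v₁ u₁ v₂ u₂ v₃ u₃

namespace Dichromatic

/-! ### Semisimple, fusion, pivotal and spherical categories -/

section Semisimple

variable (C : Type u) [Category.{v} C] [Preadditive C] [Linear ℂ C]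

/-- An object is simple if its endomorphism algebra is one-dimensional. -/
def IsSimpleObj {C : Type u} [Category.{v} C] [Preadditive C] [Linear ℂ C] (X : C) : Prop :=
  Module.finrank ℂ (X ⟶ X) = 1

/-- A finitely semisimple linear category: finite-dimensional morphism spaces, finite biproducts,
split idempotents, and a finite set of pairwise non-isomorphic simple objects `Z i` such that
composition `⨁ i, C(X, Z i) ⊗ C(Z i, Y) → C(X, Y)` is bijective for all `X` and `Y`. (A finite
direct sum is written as a product.) -/
class FinitelySemisimple : Prop where
  finiteDimensional_hom : ∀ X Y : C, FiniteDimensional ℂ (X ⟶ Y)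
  hasFiniteBiproducts : HasFiniteBiproducts C
  idempotents_split : IsIdempotentComplete C
  exists_simples : ∃ (ι : Type) (_ : Fintype ι) (Z : ι → C),
    (∀ i, IsSimpleObj (Z i)) ∧ (∀ i j, Nonempty (Z i ≅ Z j) → i = j) ∧
    ∀ X Y : C, Function.Bijective
      (fun t : ∀ i, TensorProduct ℂ (X ⟶ Z i) (Z i ⟶ Y) =>
        ∑ i, TensorProduct.lift (Linear.comp (S := ℂ) X (Z i) Y) (t i))

variable [FinitelySemisimple C]

/-- The index type of the chosen finite set `Λ_C` of representatives of the simple objects. -/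
def SimpleIndex : Type :=
  (FinitelySemisimple.exists_simples (C := C)).choose

noncomputable instance : Fintype (SimpleIndex C) :=
  (FinitelySemisimple.exists_simples (C := C)).choose_spec.choose

/-- The chosen representatives `Λ_C` of the simple objects. -/
noncomputable def simpleObj : SimpleIndex C → C :=
  (FinitelySemisimple.exists_simples (C := C)).choose_spec.choose_spec.choose

end Semisimple

/-- Fusion categories: finitely semisimple, rigid, with bilinear tensor product and simple unit.
`ᘁX` is the chosen dual `X*`, with `ev : X ⊗ X* ⟶ 𝟙` and `coev : 𝟙 ⟶ X* ⊗ X`. The duals on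
the other side come from a pivotal structure, which all our fusion categories carry. -/
class FusionCategory (C : Type u) [Category.{v} C] [Preadditive C] [Linear ℂ C]
    [MonoidalCategory C] [MonoidalPreadditive C] [MonoidalLinear ℂ C] [LeftRigidCategory C] : Prop
    extends FinitelySemisimple C where
  simple_unit : IsSimpleObj (𝟙_ C)

section Pivotal

variable {C : Type u} [Category.{v} C] [MonoidalCategory C] [LeftRigidCategory C]

/-- The chosen dual `X*`. -/
abbrev dual (X : C) : C := ᘁX

/-- The dual `f* : Y* ⟶ X*` of a morphism `f : X ⟶ Y`. -/
abbrev dualMap {X Y : C} (f : X ⟶ Y) : dual Y ⟶ dual X := ᘁf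

/-- The evaluation `X ⊗ X* ⟶ 𝟙`. -/
def ev (X : C) : X ⊗ dual X ⟶ 𝟙_ C := ε_ (dual X) X

/-- The coevaluation `𝟙 ⟶ X* ⊗ X`. -/
def coev (X : C) : 𝟙_ C ⟶ dual X ⊗ X := η_ (dual X) X

variable (C) in
/-- The canonical isomorphism `𝟙* ≅ 𝟙`. -/
noncomputable def dualUnitIso : dual (𝟙_ C) ≅ 𝟙_ C :=
  leftDualIso (LeftRigidCategory.leftDual (𝟙_ C)).exact exactPairingUnit

/-- The canonical isomorphism `(X ⊗ Y)* ≅ Y* ⊗ X*`. -/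
noncomputable def dualTensorIso (X Y : C) : dual (X ⊗ Y) ≅ dual Y ⊗ dual X :=
  leftDualTensorIso X Y

/-- A pivotal structure: a monoidal natural isomorphism from the identity to the double dual. -/
class PivotalCategory (C : Type u) [Category.{v} C] [MonoidalCategory C]
    [LeftRigidCategory C] where
  piv : ∀ X : C, X ≅ dual (dual X)
  piv_naturality : ∀ {X Y : C} (f : X ⟶ Y),
    f ≫ (piv Y).hom = (piv X).hom ≫ dualMap (dualMap f)
  piv_tensor : ∀ X Y : C,
    (piv (X ⊗ Y)).hom ≫ dualMap (dualTensorIso X Y).inv ≫ (dualTensorIso (dual Y) (dual X)).hom =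
      (piv X).hom ⊗ₘ (piv Y).hom
  piv_unit : (piv (𝟙_ C)).hom = (dualUnitIso C).inv ≫ dualMap (dualUnitIso C).hom

variable [PivotalCategory C]

/-- The pivotal structure `X ≅ X**`. -/
def piv (X : C) : X ≅ dual (dual X) := PivotalCategory.piv X

/-- The other evaluation `X* ⊗ X ⟶ 𝟙`. -/
def evT (X : C) : dual X ⊗ X ⟶ 𝟙_ C := dual X ◁ (piv X).hom ≫ ev (dual X)

/-- The other coevaluation `𝟙 ⟶ X ⊗ X*`. -/
def coevT (X : C) : 𝟙_ C ⟶ X ⊗ dual X := coev (dual X) ≫ (piv X).inv ▷ dual X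

/-- The right trace, as an endomorphism of the unit. -/
def rightTrace {X : C} (f : X ⟶ X) : 𝟙_ C ⟶ 𝟙_ C := coevT X ≫ f ▷ dual X ≫ ev X

/-- The left trace, as an endomorphism of the unit. -/
def leftTrace {X : C} (f : X ⟶ X) : 𝟙_ C ⟶ 𝟙_ C := coev X ≫ dual X ◁ f ≫ evT X

end Pivotal

/-- Spherical categories: pivotal categories whose left and right traces agree. -/
class SphericalCategory (C : Type u) [Category.{v} C] [MonoidalCategory C] [LeftRigidCategory C]
    [PivotalCategory C] : Prop where
  trace_eq : ∀ {X : C} (f : X ⟶ X), rightTrace f = leftTrace f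

section Dimension

variable {C : Type u} [Category.{v} C] [Preadditive C] [Linear ℂ C] [MonoidalCategory C]
  [MonoidalPreadditive C] [MonoidalLinear ℂ C] [LeftRigidCategory C]

theorem exists_scalar [FusionCategory C] (f : 𝟙_ C ⟶ 𝟙_ C) : ∃ c : ℂ, c • 𝟙 (𝟙_ C) = f := by
  have h : Module.finrank ℂ (𝟙_ C ⟶ 𝟙_ C) = 1 := FusionCategory.simple_unit
  have h0 : 𝟙 (𝟙_ C) ≠ 0 := by
    intro h0
    obtain ⟨v, hv, -⟩ := finrank_eq_one_iff'.1 h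
    apply hv
    rw [← Category.comp_id v, h0, comp_zero]
  exact (finrank_eq_one_iff_of_nonzero' _ h0).1 h f

/-- The identification of the endomorphisms of the unit of a fusion category with `ℂ`. -/
noncomputable def scalar [FusionCategory C] (f : 𝟙_ C ⟶ 𝟙_ C) : ℂ := (exists_scalar f).choose

theorem scalar_spec [FusionCategory C] (f : 𝟙_ C ⟶ 𝟙_ C) : scalar f • 𝟙 (𝟙_ C) = f :=
  (exists_scalar f).choose_spec

/-- The categorical dimension of an object. -/
noncomputable def qdim [FusionCategory C] [PivotalCategory C] (X : C) : ℂ :=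
  scalar (rightTrace (𝟙 X))

end Dimension

/-! ### Ribbon categories, transparent objects, modular categories -/

/-- Ribbon categories: braided rigid categories with a balanced twist satisfying the ribbon
equation, equipped with the canonical pivotal structure determined by the twist (the twist is the
right partial trace of the braiding). -/
class RibbonCategory (C : Type u) [Category.{v} C] [MonoidalCategory C] [BraidedCategory C]
    [LeftRigidCategory C] [PivotalCategory C] where
  twist : ∀ X : C, X ≅ X
  twist_naturality : ∀ {X Y : C} (f : X ⟶ Y), f ≫ (twist Y).hom = (twist X).hom ≫ f
  twist_tensor : ∀ X Y : C, (twist (X ⊗ Y)).hom =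
    ((twist X).hom ⊗ₘ (twist Y).hom) ≫ (β_ X Y).hom ≫ (β_ Y X).hom
  twist_dual : ∀ X : C, (twist (dual X)).hom = dualMap (twist X).hom
  twist_eq_piv : ∀ X : C, (twist X).hom =
    (ρ_ X).inv ≫ X ◁ coev (dual X) ≫ (α_ X (dual (dual X)) (dual X)).inv ≫
      (β_ X (dual (dual X))).hom ▷ dual X ≫ (α_ (dual (dual X)) X (dual X)).hom ≫
      dual (dual X) ◁ ev X ≫ (ρ_ (dual (dual X))).hom ≫ (piv X).inv

/-- The twist of a ribbon category. -/
def twist {C : Type u} [Category.{v} C] [MonoidalCategory C] [BraidedCategory C]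
    [LeftRigidCategory C] [PivotalCategory C] [RibbonCategory C] (X : C) : X ≅ X :=
  RibbonCategory.twist X

/-- An object is transparent if its double braiding with every object is trivial. -/
def IsTransparent {C : Type u} [Category.{v} C] [MonoidalCategory C] [BraidedCategory C]
    (X : C) : Prop :=
  ∀ Y : C, (β_ X Y).hom ≫ (β_ Y X).hom = 𝟙 (X ⊗ Y)

/-- The symmetric centre has trivial twist. -/
def CentreHasTrivialTwist (C : Type u) [Category.{v} C] [MonoidalCategory C] [BraidedCategory C]
    [LeftRigidCategory C] [PivotalCategory C] [RibbonCategory C] : Prop :=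
  ∀ X : C, IsTransparent X → (twist X).hom = 𝟙 X

section Ribbon

variable (C : Type u) [Category.{v} C] [Preadditive C] [Linear ℂ C] [MonoidalCategory C]
  [MonoidalPreadditive C] [MonoidalLinear ℂ C] [LeftRigidCategory C] [FusionCategory C]
  [PivotalCategory C] [BraidedCategory C] [RibbonCategory C]

/-- A ribbon fusion category is modularisable if its symmetric centre has trivial twist and
natural numbers as dimensions. -/
def IsModularisable : Prop :=
  CentreHasTrivialTwist C ∧ ∀ X : C, IsTransparent X → ∃ n : ℕ, qdim X = n

/-- A ribbon fusion category is modular if the unit is its only transparent simple object. -/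
def IsModular : Prop :=
  ∀ X : C, IsSimpleObj X → IsTransparent X → Nonempty (X ≅ 𝟙_ C)

end Ribbon

/-- A functor is dominant if every object of the target is a subobject (direct summand) of some
`F.obj X`. -/
def IsDominant {C : Type u₁} [Category.{v₁} C] {D : Type u₂} [Category.{v₂} D]
    (F : C ⥤ D) : Prop :=
  ∀ Y : D, ∃ X : C, Nonempty (Retract Y (F.obj X))

/-- A linear braided monoidal functor `H : D ⥤ E` is a modularisation of `D` if it is a ribbon
functor (preserves twists), is faithful and dominant, and `E` is modular. -/
structure IsModularisation {D : Type u₁} [Category.{v₁} D] [MonoidalCategory D]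
    [BraidedCategory D] [LeftRigidCategory D] [PivotalCategory D] [RibbonCategory D]
    {E : Type u₂} [Category.{v₂} E] [Preadditive E] [Linear ℂ E] [MonoidalCategory E]
    [MonoidalPreadditive E] [MonoidalLinear ℂ E] [LeftRigidCategory E] [FusionCategory E]
    [PivotalCategory E] [BraidedCategory E] [RibbonCategory E]
    (H : D ⥤ E) [H.Braided] : Prop where
  map_twist : ∀ X : D, H.map (twist X).hom = (twist (H.obj X)).hom
  faithful : H.Faithful
  dominant : IsDominant H
  modular : IsModular E

/-! ### Unitary fusion categories -/

/-- A dagger structure: an involutive contravariant functor that is the identity on objects. -/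
class DaggerCategory (C : Type u) [Category.{v} C] where
  dag : ∀ {X Y : C}, (X ⟶ Y) → (Y ⟶ X)
  dag_id : ∀ X : C, dag (𝟙 X) = 𝟙 X
  dag_comp : ∀ {X Y Z : C} (f : X ⟶ Y) (g : Y ⟶ Z), dag (f ≫ g) = dag g ≫ dag f
  dag_dag : ∀ {X Y : C} (f : X ⟶ Y), dag (dag f) = f

/-- The dagger of a morphism. -/
def dag {C : Type u} [Category.{v} C] [DaggerCategory C] {X Y : C} (f : X ⟶ Y) : Y ⟶ X :=
  DaggerCategory.dag f

/-- Unitary fusion categories, with the canonical spherical structure. The dagger is conjugate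
linear and monoidal, and makes the category a C*-category: `f† ∘ f = 0` only for `f = 0`, and
`f† ∘ f` is a positive element of the endomorphism algebra (for finite-dimensional morphism
spaces these conditions amount to the existence of C*-norms). The pivotal structure is the one
defined by the dagger and the chosen duals (`ẽv = coev†`), and it is spherical. -/
class UnitaryFusionCategory (C : Type u) [Category.{v} C] [Preadditive C] [Linear ℂ C]
    [MonoidalCategory C] [MonoidalPreadditive C] [MonoidalLinear ℂ C] [LeftRigidCategory C]
    [PivotalCategory C] [DaggerCategory C] : Prop
    extends FusionCategory C, SphericalCategory C where
  dag_add : ∀ {X Y : C} (f g : X ⟶ Y), dag (f + g) = dag f + dag g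
  dag_smul : ∀ {X Y : C} (c : ℂ) (f : X ⟶ Y), dag (c • f) = (starRingEnd ℂ) c • dag f
  dag_tensor : ∀ {X₁ Y₁ X₂ Y₂ : C} (f : X₁ ⟶ Y₁) (g : X₂ ⟶ Y₂),
    dag (f ⊗ₘ g) = dag f ⊗ₘ dag g
  dag_associator : ∀ X Y Z : C, dag (α_ X Y Z).hom = (α_ X Y Z).inv
  dag_leftUnitor : ∀ X : C, dag (λ_ X).hom = (λ_ X).inv
  dag_rightUnitor : ∀ X : C, dag (ρ_ X).hom = (ρ_ X).inv
  eq_zero_of_comp_dag : ∀ {X Y : C} (f : X ⟶ Y), f ≫ dag f = 0 → f = 0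
  exists_comp_dag : ∀ {X Y : C} (f : X ⟶ Y), ∃ g : X ⟶ X, f ≫ dag f = g ≫ dag g
  evT_eq : ∀ X : C, evT X = dag (coev X)

/-- A unitary functor (dagger functor) preserves the dagger. -/
def IsUnitaryFunctor {C : Type u₁} [Category.{v₁} C] [DaggerCategory C]
    {D : Type u₂} [Category.{v₂} D] [DaggerCategory D] (F : C ⥤ D) : Prop :=
  ∀ {X Y : C} (f : X ⟶ Y), F.map (dag f) = dag (F.map f)


/-! ### Full fusion subcategories and the image of a functor -/

section FullSubcategory

variable {D : Type u} [Category.{v} D] [MonoidalCategory D] [LeftRigidCategory D]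

/-- A property of objects that is closed under unit, tensor products, duals. -/
class IsRigidSubcategory (P : ObjectProperty D) : Prop extends P.IsMonoidal where
  prop_dual : ∀ X : D, P X → P (dual X)

variable (P : ObjectProperty D) [IsRigidSubcategory P]

instance : LeftRigidCategory P.FullSubcategory where
  leftDual X :=
    { leftDual := ⟨dual X.obj, IsRigidSubcategory.prop_dual X.obj X.property⟩
      exact :=
        { coevaluation' := ObjectProperty.homMk (coev X.obj)
          evaluation' := ObjectProperty.homMk (ev X.obj)
          coevaluation_evaluation' := by
            ext
            exact ExactPairing.coevaluation_evaluation (dual X.obj) X.obj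
          evaluation_coevaluation' := by
            ext
            exact ExactPairing.evaluation_coevaluation (dual X.obj) X.obj } }

theorem dual_obj (X : P.FullSubcategory) : (dual X).obj = dual X.obj := rfl

theorem ev_hom (X : P.FullSubcategory) : (ev X).hom = ev X.obj := rfl

theorem coev_hom (X : P.FullSubcategory) : (coev X).hom = coev X.obj := rfl

theorem dualMap_hom {X Y : P.FullSubcategory} (f : X ⟶ Y) : (dualMap f).hom = dualMap f.hom := rfl

theorem dualUnitIso_hom_hom :
    (dualUnitIso P.FullSubcategory).hom.hom = (dualUnitIso D).hom := rfl

theorem dualUnitIso_inv_hom :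
    (dualUnitIso P.FullSubcategory).inv.hom = (dualUnitIso D).inv := rfl

theorem dualTensorIso_hom_hom (X Y : P.FullSubcategory) :
    (dualTensorIso X Y).hom.hom = (dualTensorIso X.obj Y.obj).hom := rfl

theorem dualTensorIso_inv_hom (X Y : P.FullSubcategory) :
    (dualTensorIso X Y).inv.hom = (dualTensorIso X.obj Y.obj).inv := rfl

instance [PivotalCategory D] : PivotalCategory P.FullSubcategory where
  piv X := P.isoMk (piv X.obj)
  piv_naturality f := by
    ext
    exact PivotalCategory.piv_naturality f.hom
  piv_tensor X Y := by
    ext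
    exact PivotalCategory.piv_tensor X.obj Y.obj
  piv_unit := by
    ext
    exact PivotalCategory.piv_unit

instance [PivotalCategory D] [SphericalCategory D] : SphericalCategory P.FullSubcategory where
  trace_eq f := by
    ext
    exact SphericalCategory.trace_eq f.hom

instance [BraidedCategory D] [PivotalCategory D] [RibbonCategory D] :
    RibbonCategory P.FullSubcategory where
  twist X := P.isoMk (twist X.obj)
  twist_naturality f := by
    ext
    exact RibbonCategory.twist_naturality f.hom
  twist_tensor X Y := by
    ext
    exact RibbonCategory.twist_tensor X.obj Y.obj
  twist_dual X := by
    ext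
    exact RibbonCategory.twist_dual X.obj
  twist_eq_piv X := by
    ext
    exact RibbonCategory.twist_eq_piv X.obj

end FullSubcategory


section SimpleRetract

variable {D : Type u} [Category.{v} D] [Preadditive D] [Linear ℂ D]

theorem simple_retract {X Z : D} (hZ : IsSimpleObj Z) (a : X ⟶ Z) (b : Z ⟶ X)
    (h : b ≫ a ≠ 0) : Nonempty (Retract Z X) := by
  have h0 : 𝟙 Z ≠ 0 := by
    intro h0
    apply h
    rw [← Category.comp_id a, h0, comp_zero, comp_zero]
  obtain ⟨c, hc⟩ := (finrank_eq_one_iff_of_nonzero' _ h0).1 hZ (b ≫ a)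
  have hc0 : c ≠ 0 := by
    rintro rfl
    rw [zero_smul] at hc
    exact h hc.symm
  refine ⟨⟨c⁻¹ • b, a, ?_⟩⟩
  rw [Linear.smul_comp, ← hc, smul_smul, inv_mul_cancel₀ hc0, one_smul]

/-- A nonzero morphism to a simple object makes it a direct summand. -/
theorem retract_of_hom_ne_zero {ι : Type} [Fintype ι] {Z : ι → D} (hZ : ∀ i, IsSimpleObj (Z i))
    (hΦ : ∀ X Y : D, Function.Bijective
      (fun t : ∀ i, TensorProduct ℂ (X ⟶ Z i) (Z i ⟶ Y) =>
        ∑ i, TensorProduct.lift (Linear.comp (S := ℂ) X (Z i) Y) (t i)))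
    {X : D} {i : ι} (a : X ⟶ Z i) (ha : a ≠ 0) : Nonempty (Retract (Z i) X) := by
  classical
  by_contra hcon
  have hzero : ∀ b : Z i ⟶ X, b ≫ a = 0 := by
    intro b
    by_contra hb
    exact hcon (simple_retract (hZ i) a b hb)
  have hortho : ∀ j, j ≠ i → ∀ b : Z j ⟶ Z i, b = 0 := by
    intro j hj b
    by_contra hb
    let t : ∀ k, TensorProduct ℂ (Z j ⟶ Z k) (Z k ⟶ Z i) :=
      Pi.single j (𝟙 (Z j) ⊗ₜ[ℂ] b) - Pi.single i (b ⊗ₜ[ℂ] 𝟙 (Z i))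
    have ht : t = 0 := by
      apply (hΦ (Z j) (Z i)).1
      have e : ∀ (k : ι) (s : TensorProduct ℂ (Z j ⟶ Z k) (Z k ⟶ Z i)),
          ∑ l, TensorProduct.lift (Linear.comp (S := ℂ) (Z j) (Z l) (Z i))
            ((Pi.single k s : ∀ l, TensorProduct ℂ (Z j ⟶ Z l) (Z l ⟶ Z i)) l) =
          TensorProduct.lift (Linear.comp (S := ℂ) (Z j) (Z k) (Z i)) s := by
        intro k s
        rw [Finset.sum_eq_single k]
        · rw [Pi.single_eq_same]
        · intro l _ hl
          rw [Pi.single_eq_of_ne hl, map_zero]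
        · intro h
          exact absurd (Finset.mem_univ k) h
      simp only [t, Pi.sub_apply, map_sub, Finset.sum_sub_distrib, e, Pi.zero_apply, map_zero,
        Finset.sum_const_zero]
      simp
    have h1 := congrFun ht j
    simp only [t, Pi.sub_apply, Pi.single_eq_same, Pi.single_eq_of_ne hj, sub_zero,
      Pi.zero_apply] at h1
    have h2 := congrArg (TensorProduct.lift (Linear.comp (S := ℂ) (Z j) (Z j) (Z i))) h1
    simp at h2
    exact hb h2
  obtain ⟨t, ht⟩ := (hΦ X X).2 (𝟙 X)
  apply ha
  rw [← Category.id_comp a, ← ht]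
  simp only [Preadditive.sum_comp]
  apply Finset.sum_eq_zero
  intro k _
  induction t k using TensorProduct.induction_on with
  | zero => simp
  | tmul x y =>
    simp only [TensorProduct.lift.tmul, Linear.comp_apply, Linear.leftComp_apply, Category.assoc]
    by_cases hk : k = i
    · subst hk
      rw [hzero, comp_zero]
    · rw [hortho k hk (y ≫ a), comp_zero]
  | add x y hx hy => rw [map_add, Preadditive.add_comp, hx, hy, add_zero]

end SimpleRetract

section FusionSubcategory

variable {D : Type u} [Category.{v} D] [Preadditive D] [Linear ℂ D] [MonoidalCategory D]
  [MonoidalPreadditive D] [MonoidalLinear ℂ D] [LeftRigidCategory D]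

/-- A property of objects whose full subcategory is a fusion subcategory: closed under unit,
tensor products, duals, direct summands and finite direct sums. -/
class IsFusionSubcategory (P : ObjectProperty D) [HasFiniteBiproducts D] : Prop
    extends IsRigidSubcategory P where
  prop_retract : ∀ {X Y : D}, Retract X Y → P Y → P X
  prop_biproduct : ∀ {n : ℕ} (f : Fin n → D), (∀ i, P (f i)) → P (⨁ f)

instance [FinitelySemisimple D] : HasFiniteBiproducts D :=
  FinitelySemisimple.hasFiniteBiproducts

/-- Morphisms in a full subcategory are morphisms in the ambient category. -/
def fullHomEquiv (P : ObjectProperty D) (X Y : P.FullSubcategory) :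
    (X ⟶ Y) ≃ₗ[ℂ] (X.obj ⟶ Y.obj) where
  toFun f := f.hom
  invFun f := ObjectProperty.homMk f
  map_add' _ _ := rfl
  map_smul' _ _ := rfl
  left_inv _ := rfl
  right_inv _ := rfl

variable [FusionCategory D] (P : ObjectProperty D) [IsFusionSubcategory P]

theorem fullSubcategory_hasFiniteBiproducts : HasFiniteBiproducts P.FullSubcategory := by
  refine ⟨fun n => ⟨fun f => ?_⟩⟩
  let g : Fin n → D := fun i => (f i).obj
  let b : Bicone f :=
    { pt := ⟨⨁ g, IsFusionSubcategory.prop_biproduct g fun i => (f i).property⟩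
      π := fun i => ObjectProperty.homMk (biproduct.π g i)
      ι := fun i => ObjectProperty.homMk (biproduct.ι g i)
      ι_π := by
        intro i j
        ext
        by_cases h : i = j
        · subst h
          simp [g]
        · simp [h, biproduct.ι_π_ne g h] }
  refine HasBiproduct.mk ⟨b, isBilimitOfTotal b ?_⟩
  apply (fullHomEquiv P _ _).injective
  rw [map_sum]
  exact biproduct.total (f := g)

instance : FusionCategory P.FullSubcategory where
  finiteDimensional_hom X Y := by
    have := FinitelySemisimple.finiteDimensional_hom X.obj Y.obj
    exact (fullHomEquiv P X Y).symm.finiteDimensional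
  hasFiniteBiproducts := fullSubcategory_hasFiniteBiproducts P
  idempotents_split := by
    have : IsIdempotentComplete D := FinitelySemisimple.idempotents_split
    refine ⟨fun X p hp => ?_⟩
    obtain ⟨Y, i, e, h1, h2⟩ := IsIdempotentComplete.idempotents_split X.obj p.hom
      (congrArg (fun q => InducedCategory.Hom.hom q) hp)
    refine ⟨⟨Y, IsFusionSubcategory.prop_retract ⟨i, e, h1⟩ X.property⟩,
      ObjectProperty.homMk i, ObjectProperty.homMk e, ?_, ?_⟩
    · ext
      exact h1
    · ext
      exact h2
  exists_simples := by
    classical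
    obtain ⟨ι, hι, Z, hZ, hne, hΦ⟩ := FinitelySemisimple.exists_simples (C := D)
    refine ⟨{i : ι // P (Z i)}, inferInstance, fun i => ⟨Z i.1, i.2⟩, ?_, ?_, ?_⟩
    · intro i
      exact (fullHomEquiv P _ _).finrank_eq.trans (hZ i.1)
    · rintro i j ⟨e⟩
      exact Subtype.ext (hne _ _ ⟨P.ι.mapIso e⟩)
    · intro X Y
      have hsub : ∀ i, ¬ P (Z i) → ∀ x : TensorProduct ℂ (X.obj ⟶ Z i) (Z i ⟶ Y.obj), x = 0 := by
        intro i hi x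
        have h0 : ∀ a : X.obj ⟶ Z i, a = 0 := by
          intro a
          by_contra ha
          obtain ⟨r⟩ := retract_of_hom_ne_zero hZ hΦ a ha
          exact hi (IsFusionSubcategory.prop_retract r X.property)
        induction x using TensorProduct.induction_on with
        | zero => rfl
        | tmul a b => rw [h0 a, TensorProduct.zero_tmul]
        | add a b ha hb => rw [ha, hb, add_zero]
      let E : ∀ i : {i : ι // P (Z i)},
          TensorProduct ℂ (X ⟶ (⟨Z i.1, i.2⟩ : P.FullSubcategory)) (⟨Z i.1, i.2⟩ ⟶ Y) ≃ₗ[ℂ]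
            TensorProduct ℂ (X.obj ⟶ Z i.1) (Z i.1 ⟶ Y.obj) := fun i =>
        TensorProduct.congr (fullHomEquiv P X ⟨Z i.1, i.2⟩) (fullHomEquiv P ⟨Z i.1, i.2⟩ Y)
      have hE : ∀ i t, (TensorProduct.lift (Linear.comp (S := ℂ) X
            (⟨Z i.1, i.2⟩ : P.FullSubcategory) Y) t).hom =
          TensorProduct.lift (Linear.comp (S := ℂ) X.obj (Z i.1) Y.obj) (E i t) := by
        intro i t
        induction t using TensorProduct.induction_on with
        | zero => simp
        | tmul a b => rfl
        | add a b ha hb =>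
          rw [map_add, map_add, map_add, ← ha, ← hb]
          rfl
      let ext0 : (∀ i : {i : ι // P (Z i)},
          TensorProduct ℂ (X ⟶ (⟨Z i.1, i.2⟩ : P.FullSubcategory)) (⟨Z i.1, i.2⟩ ⟶ Y)) →
          ∀ i, TensorProduct ℂ (X.obj ⟶ Z i) (Z i ⟶ Y.obj) := fun t i =>
        if h : P (Z i) then E ⟨i, h⟩ (t ⟨i, h⟩) else 0
      have hsum : ∀ t, (∑ i, TensorProduct.lift (Linear.comp (S := ℂ) X
            (⟨Z i.1, i.2⟩ : P.FullSubcategory) Y) (t i)).hom =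
          ∑ i, TensorProduct.lift (Linear.comp (S := ℂ) X.obj (Z i) Y.obj) (ext0 t i) := by
        intro t
        have h1 : (∑ i, TensorProduct.lift (Linear.comp (S := ℂ) X
            (⟨Z i.1, i.2⟩ : P.FullSubcategory) Y) (t i)).hom =
            ∑ i : {i : ι // P (Z i)},
              TensorProduct.lift (Linear.comp (S := ℂ) X.obj (Z i.1) Y.obj) (ext0 t i.1) := by
          refine (map_sum (fullHomEquiv P X Y) _ _).trans (Finset.sum_congr rfl fun i _ => ?_)
          refine (hE i (t i)).trans ?_
          simp only [ext0, i.2, dite_true]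
        rw [h1]
        rw [← Finset.sum_subtype (Finset.univ.filter fun i => P (Z i)) (by simp)
          (fun i => TensorProduct.lift (Linear.comp (S := ℂ) X.obj (Z i) Y.obj) (ext0 t i)),
          Finset.sum_filter]
        refine Finset.sum_congr rfl fun i _ => ?_
        split_ifs with h
        · rfl
        · simp [ext0, h]
      constructor
      · intro t s hts
        have h1 : ext0 t = ext0 s := by
          apply (hΦ X.obj Y.obj).1
          change ∑ i, _ = ∑ i, _
          rw [← hsum t, ← hsum s]
          exact congrArg (fun q => InducedCategory.Hom.hom q) hts
        funext i
        have h2 := congrFun h1 i.1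
        simp only [ext0, i.2, dite_true] at h2
        exact (E i).injective h2
      · intro f
        obtain ⟨s, hs⟩ := (hΦ X.obj Y.obj).2 f.hom
        refine ⟨fun i => (E i).symm (s i.1), ?_⟩
        ext
        refine (hsum _).trans (Eq.trans (Finset.sum_congr rfl fun i _ => ?_) hs)
        congr 1
        by_cases h : P (Z i)
        · simp only [ext0, h, dite_true]
          exact (E ⟨i, h⟩).apply_symm_apply _
        · simp only [ext0, h, dite_false]
          exact (hsub i h _).symm
  simple_unit := (fullHomEquiv P _ _).finrank_eq.trans FusionCategory.simple_unit

end FusionSubcategory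


section Image

variable {C : Type u₁} [Category.{v₁} C] {D : Type u₂} [Category.{v₂} D]

/-- The objects of the image of `F`: the direct summands of the objects `F.obj X`. -/
def imageProperty (F : C ⥤ D) : ObjectProperty D :=
  fun Y => ∃ X : C, Nonempty (Retract Y (F.obj X))

/-- The image category `Im F`, a full subcategory of `D`. -/
abbrev Image (F : C ⥤ D) := (imageProperty F).FullSubcategory

/-- The full inclusion of `Im F` into `D`. -/
abbrev imageInclusion (F : C ⥤ D) : Image F ⥤ D := (imageProperty F).ι

section

variable [MonoidalCategory C] [MonoidalCategory D] (F : C ⥤ D) [F.Monoidal]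

open Functor.LaxMonoidal Functor.OplaxMonoidal

/-- The image of a duality under a monoidal functor. -/
@[reducible]
def mapExactPairing (X Y : C) [ExactPairing X Y] : ExactPairing (F.obj X) (F.obj Y) where
  coevaluation' := ε F ≫ F.map (η_ X Y) ≫ δ F X Y
  evaluation' := μ F Y X ≫ F.map (ε_ X Y) ≫ Functor.OplaxMonoidal.η F
  coevaluation_evaluation' := by
    have h := congrArg (fun f => F.obj Y ◁ ε F ≫ μ F _ _ ≫ F.map f ≫ δ F _ _ ≫
      Functor.OplaxMonoidal.η F ▷ F.obj Y) (ExactPairing.coevaluation_evaluation X Y)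
    simp only [Functor.map_comp, Functor.Monoidal.map_whiskerLeft,
      Functor.Monoidal.map_whiskerRight, Functor.Monoidal.map_associator_inv, Category.assoc,
      Functor.Monoidal.μ_δ_assoc, Functor.Monoidal.map_rightUnitor,
      Functor.Monoidal.map_leftUnitor_inv] at h
    simpa using h
  evaluation_coevaluation' := by
    have h := congrArg (fun f => ε F ▷ F.obj X ≫ μ F _ _ ≫ F.map f ≫ δ F _ _ ≫
      F.obj X ◁ Functor.OplaxMonoidal.η F) (ExactPairing.evaluation_coevaluation X Y)
    simp only [Functor.map_comp, Functor.Monoidal.map_whiskerLeft,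
      Functor.Monoidal.map_whiskerRight, Functor.Monoidal.map_associator, Category.assoc,
      Functor.Monoidal.μ_δ_assoc, Functor.Monoidal.map_leftUnitor,
      Functor.Monoidal.map_rightUnitor_inv] at h
    simpa using h

variable [LeftRigidCategory C] [LeftRigidCategory D]

instance : IsRigidSubcategory (imageProperty F) where
  prop_unit := ⟨𝟙_ C, ⟨Retract.ofIso (Functor.Monoidal.εIso F)⟩⟩
  prop_tensor := by
    rintro Y₁ Y₂ ⟨X₁, ⟨r₁⟩⟩ ⟨X₂, ⟨r₂⟩⟩
    refine ⟨X₁ ⊗ X₂, ⟨Retract.trans ⟨r₁.i ⊗ₘ r₂.i, r₁.r ⊗ₘ r₂.r, ?_⟩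
      (Retract.ofIso (Functor.Monoidal.μIso F X₁ X₂))⟩⟩
    rw [MonoidalCategory.tensorHom_comp_tensorHom, r₁.retract, r₂.retract, id_tensorHom_id]
  prop_dual := by
    rintro Y ⟨X, ⟨r⟩⟩
    refine ⟨dual X, ⟨Retract.trans (Y := dual (F.obj X)) ⟨dualMap r.r, dualMap r.i, ?_⟩
      (Retract.ofIso (leftDualIso (LeftRigidCategory.leftDual (F.obj X)).exact
        (mapExactPairing F (dual X) X)))⟩⟩
    rw [← comp_leftAdjointMate, r.retract, leftAdjointMate_id]

end

variable [Preadditive C] [Linear ℂ C] [MonoidalCategory C]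
  [MonoidalPreadditive C] [MonoidalLinear ℂ C] [LeftRigidCategory C] [FusionCategory C]
  [Preadditive D] [Linear ℂ D] [MonoidalCategory D]
  [MonoidalPreadditive D] [MonoidalLinear ℂ D] [LeftRigidCategory D] [FusionCategory D]

instance (F : C ⥤ D) [F.Additive] [F.Monoidal] : IsFusionSubcategory (imageProperty F) where
  prop_retract := by
    rintro X Y r ⟨Z, ⟨s⟩⟩
    exact ⟨Z, ⟨r.trans s⟩⟩
  prop_biproduct := by
    intro n f hf
    choose X hX using hf
    have r : ∀ i, Retract (f i) (F.obj (X i)) := fun i => (hX i).some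
    refine ⟨⨁ X, ⟨⟨biproduct.desc fun i => (r i).i ≫ F.map (biproduct.ι X i),
      biproduct.lift fun i => F.map (biproduct.π X i) ≫ (r i).r, ?_⟩⟩⟩
    ext i j
    simp only [biproduct.ι_desc_assoc, Category.assoc, biproduct.lift_π, Category.id_comp]
    rw [← F.map_comp_assoc]
    by_cases h : i = j
    · subst h
      simp
    · rw [biproduct.ι_π_ne X (Ne.symm h), biproduct.ι_π_ne f (Ne.symm h)]
      simp

end Image


/-! ### Framed link diagrams -/

section Links

variable {ι : Type}

/-- An oriented strand of a diagram: the link component it belongs to and its direction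
(`true` for upwards, `false` for downwards). -/
abbrev Strand (ι : Type) := ι × Bool

/-- Elementary horizontal slices of an oriented link diagram in general position, read upwards from
a list of strands at the bottom to a list of strands at the top (strands are listed from left to
right). In `over`, the strand going from bottom left to top right crosses over the other one, in
`under` it crosses under it. `cons a s` is `s` with a vertical strand `a` added on its left. -/
inductive Slice (ι : Type) : List (Strand ι) → List (Strand ι) → Type
  | over (a b : Strand ι) (l : List (Strand ι)) : Slice ι (a :: b :: l) (b :: a :: l)
  | under (a b : Strand ι) (l : List (Strand ι)) : Slice ι (a :: b :: l) (b :: a :: l)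
  | cap (i : ι) (l : List (Strand ι)) : Slice ι ((i, true) :: (i, false) :: l) l
  | capT (i : ι) (l : List (Strand ι)) : Slice ι ((i, false) :: (i, true) :: l) l
  | cup (i : ι) (l : List (Strand ι)) : Slice ι l ((i, false) :: (i, true) :: l)
  | cupT (i : ι) (l : List (Strand ι)) : Slice ι l ((i, true) :: (i, false) :: l)
  | cons (a : Strand ι) {l l' : List (Strand ι)} (s : Slice ι l l') : Slice ι (a :: l) (a :: l')

/-- Tangle diagrams: sequences of slices stacked upwards. The framing is the blackboard framing. -/
inductive Tangle (ι : Type) : List (Strand ι) → List (Strand ι) → Type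
  | nil (l : List (Strand ι)) : Tangle ι l l
  | cons {l l' l'' : List (Strand ι)} (s : Slice ι l l') (t : Tangle ι l' l'') : Tangle ι l l''

/-- The positions joined by a strand within a slice: `inl p` is the `p`-th strand at the bottom,
`inr p` the `p`-th strand at the top. -/
inductive Slice.Joins : {l l' : List (Strand ι)} → Slice ι l l' → ℕ ⊕ ℕ → ℕ ⊕ ℕ → Prop
  | over_left (a b l) : Slice.Joins (.over a b l) (.inl 0) (.inr 1)
  | over_right (a b l) : Slice.Joins (.over a b l) (.inl 1) (.inr 0)
  | over_rest (a b l) (p : ℕ) : Slice.Joins (.over a b l) (.inl (p + 2)) (.inr (p + 2))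
  | under_left (a b l) : Slice.Joins (.under a b l) (.inl 0) (.inr 1)
  | under_right (a b l) : Slice.Joins (.under a b l) (.inl 1) (.inr 0)
  | under_rest (a b l) (p : ℕ) : Slice.Joins (.under a b l) (.inl (p + 2)) (.inr (p + 2))
  | cap (i l) : Slice.Joins (.cap i l) (.inl 0) (.inl 1)
  | cap_rest (i l) (p : ℕ) : Slice.Joins (.cap i l) (.inl (p + 2)) (.inr p)
  | capT (i l) : Slice.Joins (.capT i l) (.inl 0) (.inl 1)
  | capT_rest (i l) (p : ℕ) : Slice.Joins (.capT i l) (.inl (p + 2)) (.inr p)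
  | cup (i l) : Slice.Joins (.cup i l) (.inr 0) (.inr 1)
  | cup_rest (i l) (p : ℕ) : Slice.Joins (.cup i l) (.inl p) (.inr (p + 2))
  | cupT (i l) : Slice.Joins (.cupT i l) (.inr 0) (.inr 1)
  | cupT_rest (i l) (p : ℕ) : Slice.Joins (.cupT i l) (.inl p) (.inr (p + 2))
  | cons_first (a) {l l'} (s : Slice ι l l') : Slice.Joins (.cons a s) (.inl 0) (.inr 0)
  | cons_rest (a) {l l'} (s : Slice ι l l') {x y : ℕ ⊕ ℕ} : Slice.Joins s x y →
      Slice.Joins (.cons a s) (Sum.map (· + 1) (· + 1) x) (Sum.map (· + 1) (· + 1) y)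

/-- The strand of a tangle diagram at a given level (a horizontal line between two slices, counted
from below) and position (counted from the left), if there is one. -/
def Tangle.strandAt : {l l' : List (Strand ι)} → Tangle ι l l' → ℕ → ℕ → Option (Strand ι)
  | l, _, .nil _, 0, p => l[p]?
  | _, _, .nil _, _ + 1, _ => none
  | l, _, .cons _ _, 0, p => l[p]?
  | _, _, .cons _ t, k + 1, p => t.strandAt k p

/-- The pairs (level, position) joined by a strand within one slice of a tangle diagram. -/
inductive Tangle.Joins : {l l' : List (Strand ι)} → Tangle ι l l' → ℕ × ℕ → ℕ × ℕ → Prop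
  | here {l l' l''} (s : Slice ι l l') (t : Tangle ι l' l'') {x y : ℕ ⊕ ℕ} : s.Joins x y →
      Tangle.Joins (.cons s t) (Sum.elim (fun p => (0, p)) (fun p => (1, p)) x)
        (Sum.elim (fun p => (0, p)) (fun p => (1, p)) y)
  | later {l l' l''} (s : Slice ι l l') (t : Tangle ι l' l'') {k p m q : ℕ} :
      Tangle.Joins t (k, p) (m, q) → Tangle.Joins (.cons s t) (k + 1, p) (m + 1, q)

/-- The sign `±1` of a direction. -/
def dirSign (b : Bool) : ℚ := if b then 1 else -1

/-- The contribution of the crossing of the strands `a` and `b`, of sign `s` when both point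
upwards, to the linking matrix. -/
def crossingMatrix [DecidableEq ι] (s : ℚ) (a b : Strand ι) : Matrix ι ι ℚ :=
  (s * dirSign a.2 * dirSign b.2 / 2) • (Matrix.single a.1 b.1 1 + Matrix.single b.1 a.1 1)

/-- The contribution of a slice to the linking matrix. -/
def Slice.linking [DecidableEq ι] : {l l' : List (Strand ι)} → Slice ι l l' → Matrix ι ι ℚ
  | _, _, .over a b _ => crossingMatrix 1 a b
  | _, _, .under a b _ => crossingMatrix (-1) a b
  | _, _, .cons _ s => s.linking
  | _, _, .cap _ _ => 0
  | _, _, .capT _ _ => 0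
  | _, _, .cup _ _ => 0
  | _, _, .cupT _ _ => 0

/-- The linking matrix of a diagram: the entry at `i ≠ j` is the linking number, half of the sum
of the signs of the crossings of `i` with `j`; the diagonal entry at `i` is the framing
(writhe), the sum of the signs of the self-crossings of `i`. -/
def Tangle.linking [DecidableEq ι] : {l l' : List (Strand ι)} → Tangle ι l l' → Matrix ι ι ℚ
  | _, _, .nil _ => 0
  | _, _, .cons s t => s.linking + t.linking

end Links

/-- A diagram of an oriented framed link whose components are partitioned into `h₁` dotted
components (1-handles) and `h₂` undotted components (2-handles). Every label `i` occurs in the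
diagram and the strands labelled `i` form one closed curve. -/
structure DottedLink where
  h₁ : ℕ
  h₂ : ℕ
  diagram : Tangle (Fin h₁ ⊕ Fin h₂) [] []
  occurs : ∀ i, ∃ k p b, diagram.strandAt k p = some (i, b)
  connected : ∀ i k p b m q c, diagram.strandAt k p = some (i, b) →
    diagram.strandAt m q = some (i, c) → Relation.EqvGen diagram.Joins (k, p) (m, q)

/-- The nullity of the linking matrix. If the diagram represents a closed four-manifold, by a
handle decomposition with one 0-handle and one 4-handle, this is its number of 3-handles. -/
noncomputable def DottedLink.h₃ (L : DottedLink) : ℕ :=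
  Fintype.card (Fin L.h₁ ⊕ Fin L.h₂) - L.diagram.linking.rank

/-- The Euler characteristic of the closed four-manifold represented by the diagram: the
alternating sum of the numbers of handles, with one 0-handle and one 4-handle. -/
noncomputable def DottedLink.eulerChar (L : DottedLink) : ℤ :=
  1 - L.h₁ + L.h₂ - L.h₃ + 1

/-! ### Evaluation of diagrams -/

section Evaluation

variable {ι : Type} {D : Type u} [Category.{v} D] [MonoidalCategory D] [LeftRigidCategory D]
  [PivotalCategory D]

/-- The object of a labelled strand: `X i` if it points upwards, `(X i)*` if it points
downwards. -/
def strandObj (X : ι → D) : Strand ι → D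
  | (i, true) => X i
  | (i, false) => dual (X i)

/-- The tensor product of the objects of a list of labelled strands. -/
def strandsObj (X : ι → D) : List (Strand ι) → D
  | [] => 𝟙_ D
  | a :: l => strandObj X a ⊗ strandsObj X l

variable [BraidedCategory D]

/-- The morphism of a labelled slice. -/
def Slice.eval (X : ι → D) : {l l' : List (Strand ι)} → Slice ι l l' →
    (strandsObj X l ⟶ strandsObj X l')
  | _, _, .over a b l =>
      (α_ (strandObj X a) (strandObj X b) (strandsObj X l)).inv ≫
        (β_ (strandObj X a) (strandObj X b)).hom ▷ strandsObj X l ≫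
        (α_ (strandObj X b) (strandObj X a) (strandsObj X l)).hom
  | _, _, .under a b l =>
      (α_ (strandObj X a) (strandObj X b) (strandsObj X l)).inv ≫
        (β_ (strandObj X b) (strandObj X a)).inv ▷ strandsObj X l ≫
        (α_ (strandObj X b) (strandObj X a) (strandsObj X l)).hom
  | _, _, .cap i l =>
      (α_ (X i) (dual (X i)) (strandsObj X l)).inv ≫ ev (X i) ▷ strandsObj X l ≫
        (λ_ (strandsObj X l)).hom
  | _, _, .capT i l =>
      (α_ (dual (X i)) (X i) (strandsObj X l)).inv ≫ evT (X i) ▷ strandsObj X l ≫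
        (λ_ (strandsObj X l)).hom
  | _, _, .cup i l =>
      (λ_ (strandsObj X l)).inv ≫ coev (X i) ▷ strandsObj X l ≫
        (α_ (dual (X i)) (X i) (strandsObj X l)).hom
  | _, _, .cupT i l =>
      (λ_ (strandsObj X l)).inv ≫ coevT (X i) ▷ strandsObj X l ≫
        (α_ (X i) (dual (X i)) (strandsObj X l)).hom
  | _, _, .cons a s => strandObj X a ◁ s.eval X

/-- The morphism of a labelled tangle diagram. -/
def Tangle.eval (X : ι → D) : {l l' : List (Strand ι)} → Tangle ι l l' →
    (strandsObj X l ⟶ strandsObj X l')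
  | _, _, .nil l => 𝟙 (strandsObj X l)
  | _, _, .cons s t => s.eval X ≫ t.eval X

end Evaluation

/-! ### Colours -/

/-- Colours: formal complex linear combinations of objects. -/
abbrev Colour (C : Type u) := C →₀ ℂ

section Colours

variable (C : Type u₁) [Category.{v₁} C] [Preadditive C] [Linear ℂ C] [MonoidalCategory C]
  [MonoidalPreadditive C] [MonoidalLinear ℂ C] [LeftRigidCategory C] [FusionCategory C]
  [PivotalCategory C]

/-- The Kirby colour `Ω_C = ∑_{X ∈ Λ_C} dim(X) X`. -/
noncomputable def kirbyColour : Colour C :=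
  ∑ i : SimpleIndex C, Finsupp.single (simpleObj C i) (qdim (simpleObj C i))

variable {C}

/-- The dimension of a colour. -/
noncomputable def Colour.dim (x : Colour C) : ℂ := x.sum fun X a => a * qdim X

/-- The image of a colour under a functor. -/
noncomputable def Colour.map {D : Type u₂} [Category.{v₂} D] (F : C ⥤ D) (x : Colour C) :
    Colour D :=
  Finsupp.mapDomain F.obj x

open Classical in
/-- The transparent part `x'` of a colour `x`: decompose all objects into simple ones (`Z` has
multiplicity `dim Hom(Z, X)` in `X`) and keep the transparent ones. -/
noncomputable def Colour.transparentPart [BraidedCategory C] (x : Colour C) : Colour C :=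
  x.sum fun X a => ∑ i : SimpleIndex C, if IsTransparent (simpleObj C i) then
    Finsupp.single (simpleObj C i) (a * Module.finrank ℂ (simpleObj C i ⟶ X)) else 0

end Colours

/-! ### The invariants -/

section Invariant

variable {C : Type u₁} [Category.{v₁} C] [Preadditive C] [Linear ℂ C] [MonoidalCategory C]
  [MonoidalPreadditive C] [MonoidalLinear ℂ C] [LeftRigidCategory C] [FusionCategory C]
  [PivotalCategory C]
  {D : Type u₂} [Category.{v₂} D] [Preadditive D] [Linear ℂ D] [MonoidalCategory D]
  [MonoidalPreadditive D] [MonoidalLinear ℂ D] [LeftRigidCategory D] [FusionCategory D]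
  [PivotalCategory D] [BraidedCategory D]

open Classical in
/-- The evaluation `⟨L(x, y)⟩` of a diagram whose dotted components are labelled with the colour `x`
and whose other components are labelled with the colour `y`, extended multilinearly from
labellings by objects. -/
noncomputable def DottedLink.eval (L : DottedLink) (x y : Colour D) : ℂ :=
  ∑ X ∈ Fintype.piFinset (fun c : Fin L.h₁ ⊕ Fin L.h₂ =>
      (Sum.elim (fun _ => x) (fun _ => y) c : Colour D).support),
    (∏ c, (Sum.elim (fun _ => x) (fun _ => y) c : Colour D) (X c)) *
      scalar (L.diagram.eval X)

/-- The generalised dichromatic invariant `I_F` of a functor `F : C ⥤ D`. -/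
noncomputable def dichromaticInvariant (F : C ⥤ D) (L : DottedLink) : ℂ :=
  L.eval (kirbyColour D) ((kirbyColour C).map F) /
    ((kirbyColour C).dim ^ ((L.h₂ : ℤ) - (L.h₁ : ℤ)) *
      ((kirbyColour D).dim * ((kirbyColour C).map F).transparentPart.dim) ^ L.h₁)

/-- A square root of `dim(Ω_D) dim((F Ω_C)')` (the principal one; the positive one if this number
is positive). -/
noncomputable def petitNorm (F : C ⥤ D) : ℂ :=
  ((kirbyColour D).dim * ((kirbyColour C).map F).transparentPart.dim) ^ (1 / 2 : ℂ)

/-- Petit's dichromatic invariant `I_0` of a full ribbon inclusion `F : C ⥤ D`. -/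
noncomputable def petitInvariant (F : C ⥤ D) (L : DottedLink) : ℂ :=
  L.eval (kirbyColour D) ((kirbyColour C).map F) /
    ((kirbyColour C).dim ^ L.h₃ *
      petitNorm F ^ ((L.h₁ : ℤ) + (L.h₂ : ℤ) - (L.h₃ : ℤ)))

end Invariant

end Dichromatic

open Dichromatic

namespace Dichromatic

/-! ### Decompositions into direct sums -/

section Decomposition

variable {D : Type u} [Category.{v} D] [Preadditive D]

/-! The invariant sees a colour only through the multiplicities of simple objects in it, and its
normalisation is homogeneous: rescaling the undotted colour by `l` and the dotted one by `m`
multiplies numerator and denominator alike by `m ^ h₁ * l ^ h₂`. So the theorem comes down to two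
facts: functors send Kirby colours to multiples of Kirby colours, and transparent parts scale
accordingly.

Dependence on multiplicities alone (`Tangle.eval_decomposition`, `DottedLink.eval_eq_simpleEval`).
On one component, the identity is written at a single point as the sum of the idempotents of a
direct sum decomposition. An idempotent slides through crossings, caps and cups, so it can be
repeated all along its component, and a component filled with it may as well carry the summand as
label.

Proportionality (`exists_imageMult_eq`). In a unitary fusion category `qdim X` is the scalar of
`coev X` followed by its dagger, hence positive. For a monoidal `F`, the multiplicities of simple
objects in the image of the Kirby colour form an eigenvector for tensoring with each `F.obj Y`, with
eigenvalue `qdim Y`, by duality. If `F` preserves dimensions, these form another eigenvector with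
the same eigenvalue. Tensoring with the sum of all images of simple objects has a strictly positive
matrix on the simple objects of the image, so by Perron–Frobenius the two vectors are proportional.
The same argument inside `C` shows that `F` preserves dimensions at all
(`HasPositiveDimensions.qdim_map`). This yields the passage to `Im F`; the comparison with Petit's
invariant is then a count of exponents.

Modularisation. A ribbon functor `H` preserves evaluations and dimensions, because the pivotal
evaluation is determined by twist, braiding and `ev` (`evT_eq_twist`). Proportionality applies to
`H`, whose image is everything by dominance, and to `F ⋙ H`. The transparent part of a colour is
recovered from its image as the multiplicity of the unit (`dim_transparentPart_eq_mult`):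
transparent objects become multiples of the unit, and non-transparent simple objects have images not
containing it. -/

/-- A decomposition of `X` as a direct sum of the objects `W k`. -/
structure Decomposition (X : D) {K : Type} [Fintype K] (W : K → D) where
  proj : ∀ k, X ⟶ W k
  incl : ∀ k, W k ⟶ X
  incl_proj : ∀ k, incl k ≫ proj k = 𝟙 (W k)
  incl_proj_ne : ∀ k l, k ≠ l → incl k ≫ proj l = 0
  total : ∑ k, proj k ≫ incl k = 𝟙 X

namespace Decomposition

variable {X : D} {K : Type} [Fintype K] {W : K → D}

/-- The image of a decomposition under an additive functor. -/
def map {E : Type u₂} [Category.{v₂} E] [Preadditive E] (d : Decomposition X W) (F : D ⥤ E)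
    [F.Additive] : Decomposition (F.obj X) (fun k => F.obj (W k)) where
  proj k := F.map (d.proj k)
  incl k := F.map (d.incl k)
  incl_proj k := by rw [← F.map_comp, d.incl_proj, F.map_id]
  incl_proj_ne k l h := by rw [← F.map_comp, d.incl_proj_ne k l h, F.map_zero]
  total := by
    simp only [← F.map_comp]
    rw [← F.map_sum, d.total, F.map_id]

theorem sum_comp (d : Decomposition X W) {Y : D} (f : X ⟶ Y) :
    ∑ k, d.proj k ≫ d.incl k ≫ f = f := by
  simp only [← Category.assoc]
  rw [← Preadditive.sum_comp, d.total, Category.id_comp]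

theorem comp_sum (d : Decomposition X W) {Y : D} (f : Y ⟶ X) :
    ∑ k, (f ≫ d.proj k) ≫ d.incl k = f := by
  simp only [Category.assoc]
  rw [← Preadditive.comp_sum, d.total, Category.comp_id]

/-- Morphisms to a direct sum. -/
def homEquiv [Linear ℂ D] (d : Decomposition X W) (Z : D) : (Z ⟶ X) ≃ₗ[ℂ] ∀ k, (Z ⟶ W k) where
  toFun f k := f ≫ d.proj k
  invFun g := ∑ k, g k ≫ d.incl k
  map_add' f g := by ext; simp
  map_smul' c f := by ext; simp
  left_inv f := d.comp_sum f
  right_inv g := by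
    ext k
    change (∑ l, g l ≫ d.incl l) ≫ d.proj k = g k
    rw [Preadditive.sum_comp, Finset.sum_eq_single k]
    · rw [Category.assoc, d.incl_proj, Category.comp_id]
    · intro l _ hl
      rw [Category.assoc, d.incl_proj_ne l k hl, comp_zero]
    · simp

end Decomposition

end Decomposition

/-! ### Schur's lemma, decompositions into simple objects, symmetry of multiplicities. -/

section Semisimple

variable {D : Type u} [Category.{v} D] [Preadditive D] [Linear ℂ D]

theorem IsSimpleObj.id_ne_zero {Z : D} (hZ : IsSimpleObj Z) : 𝟙 Z ≠ 0 := by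
  intro h0
  have : Subsingleton (Z ⟶ Z) :=
    ⟨fun f g => by rw [← Category.comp_id f, ← Category.comp_id g, h0, comp_zero, comp_zero]⟩
  have h : Module.finrank ℂ (Z ⟶ Z) = 1 := hZ
  rw [Module.finrank_zero_of_subsingleton] at h
  exact zero_ne_one h

theorem IsSimpleObj.exists_smul {Z : D} (hZ : IsSimpleObj Z) (f : Z ⟶ Z) : ∃ c : ℂ, c • 𝟙 Z = f :=
  (finrank_eq_one_iff_of_nonzero' _ hZ.id_ne_zero).1 hZ f

/-- Two simple objects related by morphisms with nonzero composite are isomorphic. -/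
theorem IsSimpleObj.nonempty_iso {Y Z : D} (hY : IsSimpleObj Y) (hZ : IsSimpleObj Z)
    (a : Y ⟶ Z) (b : Z ⟶ Y) (h : a ≫ b ≠ 0) : Nonempty (Y ≅ Z) := by
  obtain ⟨c, hc⟩ := hY.exists_smul (a ≫ b)
  have hc0 : c ≠ 0 := by
    rintro rfl
    exact h (by rw [← hc, zero_smul])
  obtain ⟨e, he⟩ := hZ.exists_smul (b ≫ a)
  -- Both composites are scalars; comparing the two bracketings of `a ≫ b ≫ a` identifies them.
  have hce : e = c := by
    have h1 : (a ≫ b) ≫ a = a ≫ (b ≫ a) := Category.assoc _ _ _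
    rw [← hc, ← he, Linear.smul_comp, Linear.comp_smul, Category.id_comp, Category.comp_id] at h1
    have ha : a ≠ 0 := by rintro rfl; exact h zero_comp
    exact (smul_left_injective ℂ ha h1).symm
  subst hce
  refine ⟨⟨a, e⁻¹ • b, ?_, ?_⟩⟩
  · rw [Linear.comp_smul, ← hc, smul_smul, inv_mul_cancel₀ hc0, one_smul]
  · rw [Linear.smul_comp, ← he, smul_smul, inv_mul_cancel₀ hc0, one_smul]

theorem finrank_hom_congr {X X' Y Y' : D} (e : X ≅ X') (f : Y ≅ Y') :
    Module.finrank ℂ (X ⟶ Y) = Module.finrank ℂ (X' ⟶ Y') :=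
  LinearEquiv.finrank_eq
    { toFun := fun g => e.inv ≫ g ≫ f.hom
      invFun := fun g => e.hom ≫ g ≫ f.inv
      map_add' := by intros; simp
      map_smul' := by intros; simp
      left_inv := by intro g; simp
      right_inv := by intro g; simp }

variable (D) [FinitelySemisimple D]

instance (X Y : D) : FiniteDimensional ℂ (X ⟶ Y) := FinitelySemisimple.finiteDimensional_hom X Y

theorem simpleObj_simple (i : SimpleIndex D) : IsSimpleObj (simpleObj D i) :=
  (FinitelySemisimple.exists_simples (C := D)).choose_spec.choose_spec.choose_spec.1 i

variable {D} in
theorem simpleObj_inj {i j : SimpleIndex D} (h : Nonempty (simpleObj D i ≅ simpleObj D j)) :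
    i = j :=
  (FinitelySemisimple.exists_simples (C := D)).choose_spec.choose_spec.choose_spec.2.1 i j h

theorem simpleObj_bijective (X Y : D) : Function.Bijective
    (fun t : ∀ i, TensorProduct ℂ (X ⟶ simpleObj D i) (simpleObj D i ⟶ Y) =>
      ∑ i, TensorProduct.lift (Linear.comp (S := ℂ) X (simpleObj D i) Y) (t i)) :=
  (FinitelySemisimple.exists_simples (C := D)).choose_spec.choose_spec.choose_spec.2.2 X Y

variable {D}

theorem simpleObj_hom_eq_zero {i j : SimpleIndex D} (h : i ≠ j)
    (f : simpleObj D i ⟶ simpleObj D j) : f = 0 := by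
  by_contra hf
  obtain ⟨r⟩ := retract_of_hom_ne_zero (simpleObj_simple D) (simpleObj_bijective D) f hf
  apply h
  refine simpleObj_inj (((simpleObj_simple D j).nonempty_iso (simpleObj_simple D i) r.i r.r ?_).map
    Iso.symm)
  rw [r.retract]
  exact (simpleObj_simple D j).id_ne_zero

theorem finrank_hom (X Y : D) : Module.finrank ℂ (X ⟶ Y) =
    ∑ i : SimpleIndex D, Module.finrank ℂ (X ⟶ simpleObj D i) *
      Module.finrank ℂ (simpleObj D i ⟶ Y) := by
  let L : (∀ i, TensorProduct ℂ (X ⟶ simpleObj D i) (simpleObj D i ⟶ Y)) →ₗ[ℂ] (X ⟶ Y) :=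
    ∑ i, (TensorProduct.lift (Linear.comp (S := ℂ) X (simpleObj D i) Y)).comp (LinearMap.proj i)
  have hL : Function.Bijective L := by
    convert simpleObj_bijective D X Y using 1
    ext t
    simp [L]
  rw [← (LinearEquiv.ofBijective L hL).finrank_eq, Module.finrank_pi_fintype]
  exact Finset.sum_congr rfl fun i _ => Module.finrank_tensorProduct ..

/-- The index type of the simple summands of `X`, with multiplicity. -/
abbrev SummandIndex (X : D) : Type :=
  Σ i : SimpleIndex D, Fin (Module.finrank ℂ (simpleObj D i ⟶ X))

/-- Inclusions are bases of the spaces `simpleObj D i ⟶ X`. Projections are the coefficients of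
these bases in the preimage of `𝟙 X` under the composition bijection; they turn out to be dual to
the inclusions. -/
theorem exists_decomposition (X : D) :
    Nonempty (Decomposition X (fun k : SummandIndex X => simpleObj D k.1)) := by
  classical
  let b := fun i => Module.finBasis ℂ (simpleObj D i ⟶ X)
  obtain ⟨t, ht⟩ := (simpleObj_bijective D X X).2 (𝟙 X)
  have h1 : ∀ i, ∃ a : Fin (Module.finrank ℂ (simpleObj D i ⟶ X)) → (X ⟶ simpleObj D i),
      t i = ∑ k, a k ⊗ₜ[ℂ] b i k := by
    intro i
    induction t i using TensorProduct.induction_on with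
    | zero => exact ⟨0, by simp⟩
    | tmul x y =>
      refine ⟨fun k => (b i).repr y k • x, ?_⟩
      conv_lhs => rw [← (b i).sum_repr y, TensorProduct.tmul_sum]
      simp only [TensorProduct.smul_tmul]
    | add x y hx hy =>
      obtain ⟨p, rfl⟩ := hx
      obtain ⟨q, rfl⟩ := hy
      exact ⟨p + q, by simp [TensorProduct.add_tmul, Finset.sum_add_distrib]⟩
  choose a ha using h1
  have htot : ∑ k : SummandIndex X, a k.1 k.2 ≫ b k.1 k.2 = 𝟙 X := by
    rw [← ht, Fintype.sum_sigma]
    refine Finset.sum_congr rfl fun i _ => ?_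
    rw [ha i, map_sum]
    simp
  have hdual : ∀ j (l m : Fin (Module.finrank ℂ (simpleObj D j ⟶ X))),
      b j l ≫ a j m = if l = m then 𝟙 _ else 0 := by
    intro j l
    have h2 : ∀ m, ∃ c : ℂ, c • 𝟙 _ = b j l ≫ a j m :=
      fun m => (simpleObj_simple D j).exists_smul _
    choose c hc using h2
    -- Composing with the resolution of `𝟙 X` leaves only the terms of type `j`, so `b j l` is
    -- expanded in the basis it belongs to, and its coefficients must be Kronecker deltas.
    have h3 : b j l = ∑ m, c m • b j m := by
      conv_lhs => rw [← Category.comp_id (b j l), ← htot, Fintype.sum_sigma, Preadditive.comp_sum]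
      rw [Finset.sum_eq_single j]
      · rw [Preadditive.comp_sum]
        refine Finset.sum_congr rfl fun m _ => ?_
        rw [← Category.assoc, ← hc, Linear.smul_comp, Category.id_comp]
      · intro i _ hi
        rw [Preadditive.comp_sum]
        refine Finset.sum_eq_zero fun m _ => ?_
        rw [← Category.assoc, simpleObj_hom_eq_zero (Ne.symm hi) (b j l ≫ a i m), zero_comp]
      · simp
    intro m
    have h4 := congrArg (fun z => (b j).repr z m) h3
    simp only [map_sum, map_smul, Module.Basis.repr_self, Finsupp.coe_finsetSum,
      Finset.sum_apply, Finsupp.smul_apply, Finsupp.single_apply, smul_eq_mul, mul_ite, mul_one,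
      mul_zero, Finset.sum_ite_eq', Finset.mem_univ, if_true] at h4
    rw [← hc, ← h4]
    split_ifs <;> simp
  refine ⟨⟨fun k => a k.1 k.2, fun k => b k.1 k.2, ?_, ?_, htot⟩⟩
  · rintro ⟨i, k⟩
    rw [hdual, if_pos rfl]
  · rintro ⟨i, k⟩ ⟨j, l⟩ h
    by_cases hij : i = j
    · subst hij
      have hkl : k ≠ l := by rintro rfl; exact h rfl
      rw [hdual, if_neg hkl]
    · exact simpleObj_hom_eq_zero hij _

/-- A decomposition of `X` into simple objects. -/
noncomputable def decomposition (X : D) :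
    Decomposition X (fun k : SummandIndex X => simpleObj D k.1) :=
  (exists_decomposition X).some

theorem sum_summandIndex (X : D) (f : SimpleIndex D → ℂ) :
    ∑ k : SummandIndex X, f k.1 =
      ∑ i, (Module.finrank ℂ (simpleObj D i ⟶ X) : ℂ) * f i := by
  rw [Fintype.sum_sigma]
  simp

theorem IsSimpleObj.exists_iso_simpleObj {Y : D} (hY : IsSimpleObj Y) :
    ∃ i, Nonempty (Y ≅ simpleObj D i) := by
  by_contra! hcon
  apply hY.id_ne_zero
  rw [← (decomposition Y).total]
  refine Finset.sum_eq_zero fun k _ => ?_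
  by_contra h
  exact (hcon k.1).false (hY.nonempty_iso (simpleObj_simple D k.1) _ _ h).some

/-- A nonzero morphism from a simple object is a split monomorphism. -/
theorem IsSimpleObj.exists_retraction {Y X : D} (hY : IsSimpleObj Y) (f : Y ⟶ X) (hf : f ≠ 0) :
    ∃ g : X ⟶ Y, f ≫ g = 𝟙 Y := by
  obtain ⟨k, hk⟩ : ∃ k, f ≫ (decomposition X).proj k ≠ 0 := by
    by_contra! h
    apply hf
    rw [← (decomposition X).comp_sum f]
    exact Finset.sum_eq_zero fun k _ => by rw [h k, zero_comp]
  obtain ⟨r⟩ := retract_of_hom_ne_zero (simpleObj_simple D) (simpleObj_bijective D) _ hk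
  obtain ⟨e⟩ := (simpleObj_simple D k.1).nonempty_iso hY r.i r.r
    (by rw [r.retract]; exact (simpleObj_simple D k.1).id_ne_zero)
  obtain ⟨c, hc⟩ := hY.exists_smul (f ≫ (decomposition X).proj k ≫ e.hom)
  have hc0 : c ≠ 0 := by
    rintro rfl
    apply hk
    rw [zero_smul] at hc
    rw [← Category.comp_id (f ≫ _), ← e.hom_inv_id, ← Category.assoc, Category.assoc f, ← hc,
      zero_comp]
  refine ⟨c⁻¹ • (decomposition X).proj k ≫ e.hom, ?_⟩
  rw [Linear.comp_smul, ← hc, smul_smul, inv_mul_cancel₀ hc0, one_smul]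

/-- Composition pairs the two spaces into the scalars `End (simpleObj D i)`. The pairing is
nondegenerate on either side: a morphism annihilated by it vanishes on every simple summand of `X`.
-/
theorem finrank_hom_simpleObj_comm (X : D) (i : SimpleIndex D) :
    Module.finrank ℂ (X ⟶ simpleObj D i) = Module.finrank ℂ (simpleObj D i ⟶ X) := by
  have hs := simpleObj_simple D i
  let σ : (simpleObj D i ⟶ simpleObj D i) →ₗ[ℂ] ℂ :=
    (LinearEquiv.ofBijective (LinearMap.toSpanSingleton ℂ _ (𝟙 (simpleObj D i)))
      ⟨smul_left_injective ℂ hs.id_ne_zero, fun f => hs.exists_smul f⟩).symm.toLinearMap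
  have hσ : ∀ f, σ f = 0 → f = 0 := fun f hf => (LinearEquiv.map_eq_zero_iff _).1 hf
  apply le_antisymm
  · let T : (X ⟶ simpleObj D i) →ₗ[ℂ] ((simpleObj D i ⟶ X) →ₗ[ℂ] ℂ) :=
      { toFun := fun f => σ.comp (Linear.rightComp ℂ _ f)
        map_add' := by intros; ext; simp
        map_smul' := by intros; ext; simp }
    have hT : Function.Injective T := by
      rw [← LinearMap.ker_eq_bot, LinearMap.ker_eq_bot']
      intro f hf
      rw [← (decomposition X).sum_comp f]
      refine Finset.sum_eq_zero fun k _ => ?_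
      rw [← comp_zero]
      congr 1
      obtain ⟨j, k⟩ := k
      by_cases hij : j = i
      · subst hij
        exact hσ _ (LinearMap.congr_fun hf _)
      · exact simpleObj_hom_eq_zero hij _
    exact (LinearMap.finrank_le_finrank_of_injective hT).trans (Subspace.dual_finrank_eq).le
  · let T : (simpleObj D i ⟶ X) →ₗ[ℂ] ((X ⟶ simpleObj D i) →ₗ[ℂ] ℂ) :=
      { toFun := fun f => σ.comp (Linear.leftComp ℂ _ f)
        map_add' := by intros; ext; simp
        map_smul' := by intros; ext; simp }
    have hT : Function.Injective T := by
      rw [← LinearMap.ker_eq_bot, LinearMap.ker_eq_bot']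
      intro f hf
      rw [← (decomposition X).comp_sum f]
      refine Finset.sum_eq_zero fun k _ => ?_
      rw [← zero_comp]
      congr 1
      obtain ⟨j, k⟩ := k
      by_cases hij : i = j
      · subst hij
        exact hσ _ (LinearMap.congr_fun hf _)
      · exact simpleObj_hom_eq_zero hij _
    exact (LinearMap.finrank_le_finrank_of_injective hT).trans (Subspace.dual_finrank_eq).le

theorem finrank_hom_comm (X Y : D) :
    Module.finrank ℂ (X ⟶ Y) = Module.finrank ℂ (Y ⟶ X) := by
  rw [finrank_hom, finrank_hom Y X]
  refine Finset.sum_congr rfl fun i _ => ?_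
  rw [finrank_hom_simpleObj_comm X i, finrank_hom_simpleObj_comm Y i, mul_comm]

theorem finrank_hom_pos_iff {X Y : D} :
    0 < Module.finrank ℂ (X ⟶ Y) ↔ ∃ f : X ⟶ Y, f ≠ 0 :=
  Module.finrank_pos_iff_exists_ne_zero

/-- The multiplicity of `Z` in the image of `X` under an additive functor. -/
theorem finrank_hom_map {E : Type u₂} [Category.{v₂} E] [Preadditive E] [Linear ℂ E]
    [FinitelySemisimple E] (F : D ⥤ E) [F.Additive] (Z : E) (X : D) :
    Module.finrank ℂ (Z ⟶ F.obj X) = ∑ i : SimpleIndex D,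
      Module.finrank ℂ (simpleObj D i ⟶ X) * Module.finrank ℂ (Z ⟶ F.obj (simpleObj D i)) := by
  rw [(((decomposition X).map F).homEquiv Z).finrank_eq, Module.finrank_pi_fintype,
    Fintype.sum_sigma]
  refine Finset.sum_congr rfl fun i _ => ?_
  change ∑ _ : Fin (Module.finrank ℂ (simpleObj D i ⟶ X)),
    Module.finrank ℂ (Z ⟶ F.obj (simpleObj D i)) = _
  rw [Finset.sum_const, smul_eq_mul, Finset.card_univ, Fintype.card_fin]

end Semisimple

/-! ### Duals and traces in pivotal categories -/

section Pivotal

variable {C : Type u} [Category.{v} C] [MonoidalCategory C]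

/-- The comparison of two duals is the mate of the identity, hence compatible with the evaluations.
-/
theorem whiskerLeft_leftDualIso_hom {X₁ X₂ Y : C} (p₁ : ExactPairing X₁ Y)
    (p₂ : ExactPairing X₂ Y) : Y ◁ (leftDualIso p₁ p₂).hom ≫ p₂.evaluation' = p₁.evaluation' := by
  have h := @leftAdjointMate_comp_evaluation C _ _ Y Y ⟨X₂⟩ ⟨X₁⟩ (𝟙 Y)
  rw [id_whiskerRight, Category.id_comp] at h
  exact h

theorem leftDualIso_hom_whiskerRight {X₁ X₂ Y : C} (p₁ : ExactPairing X₁ Y)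
    (p₂ : ExactPairing X₂ Y) : p₁.coevaluation' ≫ (leftDualIso p₁ p₂).hom ▷ Y =
      p₂.coevaluation' := by
  have h := @coevaluation_comp_leftAdjointMate C _ _ Y Y ⟨X₂⟩ ⟨X₁⟩ (𝟙 Y)
  rw [whiskerLeft_id, Category.comp_id] at h
  exact h

variable [LeftRigidCategory C]

theorem whiskerRight_ev {X Y : C} (f : X ⟶ Y) :
    f ▷ dual Y ≫ ev Y = X ◁ dualMap f ≫ ev X :=
  (leftAdjointMate_comp_evaluation f).symm

theorem coev_whiskerRight {X Y : C} (f : X ⟶ Y) :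
    coev Y ≫ dualMap f ▷ Y = coev X ≫ dual X ◁ f :=
  coevaluation_comp_leftAdjointMate f

theorem dualMap_id (X : C) : dualMap (𝟙 X) = 𝟙 (dual X) := leftAdjointMate_id

theorem dualMap_comp {X Y Z : C} (f : X ⟶ Y) (g : Y ⟶ Z) :
    dualMap (f ≫ g) = dualMap g ≫ dualMap f := comp_leftAdjointMate

/-- The nested evaluation of a tensor product. -/
theorem dualTensorIso_inv_ev (X Y : C) : (X ⊗ Y) ◁ (dualTensorIso X Y).inv ≫ ev (X ⊗ Y) =
    (α_ X Y (dual Y ⊗ dual X)).hom ≫ X ◁ (α_ Y (dual Y) (dual X)).inv ≫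
      X ◁ (ev Y ▷ dual X) ≫ X ◁ (λ_ (dual X)).hom ≫ ev X := by
  have h := whiskerLeft_leftDualIso_hom (C := C) (X₁ := dual Y ⊗ dual X) (Y := X ⊗ Y)
    ExactPairing.tensor
    (LeftRigidCategory.leftDual (X ⊗ Y)).exact
  refine h.trans ((ExactPairing.tensor_evaluation (X₁ := dual Y) (X₂ := dual X)
    (Y₁ := Y) (Y₂ := X)).trans ?_)
  simp only [ev]
  monoidal

theorem coev_dualTensorIso_hom (X Y : C) : coev (X ⊗ Y) ≫ (dualTensorIso X Y).hom ▷ (X ⊗ Y) =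
    coev Y ≫ dual Y ◁ (λ_ Y).inv ≫ dual Y ◁ (coev X ▷ Y) ≫ dual Y ◁ (α_ (dual X) X Y).hom ≫
      (α_ (dual Y) (dual X) (X ⊗ Y)).inv := by
  have h := leftDualIso_hom_whiskerRight (C := C) (X₂ := dual Y ⊗ dual X) (Y := X ⊗ Y)
    (LeftRigidCategory.leftDual (X ⊗ Y)).exact ExactPairing.tensor
  refine h.trans ((ExactPairing.tensor_coevaluation (X₁ := dual Y) (X₂ := dual X)
    (Y₁ := Y) (Y₂ := X)).trans ?_)
  simp only [coev]
  monoidal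

variable [PivotalCategory C]

theorem piv_naturality {X Y : C} (f : X ⟶ Y) :
    f ≫ (piv Y).hom = (piv X).hom ≫ dualMap (dualMap f) := PivotalCategory.piv_naturality f

theorem piv_inv_naturality {X Y : C} (f : X ⟶ Y) :
    (piv X).inv ≫ f = dualMap (dualMap f) ≫ (piv Y).inv := by
  rw [Iso.inv_comp_eq, ← Category.assoc, ← piv_naturality, Category.assoc, Iso.hom_inv_id,
    Category.comp_id]

/-- Naturality of `piv` reduces sliding over the pivotal cap to sliding over `ev (dual X)`. -/
theorem whiskerLeft_evT {X Y : C} (f : X ⟶ Y) :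
    dual Y ◁ f ≫ evT Y = dualMap f ▷ X ≫ evT X := by
  simp only [evT]
  rw [← whiskerLeft_comp_assoc, piv_naturality, whiskerLeft_comp_assoc, ← whiskerRight_ev,
    whisker_exchange_assoc]

theorem coevT_whiskerRight {X Y : C} (f : X ⟶ Y) :
    coevT X ≫ f ▷ dual X = coevT Y ≫ Y ◁ dualMap f := by
  simp only [coevT, Category.assoc]
  rw [← comp_whiskerRight, piv_inv_naturality, comp_whiskerRight, ← Category.assoc,
    coev_whiskerRight, Category.assoc, whisker_exchange]

/-- The duality between `X` and `X*` given by the pivotal structure. -/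
@[reducible]
def pivotalPairing (X : C) : ExactPairing X (dual X) :=
  exactPairingCongrLeft (piv X)

/-- Both sides equal the loop on `Y` whose dual strand carries `dualMap f` followed by `dualMap g`.
-/
theorem rightTrace_comp_comm {X Y : C} (f : X ⟶ Y) (g : Y ⟶ X) :
    rightTrace (f ≫ g) = rightTrace (g ≫ f) := by
  simp only [rightTrace, comp_whiskerRight, Category.assoc]
  rw [whiskerRight_ev g, ← Category.assoc, coevT_whiskerRight, Category.assoc, whiskerRight_ev f,
    ← whisker_exchange_assoc, whiskerRight_ev g]

theorem piv_tensor_inv (X Y : C) : (piv (X ⊗ Y)).inv = dualMap (dualTensorIso X Y).inv ≫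
    (dualTensorIso (dual Y) (dual X)).hom ≫ ((piv X).inv ⊗ₘ (piv Y).inv) := by
  have h : (piv (X ⊗ Y)).hom ≫ _ = (piv X).hom ⊗ₘ (piv Y).hom := PivotalCategory.piv_tensor X Y
  rw [← cancel_epi (piv (X ⊗ Y)).hom, Iso.hom_inv_id, ← Category.assoc (dualMap _),
    ← Category.assoc, h, MonoidalCategory.tensorHom_comp_tensorHom]
  simp

/-- Monoidality of the pivotal structure enters here, through `piv_tensor_inv`: it lets the pivotal
cup of a tensor product split into two nested cups. -/
theorem coevT_dualTensorIso_hom (X Y : C) :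
    coevT (X ⊗ Y) ≫ (X ⊗ Y) ◁ (dualTensorIso X Y).hom =
      coevT X ≫ X ◁ (λ_ (dual X)).inv ≫ X ◁ (coevT Y ▷ dual X) ≫
        X ◁ (α_ Y (dual Y) (dual X)).hom ≫ (α_ X Y (dual Y ⊗ dual X)).inv := by
  have h1 := coev_whiskerRight (dualTensorIso X Y).inv
  have h2 := coev_dualTensorIso_hom (dual Y) (dual X)
  have h3 : coev (dual (X ⊗ Y)) ≫ (piv (X ⊗ Y)).inv ▷ dual (X ⊗ Y) ≫
      (X ⊗ Y) ◁ (dualTensorIso X Y).hom = coev (dual Y ⊗ dual X) ≫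
        (dualTensorIso (dual Y) (dual X)).hom ▷ (dual Y ⊗ dual X) ≫
          ((piv X).inv ⊗ₘ (piv Y).inv) ▷ (dual Y ⊗ dual X) := by
    rw [piv_tensor_inv, comp_whiskerRight, comp_whiskerRight, Category.assoc, Category.assoc,
      ← Category.assoc, h1, Category.assoc, ← whisker_exchange, ← whisker_exchange_assoc,
      ← whiskerLeft_comp_assoc, Iso.inv_hom_id]
    simp
  simp only [coevT, Category.assoc]
  rw [h3, ← Category.assoc, h2, MonoidalCategory.tensorHom_def']
  simp only [comp_whiskerRight, Category.assoc, whisker_assoc, ← whisker_exchange_assoc]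
  monoidal

/-- The loop of a tensor product is the loop of `Y` nested inside the loop of `X`. The inner loop is
a scalar, whence multiplicativity of dimensions. -/
theorem rightTrace_id_tensor (X Y : C) : rightTrace (𝟙 (X ⊗ Y)) =
    coevT X ≫ X ◁ (λ_ (dual X)).inv ≫ X ◁ (rightTrace (𝟙 Y) ▷ dual X) ≫
      X ◁ (λ_ (dual X)).hom ≫ ev X := by
  have h : rightTrace (𝟙 (X ⊗ Y)) = (coevT (X ⊗ Y) ≫ (X ⊗ Y) ◁ (dualTensorIso X Y).hom) ≫
      (X ⊗ Y) ◁ (dualTensorIso X Y).inv ≫ ev (X ⊗ Y) := by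
    rw [Category.assoc, ← whiskerLeft_comp_assoc, Iso.hom_inv_id]
    simp [rightTrace]
  rw [h, coevT_dualTensorIso_hom, dualTensorIso_inv_ev]
  simp [rightTrace]

end Pivotal

/-! ### Additivity and multiplicativity of dimensions. -/

section Dimension

variable {C : Type u} [Category.{v} C] [Preadditive C] [Linear ℂ C] [MonoidalCategory C]
  [MonoidalPreadditive C] [MonoidalLinear ℂ C] [LeftRigidCategory C] [FusionCategory C]

variable (C) in
theorem id_unit_ne_zero : 𝟙 (𝟙_ C) ≠ 0 :=
  IsSimpleObj.id_ne_zero (FusionCategory.simple_unit (C := C))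

theorem scalar_eq {f : 𝟙_ C ⟶ 𝟙_ C} {c : ℂ} (h : f = c • 𝟙 (𝟙_ C)) : scalar f = c :=
  smul_left_injective ℂ (id_unit_ne_zero C) ((scalar_spec f).trans h)

theorem scalar_sum {K : Type} [Fintype K] (f : K → (𝟙_ C ⟶ 𝟙_ C)) :
    scalar (∑ k, f k) = ∑ k, scalar (f k) := by
  apply scalar_eq
  rw [Finset.sum_smul]
  exact Finset.sum_congr rfl fun k _ => (scalar_spec _).symm

variable [PivotalCategory C]

theorem qdim_congr {X Y : C} (e : X ≅ Y) : qdim X = qdim Y := by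
  rw [qdim, qdim, ← e.hom_inv_id, rightTrace_comp_comm, e.inv_hom_id]

/-- By cyclicity, the trace of the idempotent `proj k ≫ incl k` is that of `incl k ≫ proj k`, the
identity of the summand. -/
theorem qdim_decomposition {X : C} {K : Type} [Fintype K] {W : K → C} (d : Decomposition X W) :
    qdim X = ∑ k, qdim (W k) := by
  simp only [qdim]
  rw [← scalar_sum]
  congr 1
  simp only [← d.incl_proj]
  rw [← d.total]
  simp only [fun k => rightTrace_comp_comm (d.incl k) (d.proj k)]
  simp only [rightTrace, sum_whiskerRight, Preadditive.sum_comp, Preadditive.comp_sum]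

theorem qdim_eq_sum (X : C) : qdim X = ∑ i : SimpleIndex C,
    (Module.finrank ℂ (simpleObj C i ⟶ X) : ℂ) * qdim (simpleObj C i) := by
  rw [qdim_decomposition (decomposition X), sum_summandIndex X fun i => qdim (simpleObj C i)]

theorem qdim_tensor (X Y : C) : qdim (X ⊗ Y) = qdim X * qdim Y := by
  apply scalar_eq
  rw [rightTrace_id_tensor, ← scalar_spec (rightTrace (𝟙 Y)), MonoidalLinear.smul_whiskerRight,
    MonoidalLinear.whiskerLeft_smul, Linear.smul_comp, Linear.comp_smul, Linear.comp_smul,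
    mul_comm, mul_smul]
  congr 1
  rw [qdim, scalar_spec]
  simp [rightTrace]

end Dimension

theorem qdim_map_eq_sum {C : Type u} [Category.{v} C] [Preadditive C] [Linear ℂ C]
    [FinitelySemisimple C] {E : Type u₂} [Category.{v₂} E] [Preadditive E] [Linear ℂ E]
    [MonoidalCategory E] [MonoidalPreadditive E] [MonoidalLinear ℂ E] [LeftRigidCategory E]
    [FusionCategory E] [PivotalCategory E] (F : C ⥤ E) [F.Additive] (X : C) :
    qdim (F.obj X) = ∑ i : SimpleIndex C,
      (Module.finrank ℂ (simpleObj C i ⟶ X) : ℂ) * qdim (F.obj (simpleObj C i)) := by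
  rw [qdim_decomposition ((decomposition X).map F),
    sum_summandIndex X fun i => qdim (F.obj (simpleObj C i))]

/-- The zigzag identity factors `𝟙 X`, up to unitors, through `coev X`. -/
theorem coev_ne_zero {C : Type u} [Category.{v} C] [Preadditive C] [MonoidalCategory C]
    [MonoidalPreadditive C] [LeftRigidCategory C] {X : C} (h : 𝟙 X ≠ 0) : coev X ≠ 0 := by
  intro h0
  apply h
  have h1 : X ◁ coev X ≫ _ = _ := ExactPairing.coevaluation_evaluation (dual X) X
  rw [h0, MonoidalPreadditive.whiskerLeft_zero, zero_comp, eq_comm, Iso.comp_inv_eq,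
    zero_comp] at h1
  rw [← (ρ_ X).inv_hom_id, h1, comp_zero]

/-! ### Positivity of dimensions from the dagger. -/

section Unitary

variable {C : Type u} [Category.{v} C] [Preadditive C] [Linear ℂ C] [MonoidalCategory C]
  [MonoidalPreadditive C] [MonoidalLinear ℂ C] [LeftRigidCategory C] [PivotalCategory C]
  [DaggerCategory C] [UnitaryFusionCategory C]

/-- Nonzero objects of unitary fusion categories have positive dimension. -/
theorem exists_qdim_pos {X : C} (h : 𝟙 X ≠ 0) : ∃ r : ℝ, 0 < r ∧ qdim X = r := by
  -- Sphericity passes to the left trace, where `evT_eq` exhibits a morphism followed by its dagger.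
  have h1 : rightTrace (𝟙 X) = coev X ≫ dag (coev X) := by
    rw [SphericalCategory.trace_eq, ← UnitaryFusionCategory.evT_eq]
    simp [leftTrace]
  -- The C*-condition replaces the composite by one formed from an endomorphism of the unit. That is
  -- a scalar `c`, so the dimension is `‖c‖ ^ 2`.
  obtain ⟨g, hg⟩ := UnitaryFusionCategory.exists_comp_dag (coev X)
  obtain ⟨c, hc⟩ := exists_scalar g
  have h2 : rightTrace (𝟙 X) = ((‖c‖ ^ 2 : ℝ) : ℂ) • 𝟙 (𝟙_ C) := by
    rw [h1, hg, ← hc, UnitaryFusionCategory.dag_smul, Linear.smul_comp, Linear.comp_smul,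
      smul_smul, Category.id_comp, Complex.mul_conj, Complex.normSq_eq_norm_sq]
    congr 1
    exact DaggerCategory.dag_id _
  refine ⟨‖c‖ ^ 2, ?_, scalar_eq h2⟩
  refine lt_of_le_of_ne (sq_nonneg _) fun h0 => coev_ne_zero h ?_
  apply UnitaryFusionCategory.eq_zero_of_comp_dag
  rw [← h1, h2, ← h0]
  simp

end Unitary

/-! ### Eigenvectors of positive matrices -/

section PerronFrobenius

variable {J : Type} [Fintype J] [Nonempty J] {M : J → J → ℝ}

/-- Eigenvectors of a positive matrix for the eigenvalue of a positive eigenvector are unique up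
to scalars. -/
theorem eigenvector_unique (hM : ∀ i j, 0 < M i j) {r : J → ℝ} (hr : ∀ i, 0 < r i) {δ : ℝ}
    (h : ∀ i, ∑ j, M i j * r j = δ * r i) {v : J → ℝ} (hv : ∀ i, ∑ j, M i j * v j = δ * v i) :
    ∃ t : ℝ, ∀ i, v i = t * r i := by
  -- With `t` the smallest ratio, `v - t * r` is a nonnegative eigenvector vanishing at `i₀`. Row
  -- `i₀` of the eigenvalue equation is then a sum of nonnegative terms equal to zero, and
  -- positivity of the row forces the whole vector to vanish.
  obtain ⟨i₀, hi₀⟩ := Finite.exists_min fun i => v i / r i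
  have hw : ∀ i, 0 ≤ v i - v i₀ / r i₀ * r i := fun i => by
    have h1 := mul_le_mul_of_nonneg_right (hi₀ i) (hr i).le
    rw [div_mul_cancel₀ _ (hr i).ne'] at h1
    linarith
  have h0 : ∑ j, M i₀ j * (v j - v i₀ / r i₀ * r j) = 0 := by
    have h1 : ∑ j, M i₀ j * (v j - v i₀ / r i₀ * r j) =
        ∑ j, M i₀ j * v j - v i₀ / r i₀ * ∑ j, M i₀ j * r j := by
      rw [Finset.mul_sum, ← Finset.sum_sub_distrib]
      exact Finset.sum_congr rfl fun j _ => by ring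
    rw [h1, h, hv]
    have := (hr i₀).ne'
    field_simp
    ring
  refine ⟨v i₀ / r i₀, fun i => ?_⟩
  have h2 := (Finset.sum_eq_zero_iff_of_nonneg fun j _ => mul_nonneg (hM i₀ j).le (hw j)).1 h0 i
    (Finset.mem_univ i)
  have h3 := (mul_eq_zero.1 h2).resolve_left (hM i₀ i).ne'
  linarith

/-- Complex version of `eigenvector_unique`. -/
theorem eigenvector_unique_complex (hM : ∀ i j, 0 < M i j) {r : J → ℝ} (hr : ∀ i, 0 < r i) {δ : ℝ}
    (h : ∀ i, ∑ j, M i j * r j = δ * r i) {v : J → ℂ}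
    (hv : ∀ i, ∑ j, (M i j : ℂ) * v j = δ * v i) : ∃ t : ℂ, ∀ i, v i = t * r i := by
  obtain ⟨s, hs⟩ := eigenvector_unique hM hr h (v := fun i => (v i).re) fun i => by
    have h1 := congrArg Complex.re (hv i)
    rw [Complex.re_sum] at h1
    simpa using h1
  obtain ⟨t, ht⟩ := eigenvector_unique hM hr h (v := fun i => (v i).im) fun i => by
    have h1 := congrArg Complex.im (hv i)
    rw [Complex.im_sum] at h1
    simpa using h1
  refine ⟨⟨s, t⟩, fun i => ?_⟩
  apply Complex.ext
  · simpa using hs i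
  · simpa using ht i

/-- Scale `s` by the smallest ratio `r / s`, attained at `i₀`, so that it lies below `r` and touches
it there. Applying row `i₀` of `M` preserves the inequality and compares the eigenvalues. -/
theorem eigenvalue_le (hM : ∀ i j, 0 < M i j) {r s : J → ℝ} (hr : ∀ i, 0 < r i)
    (hs : ∀ i, 0 < s i) {δ ε : ℝ} (h : ∀ i, ∑ j, M i j * r j = δ * r i)
    (h' : ∀ i, ∑ j, M i j * s j = ε * s i) : ε ≤ δ := by
  obtain ⟨i₀, hi₀⟩ := Finite.exists_min fun i => r i / s i
  have hw : ∀ i, r i₀ / s i₀ * s i ≤ r i := fun i => by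
    have h1 := mul_le_mul_of_nonneg_right (hi₀ i) (hs i).le
    rwa [div_mul_cancel₀ _ (hs i).ne'] at h1
  have h1 : r i₀ / s i₀ * ∑ j, M i₀ j * s j ≤ ∑ j, M i₀ j * r j := by
    rw [Finset.mul_sum]
    refine Finset.sum_le_sum fun j _ => ?_
    have := mul_le_mul_of_nonneg_left (hw j) (hM i₀ j).le
    linarith
  rw [h, h'] at h1
  have h2 : r i₀ / s i₀ * (ε * s i₀) = ε * r i₀ := by
    have := (hs i₀).ne'
    field_simp
  rw [h2] at h1
  exact le_of_mul_le_mul_right h1 (hr i₀)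

theorem eigenvalue_unique (hM : ∀ i j, 0 < M i j) {r s : J → ℝ} (hr : ∀ i, 0 < r i)
    (hs : ∀ i, 0 < s i) {δ ε : ℝ} (h : ∀ i, ∑ j, M i j * r j = δ * r i)
    (h' : ∀ i, ∑ j, M i j * s j = ε * s i) : δ = ε :=
  le_antisymm (eigenvalue_le hM hs hr h' h) (eigenvalue_le hM hr hs h h')

end PerronFrobenius

/-! ### Multiplicities in the image of the Kirby colour -/

section ImageMultiplicity

theorem finrank_tensorLeft {E : Type u} [Category.{v} E] [Preadditive E] [Linear ℂ E]
    [MonoidalCategory E] [MonoidalPreadditive E] [MonoidalLinear ℂ E] (X Y Y' Z : E)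
    [ExactPairing Y Y'] :
    Module.finrank ℂ (Y' ⊗ X ⟶ Z) = Module.finrank ℂ (X ⟶ Y ⊗ Z) :=
  LinearEquiv.finrank_eq
    { tensorLeftHomEquiv X Y Y' Z with
      map_add' := by intros; simp [tensorLeftHomEquiv]
      map_smul' := by intros; simp [tensorLeftHomEquiv] }

theorem imageProperty_map {C : Type u₁} [Category.{v₁} C] {E : Type u₂} [Category.{v₂} E]
    (F : C ⥤ E) (X : C) : imageProperty F (F.obj X) :=
  ⟨X, ⟨Retract.refl _⟩⟩

theorem imageProperty_of_finrank_ne_zero {C : Type u₁} [Category.{v₁} C] {E : Type u₂}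
    [Category.{v₂} E] [Preadditive E] [Linear ℂ E] [FinitelySemisimple E] (F : C ⥤ E)
    {Z X : E} (hZ : IsSimpleObj Z)
    (h : Module.finrank ℂ (Z ⟶ X) ≠ 0) (hX : imageProperty F X) : imageProperty F Z := by
  obtain ⟨f, hf⟩ := finrank_hom_pos_iff.1 (Nat.pos_of_ne_zero h)
  obtain ⟨g, hg⟩ := hZ.exists_retraction f hf
  obtain ⟨A, ⟨r⟩⟩ := hX
  exact ⟨A, ⟨Retract.trans ⟨f, g, hg⟩ r⟩⟩

/-- All nonzero objects have positive dimension. -/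
def HasPositiveDimensions (C : Type u) [Category.{v} C] [Preadditive C] [Linear ℂ C]
    [MonoidalCategory C] [MonoidalPreadditive C] [MonoidalLinear ℂ C] [LeftRigidCategory C]
    [FusionCategory C] [PivotalCategory C] : Prop :=
  ∀ X : C, 𝟙 X ≠ 0 → ∃ r : ℝ, 0 < r ∧ qdim X = r

variable {C : Type u₁} [Category.{v₁} C] [Preadditive C] [Linear ℂ C] [MonoidalCategory C]
  [MonoidalPreadditive C] [MonoidalLinear ℂ C] [LeftRigidCategory C] [FusionCategory C]
  {E : Type u₂} [Category.{v₂} E] [Preadditive E] [Linear ℂ E]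
  [MonoidalCategory E] [MonoidalPreadditive E] [MonoidalLinear ℂ E] [LeftRigidCategory E]
  [FusionCategory E]

/-- The unit is simple, so the nonzero coevaluation splits; this makes `Z'` a summand of `Z' ⊗ dual
Z ⊗ Z`. -/
theorem exists_coev_retraction {Z : E} (hZ : 𝟙 Z ≠ 0) : ∃ g, coev Z ≫ g = 𝟙 (𝟙_ E) :=
  IsSimpleObj.exists_retraction (FusionCategory.simple_unit (C := E)) _ (coev_ne_zero hZ)

/-- The source of strict positivity of the Perron–Frobenius matrices. The object `Z' ⊗ dual Z`
belongs to the image, hence is a summand of some `F.obj X`. Tensoring with `Z` gives `Z'` a nonzero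
morphism to `F.obj X ⊗ Z`, and some simple summand of `X` must account for it. -/
theorem exists_finrank_tensor_pos (F : C ⥤ E) [F.Additive] [F.Monoidal] {Z Z' : E}
    (hZ : imageProperty F Z) (hZ' : imageProperty F Z') (h : 𝟙 Z ≠ 0) (h' : 𝟙 Z' ≠ 0) :
    ∃ i, 0 < Module.finrank ℂ (Z' ⟶ F.obj (simpleObj C i) ⊗ Z) := by
  obtain ⟨X, ⟨r⟩⟩ : imageProperty F (Z' ⊗ dual Z) :=
    ObjectProperty.prop_tensor hZ' (IsRigidSubcategory.prop_dual Z hZ)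
  obtain ⟨g, hg⟩ := exists_coev_retraction h
  have h1 : 0 < Module.finrank ℂ (Z' ⟶ (F ⋙ tensorRight Z).obj X) := by
    rw [finrank_hom_pos_iff]
    refine ⟨(ρ_ Z').inv ≫ Z' ◁ coev Z ≫ (α_ Z' (dual Z) Z).inv ≫ r.i ▷ Z, fun h0 => h' ?_⟩
    have h2 := congrArg (fun f => f ≫ r.r ▷ Z ≫ (α_ Z' (dual Z) Z).hom ≫ Z' ◁ g ≫ (ρ_ Z').hom) h0
    simp only [Category.assoc, zero_comp] at h2
    rw [← h2, ← comp_whiskerRight_assoc, r.retract, id_whiskerRight, Category.id_comp,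
      Iso.inv_hom_id_assoc, ← whiskerLeft_comp_assoc, hg]
    simp
  rw [finrank_hom_map] at h1
  obtain ⟨i, -, hi⟩ := Finset.exists_ne_zero_of_sum_ne_zero h1.ne'
  exact ⟨i, Nat.pos_of_ne_zero (right_ne_zero_of_mul hi)⟩

/-- Monoidal functors preserve nonzero objects. -/
theorem map_id_ne_zero (F : C ⥤ E) [F.Additive] [F.Monoidal] {X : C} (hX : 𝟙 X ≠ 0) :
    𝟙 (F.obj X) ≠ 0 := by
  intro h0
  obtain ⟨g, hg⟩ := exists_coev_retraction hX
  apply id_unit_ne_zero E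
  have h1 : 𝟙 (F.obj (dual X ⊗ X)) = 0 := by
    rw [← Functor.Monoidal.δ_μ F (dual X) X,
      ← Category.id_comp (Functor.LaxMonoidal.μ F (dual X) X), ← whiskerLeft_id, h0,
      MonoidalPreadditive.whiskerLeft_zero, zero_comp, comp_zero]
  have h2 : 𝟙 (F.obj (𝟙_ C)) = 0 := by
    rw [← F.map_id, ← hg, F.map_comp, ← Category.id_comp (F.map g), h1, zero_comp, comp_zero]
  rw [← Functor.Monoidal.ε_η F, ← Category.id_comp (Functor.OplaxMonoidal.η F), h2, zero_comp,
    comp_zero]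

variable [PivotalCategory C]

/-- The multiplicity of `Z` in the image of the Kirby colour under `F`. -/
noncomputable def imageMult (F : C ⥤ E) (Z : E) : ℂ :=
  ∑ i : SimpleIndex C, qdim (simpleObj C i) * (Module.finrank ℂ (Z ⟶ F.obj (simpleObj C i)) : ℂ)

/-- The eigenvector equation. Duality moves `F.obj Y` across the morphism space, where monoidality
absorbs it into `F` and the tensor product is expanded in simple objects of `C`. Duality in `C` then
leaves the expansion of `qdim (Y ⊗ simpleObj C k)`, which is multiplicative. -/
theorem sum_finrank_mul_imageMult (F : C ⥤ E) [F.Additive] [F.Monoidal] (Y : C) (Z : E) :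
    ∑ j, (Module.finrank ℂ (simpleObj E j ⟶ F.obj Y ⊗ Z) : ℂ) * imageMult F (simpleObj E j) =
      qdim Y * imageMult F Z := by
  have h1 : ∀ W : C, Module.finrank ℂ (F.obj Y ⊗ Z ⟶ F.obj W) =
      ∑ i, Module.finrank ℂ (W ⟶ Y ⊗ simpleObj C i) *
        Module.finrank ℂ (Z ⟶ F.obj (simpleObj C i)) := by
    intro W
    let := mapExactPairing F (dual Y) Y
    rw [finrank_tensorLeft Z (F.obj (dual Y)) (F.obj Y) (F.obj W),
      finrank_hom_congr (Iso.refl Z) (Functor.Monoidal.μIso F (dual Y) W), finrank_hom_map]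
    refine Finset.sum_congr rfl fun i _ => ?_
    rw [← finrank_tensorLeft (simpleObj C i) (dual Y) Y W, finrank_hom_comm]
  calc
    _ = ∑ i, qdim (simpleObj C i) *
        (Module.finrank ℂ (F.obj Y ⊗ Z ⟶ F.obj (simpleObj C i)) : ℂ) := by
      simp only [imageMult, Finset.mul_sum]
      rw [Finset.sum_comm]
      refine Finset.sum_congr rfl fun i _ => ?_
      rw [finrank_hom, Nat.cast_sum, Finset.mul_sum]
      refine Finset.sum_congr rfl fun j _ => ?_
      rw [finrank_hom_comm (F.obj Y ⊗ Z)]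
      push_cast
      ring
    _ = ∑ k, (∑ i, (Module.finrank ℂ (simpleObj C i ⟶ Y ⊗ simpleObj C k) : ℂ) *
        qdim (simpleObj C i)) * (Module.finrank ℂ (Z ⟶ F.obj (simpleObj C k)) : ℂ) := by
      simp only [h1, Nat.cast_sum, Nat.cast_mul, Finset.mul_sum, Finset.sum_mul]
      rw [Finset.sum_comm]
      exact Finset.sum_congr rfl fun k _ => Finset.sum_congr rfl fun i _ => by ring
    _ = _ := by
      simp only [← qdim_eq_sum, qdim_tensor, imageMult, Finset.mul_sum, mul_assoc]

variable [PivotalCategory E]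

/-- The isomorphism `𝟙 ⊗ 𝟙 ≅ 𝟙` makes this dimension idempotent, and it is not zero. -/
theorem HasPositiveDimensions.qdim_unit (hC : HasPositiveDimensions C) : qdim (𝟙_ C) = 1 := by
  obtain ⟨r, hr, h⟩ := hC (𝟙_ C) (id_unit_ne_zero C)
  have h1 := qdim_tensor (𝟙_ C) (𝟙_ C)
  rw [qdim_congr (λ_ (𝟙_ C))] at h1
  have h2 : qdim (𝟙_ C) ≠ 0 := by
    rw [h]
    exact_mod_cast hr.ne'
  exact (mul_right_cancel₀ h2 (by rw [one_mul, ← h1])).symm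

open Classical in
/-- The image of the Kirby colour of `C` is proportional to the Kirby colour of the image. -/
theorem exists_imageMult_eq (hC : HasPositiveDimensions C) (F : C ⥤ E) [F.Additive] [F.Monoidal]
    (hF : ∀ X, qdim (F.obj X) = qdim X) : ∃ c : ℂ, c ≠ 0 ∧ ∀ j, imageMult F (simpleObj E j) =
      if imageProperty F (simpleObj E j) then c * qdim (simpleObj E j) else 0 := by
  choose δ hδ hd using fun i => hC _ (simpleObj_simple C i).id_ne_zero
  let J := {j : SimpleIndex E // imageProperty F (simpleObj E j)}
  -- The matrix of tensoring with the sum of all images of simple objects. A single image may give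
  -- zero entries; the sum over `k` does not.
  let M : J → J → ℝ := fun i j =>
    ∑ k, (Module.finrank ℂ (simpleObj E j.1 ⟶ F.obj (simpleObj C k) ⊗ simpleObj E i.1) : ℝ)
  let r : SimpleIndex E → ℝ := fun j =>
    ∑ k, δ k * (Module.finrank ℂ (simpleObj E j ⟶ F.obj (simpleObj C k)) : ℝ)
  have hr : ∀ j, imageMult F (simpleObj E j) = r j := fun j => by
    simp only [imageMult, r, hd]
    push_cast
    rfl
  have hM : ∀ i j, 0 < M i j := fun i j => by
    obtain ⟨k, hk⟩ := exists_finrank_tensor_pos F i.2 j.2 (simpleObj_simple E _).id_ne_zero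
      (simpleObj_simple E _).id_ne_zero
    exact Finset.sum_pos' (fun _ _ => Nat.cast_nonneg _)
      ⟨k, Finset.mem_univ k, Nat.cast_pos.2 hk⟩
  have hrpos : ∀ j : J, 0 < r j.1 := fun j => by
    obtain ⟨X, ⟨s⟩⟩ := j.2
    have h1 : 0 < Module.finrank ℂ (simpleObj E j.1 ⟶ F.obj X) := by
      rw [finrank_hom_pos_iff]
      refine ⟨s.i, fun h0 => (simpleObj_simple E j.1).id_ne_zero ?_⟩
      rw [← s.retract, h0, zero_comp]
    rw [finrank_hom_map] at h1
    obtain ⟨i, -, hi⟩ := Finset.exists_ne_zero_of_sum_ne_zero h1.ne'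
    refine Finset.sum_pos' (fun _ _ => mul_nonneg (hδ _).le (Nat.cast_nonneg _))
      ⟨i, Finset.mem_univ i, mul_pos (hδ i) ?_⟩
    exact Nat.cast_pos.2 (Nat.pos_of_ne_zero (right_ne_zero_of_mul hi))
  -- The image is closed under tensor products and summands, so simple objects outside it do not
  -- occur here and the sum over `J` may be extended to all simple objects.
  have hsum : ∀ (i : J) (f : SimpleIndex E → ℂ), ∑ j : J, (M i j : ℂ) * f j.1 =
      ∑ k, ∑ j, (Module.finrank ℂ
        (simpleObj E j ⟶ F.obj (simpleObj C k) ⊗ simpleObj E i.1) : ℂ) * f j := by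
    intro i f
    simp only [M, Complex.ofReal_sum, Complex.ofReal_natCast, Finset.sum_mul]
    rw [Finset.sum_comm]
    refine Finset.sum_congr rfl fun k _ => ?_
    rw [← Finset.sum_subtype (Finset.univ.filter fun j => imageProperty F (simpleObj E j))
      (by simp) (fun j => (Module.finrank ℂ
        (simpleObj E j ⟶ F.obj (simpleObj C k) ⊗ simpleObj E i.1) : ℂ) * f j)]
    refine Finset.sum_subset (Finset.filter_subset _ _) fun j _ hj => ?_
    have h0 : Module.finrank ℂ
        (simpleObj E j ⟶ F.obj (simpleObj C k) ⊗ simpleObj E i.1) = 0 := by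
      by_contra h0
      refine hj (Finset.mem_filter.2 ⟨Finset.mem_univ _, ?_⟩)
      exact imageProperty_of_finrank_ne_zero F (simpleObj_simple E j) h0
        (ObjectProperty.prop_tensor (imageProperty_map F _) i.2)
    rw [h0, Nat.cast_zero, zero_mul]
  have hreig : ∀ i : J, ∑ j : J, M i j * r j.1 = (∑ k, δ k) * r i.1 := fun i => by
    have h1 := hsum i (fun j => imageMult F (simpleObj E j))
    simp only [sum_finrank_mul_imageMult] at h1
    simp only [hr, hd, ← Finset.sum_mul] at h1
    exact_mod_cast h1
  -- Dimensions are a second eigenvector with the same eigenvalue. They are treated as complex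
  -- numbers, since `E` is not assumed to have positive dimensions; the positive vector of the pair
  -- is `r`.
  have hdeig : ∀ i : J, ∑ j : J, (M i j : ℂ) * qdim (simpleObj E j.1) =
      ((∑ k, δ k : ℝ) : ℂ) * qdim (simpleObj E i.1) := fun i => by
    rw [hsum i (fun j => qdim (simpleObj E j))]
    simp only [← qdim_eq_sum, qdim_tensor, hF, hd, ← Finset.sum_mul, Complex.ofReal_sum]
  obtain ⟨j₀, ⟨e⟩⟩ := IsSimpleObj.exists_iso_simpleObj (FusionCategory.simple_unit (C := E))
  have hj₀ : imageProperty F (simpleObj E j₀) :=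
    ⟨𝟙_ C, ⟨Retract.ofIso (e.symm ≪≫ Functor.Monoidal.εIso F)⟩⟩
  have : Nonempty J := ⟨⟨j₀, hj₀⟩⟩
  obtain ⟨t, ht⟩ := eigenvector_unique_complex hM hrpos hreig hdeig
  -- At the unit the dimension is 1, so the dimension vector is not zero.
  have ht0 : t ≠ 0 := by
    rintro rfl
    have h1 := ht ⟨j₀, hj₀⟩
    rw [zero_mul, ← qdim_congr e, qdim_congr (Functor.Monoidal.εIso F), hF, hC.qdim_unit] at h1
    exact one_ne_zero h1
  refine ⟨t⁻¹, inv_ne_zero ht0, fun j => ?_⟩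
  split_ifs with hj
  · rw [ht ⟨j, hj⟩, hr, ← mul_assoc, inv_mul_cancel₀ ht0, one_mul]
  · refine Finset.sum_eq_zero fun k _ => ?_
    have h0 : Module.finrank ℂ (simpleObj E j ⟶ F.obj (simpleObj C k)) = 0 := by
      by_contra h0
      exact hj (imageProperty_of_finrank_ne_zero F (simpleObj_simple E j) h0
        (imageProperty_map F _))
    rw [h0, Nat.cast_zero, mul_zero]

/-- Monoidal functors preserve positive dimensions. -/
theorem HasPositiveDimensions.qdim_map (hC : HasPositiveDimensions C)
    (hE : HasPositiveDimensions E) (F : C ⥤ E) [F.Additive] [F.Monoidal] (X : C) :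
    qdim (F.obj X) = qdim X := by
  choose δ hδ hd using fun i => hC _ (simpleObj_simple C i).id_ne_zero
  choose ε hε hd' using fun i => hE _ (map_id_ne_zero F (simpleObj_simple C i).id_ne_zero)
  -- The matrix of tensoring with the sum of the simple objects of `C`. Both `X ↦ qdim X` and `X ↦
  -- qdim (F.obj X)` are additive and multiplicative, hence give positive eigenvectors.
  let M : SimpleIndex C → SimpleIndex C → ℝ := fun i j =>
    ∑ k, (Module.finrank ℂ (simpleObj C j ⟶ simpleObj C k ⊗ simpleObj C i) : ℝ)
  have hM : ∀ i j, 0 < M i j := fun i j => by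
    obtain ⟨k, hk⟩ := exists_finrank_tensor_pos (𝟭 C) (Z := simpleObj C i) (Z' := simpleObj C j)
      (imageProperty_map (𝟭 C) _) (imageProperty_map (𝟭 C) _) (simpleObj_simple C _).id_ne_zero
      (simpleObj_simple C _).id_ne_zero
    exact Finset.sum_pos' (fun _ _ => Nat.cast_nonneg _)
      ⟨k, Finset.mem_univ k, Nat.cast_pos.2 hk⟩
  have h1 : ∀ i, ∑ j, M i j * δ j = (∑ k, δ k) * δ i := fun i => by
    apply Complex.ofReal_injective
    push_cast
    simp only [M, Complex.ofReal_sum, Complex.ofReal_natCast, Finset.sum_mul]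
    rw [Finset.sum_comm]
    simp only [← hd, ← qdim_eq_sum, qdim_tensor]
  have h2 : ∀ i, ∑ j, M i j * ε j = (∑ k, ε k) * ε i := fun i => by
    apply Complex.ofReal_injective
    push_cast
    simp only [M, Complex.ofReal_sum, Complex.ofReal_natCast, Finset.sum_mul]
    rw [Finset.sum_comm]
    simp only [← hd', ← qdim_map_eq_sum, qdim_congr (Functor.Monoidal.μIso F _ _).symm,
      qdim_tensor]
  obtain ⟨i₀, ⟨e⟩⟩ := IsSimpleObj.exists_iso_simpleObj (FusionCategory.simple_unit (C := C))
  have : Nonempty (SimpleIndex C) := ⟨i₀⟩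
  -- A positive matrix has one eigenvalue with positive eigenvectors, so the two vectors are
  -- proportional; their values at the unit are both 1.
  have h3 := eigenvalue_unique hM hδ hε h1 h2
  rw [← h3] at h2
  obtain ⟨t, ht⟩ := eigenvector_unique hM hδ h1 h2
  have ht1 : t = 1 := by
    have h4 := ht i₀
    have h5 : δ i₀ = 1 := by
      apply Complex.ofReal_injective
      rw [← hd, ← qdim_congr e, hC.qdim_unit, Complex.ofReal_one]
    have h6 : ε i₀ = 1 := by
      apply Complex.ofReal_injective
      rw [← hd', ← qdim_congr (F.mapIso e), qdim_congr (Functor.Monoidal.εIso F).symm,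
        hE.qdim_unit, Complex.ofReal_one]
    rw [h5, h6, mul_one] at h4
    exact h4.symm
  rw [qdim_map_eq_sum F X, qdim_eq_sum X]
  refine Finset.sum_congr rfl fun i _ => ?_
  rw [hd, hd', ht i, ht1, one_mul]

end ImageMultiplicity

/-! ### Inserting endomorphisms into diagrams -/

section LocalNaturality

variable {D : Type u} [Category.{v} D] [MonoidalCategory D]

/-- A morphism to the unit applied to the first two of three tensor factors. -/
def capMor {A B : D} (p : A ⊗ B ⟶ 𝟙_ D) (L : D) : A ⊗ (B ⊗ L) ⟶ L :=
  (α_ A B L).inv ≫ p ▷ L ≫ (λ_ L).hom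

/-- A morphism from the unit creating two tensor factors on the left. -/
def cupMor {A B : D} (p : 𝟙_ D ⟶ A ⊗ B) (L : D) : L ⟶ A ⊗ (B ⊗ L) :=
  (λ_ L).inv ≫ p ▷ L ≫ (α_ A B L).hom

/-- A morphism applied to the first two of three tensor factors. -/
def crossMor {A B A' B' : D} (p : A ⊗ B ⟶ B' ⊗ A') (L : D) : A ⊗ (B ⊗ L) ⟶ B' ⊗ (A' ⊗ L) :=
  (α_ A B L).inv ≫ p ▷ L ≫ (α_ B' A' L).hom

theorem tensorHom_capMor {A B A' B' L L' : D} (f : A ⟶ A') (g : B ⟶ B') (h : L ⟶ L')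
    (p : A' ⊗ B' ⟶ 𝟙_ D) : (f ⊗ₘ (g ⊗ₘ h)) ≫ capMor p L' = capMor ((f ⊗ₘ g) ≫ p) L ≫ h := by
  simp only [capMor, associator_inv_naturality_assoc, comp_whiskerRight, Category.assoc]
  congr 1
  rw [MonoidalCategory.tensorHom_def, Category.assoc, whisker_exchange_assoc,
    leftUnitor_naturality]

theorem cupMor_tensorHom {A B A' B' L L' : D} (f : A ⟶ A') (g : B ⟶ B') (h : L ⟶ L')
    (p : 𝟙_ D ⟶ A ⊗ B) : cupMor p L ≫ (f ⊗ₘ (g ⊗ₘ h)) = h ≫ cupMor (p ≫ (f ⊗ₘ g)) L' := by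
  simp only [cupMor, Category.assoc, comp_whiskerRight]
  rw [← associator_naturality, leftUnitor_inv_naturality_assoc, whisker_exchange_assoc,
    MonoidalCategory.tensorHom_def' _ h, Category.assoc, ← whisker_exchange_assoc]

theorem tensorHom_crossMor {A B A' B' A₁ B₁ A₁' B₁' L L' : D} (f : A ⟶ A') (g : B ⟶ B')
    (h : L ⟶ L') (f₁ : A₁ ⟶ A₁') (g₁ : B₁ ⟶ B₁')
    (p : A' ⊗ B' ⟶ B₁' ⊗ A₁') (q : A ⊗ B ⟶ B₁ ⊗ A₁)
    (hpq : (f ⊗ₘ g) ≫ p = q ≫ (g₁ ⊗ₘ f₁)) :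
    (f ⊗ₘ (g ⊗ₘ h)) ≫ crossMor p L' = crossMor q L ≫ (g₁ ⊗ₘ (f₁ ⊗ₘ h)) := by
  simp only [crossMor, Category.assoc, associator_inv_naturality_assoc]
  rw [← associator_naturality]
  congr 1
  simp only [← Category.assoc]
  congr 1
  rw [MonoidalCategory.tensorHom_def _ h, MonoidalCategory.tensorHom_def' _ h, Category.assoc,
    whisker_exchange, ← comp_whiskerRight_assoc, hpq, comp_whiskerRight, Category.assoc,
    whisker_exchange]

/-- The endomorphism `f` if `m` is true, the identity otherwise. -/
def toggle {D : Type u} [Category.{v} D] {A : D} (m : Bool) (f : A ⟶ A) : A ⟶ A :=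
  if m then f else 𝟙 _

theorem toggle_comp {D : Type u} [Category.{v} D] {A : D} {f : A ⟶ A} (hf : f ≫ f = f)
    (m m' : Bool) : toggle m f ≫ toggle m' f = toggle (m || m') f := by
  cases m <;> cases m' <;> simp [toggle, hf]

theorem tensorHom_comp_tensorHom_of_eq {A B C A' B' C' : D} {f : A ⟶ B} {g : B ⟶ C} {h : A ⟶ C}
    {f' : A' ⟶ B'} {g' : B' ⟶ C'} {h' : A' ⟶ C'} (e : f ≫ g = h) (e' : f' ≫ g' = h') :
    (f ⊗ₘ f') ≫ (g ⊗ₘ g') = h ⊗ₘ h' := by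
  rw [MonoidalCategory.tensorHom_comp_tensorHom, e, e']

variable [LeftRigidCategory D]

/-- A mark on one leg of a turn can be carried to the other leg, where idempotence merges it with a
mark already there. Hence only the disjunction of the marks matters, and likewise for the other caps
and cups. -/
theorem toggle_ev {A : D} {f : A ⟶ A} (hf : f ≫ f = f) (m m' : Bool) :
    (toggle m f ⊗ₘ toggle m' (dualMap f)) ≫ ev A = toggle (m || m') f ▷ dual A ≫ ev A := by
  have h : A ◁ toggle m' (dualMap f) ≫ ev A = toggle m' f ▷ dual A ≫ ev A := by
    cases m'
    · simp [toggle]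
    · exact (whiskerRight_ev f).symm
  rw [MonoidalCategory.tensorHom_def, Category.assoc, h, ← comp_whiskerRight_assoc,
    toggle_comp hf]

theorem coev_toggle {A : D} {f : A ⟶ A} (hf : f ≫ f = f) (m m' : Bool) :
    coev A ≫ (toggle m (dualMap f) ⊗ₘ toggle m' f) = coev A ≫ dual A ◁ toggle (m || m') f := by
  have h : coev A ≫ toggle m (dualMap f) ▷ A = coev A ≫ dual A ◁ toggle m f := by
    cases m
    · simp [toggle]
    · exact coev_whiskerRight f
  rw [MonoidalCategory.tensorHom_def, ← Category.assoc, h, Category.assoc, ← whiskerLeft_comp,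
    toggle_comp hf]

variable [PivotalCategory D]

theorem toggle_evT {A : D} {f : A ⟶ A} (hf : f ≫ f = f) (m m' : Bool) :
    (toggle m (dualMap f) ⊗ₘ toggle m' f) ≫ evT A = dual A ◁ toggle (m || m') f ≫ evT A := by
  have h : toggle m (dualMap f) ▷ A ≫ evT A = dual A ◁ toggle m f ≫ evT A := by
    cases m
    · simp [toggle]
    · exact (whiskerLeft_evT f).symm
  rw [MonoidalCategory.tensorHom_def', Category.assoc, h, ← whiskerLeft_comp_assoc,
    toggle_comp hf, Bool.or_comm]

theorem coevT_toggle {A : D} {f : A ⟶ A} (hf : f ≫ f = f) (m m' : Bool) :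
    coevT A ≫ (toggle m f ⊗ₘ toggle m' (dualMap f)) = coevT A ≫ toggle (m || m') f ▷ dual A := by
  have h : coevT A ≫ A ◁ toggle m' (dualMap f) = coevT A ≫ toggle m' f ▷ dual A := by
    cases m'
    · simp [toggle]
    · exact (coevT_whiskerRight f).symm
  rw [MonoidalCategory.tensorHom_def', ← Category.assoc, h, Category.assoc, ← comp_whiskerRight,
    toggle_comp hf, Bool.or_comm]

end LocalNaturality

section Insertion

variable {ι : Type} {D : Type u} [Category.{v} D] [MonoidalCategory D] [LeftRigidCategory D]

/-- The morphism of a strand given by morphisms of labels in both directions. -/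
def strandMap {X Y : ι → D} (a : ∀ i, X i ⟶ Y i) (b : ∀ i, Y i ⟶ X i) :
    ∀ s : Strand ι, strandObj X s ⟶ strandObj Y s
  | (i, true) => a i
  | (i, false) => dualMap (b i)

/-- The morphism of a list of strands given by morphisms of labels in both directions. -/
def strandsMap {X Y : ι → D} (a : ∀ i, X i ⟶ Y i) (b : ∀ i, Y i ⟶ X i) :
    ∀ l : List (Strand ι), strandsObj X l ⟶ strandsObj Y l
  | [] => 𝟙 _
  | s :: l => strandMap a b s ⊗ₘ strandsMap a b l

variable {X : ι → D} (e : ∀ i, X i ⟶ X i)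

/-- The endomorphisms `e` inserted at the marked positions. -/
def insertion : ∀ (l : List (Strand ι)) (_ : ℕ → Bool), strandsObj X l ⟶ strandsObj X l
  | [], _ => 𝟙 _
  | s :: l, m => toggle (m 0) (strandMap e e s) ⊗ₘ insertion l fun p => m (p + 1)

theorem insertion_false (l : List (Strand ι)) : insertion e l (fun _ => false) = 𝟙 _ := by
  induction l with
  | nil => rfl
  | cons s l ih =>
    rw [insertion, ih]
    simp [toggle, strandsObj]

/-- If the idempotents split, a fully marked row factors through the labels `Y`. -/
theorem insertion_true {Y : ι → D} (a : ∀ i, X i ⟶ Y i) (b : ∀ i, Y i ⟶ X i)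
    (l : List (Strand ι)) : insertion (fun i => a i ≫ b i) l (fun _ => true) =
      strandsMap a b l ≫ strandsMap b a l := by
  induction l with
  | nil => exact (Category.id_comp _).symm
  | cons s l ih =>
    have h : strandMap (fun i => a i ≫ b i) (fun i => a i ≫ b i) s =
        strandMap a b s ≫ strandMap b a s := by
      obtain ⟨i, _ | _⟩ := s
      · exact dualMap_comp _ _
      · rfl
    refine Eq.trans ?_ (MonoidalCategory.tensorHom_comp_tensorHom _ _ _ _).symm
    rw [← h, ← ih]
    rfl

/-- Marks are irrelevant beyond the end of the list and on components where `e` is the identity. -/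
theorem insertion_congr {l : List (Strand ι)} {m m' : ℕ → Bool}
    (h : ∀ p i b, l[p]? = some (i, b) → e i ≠ 𝟙 _ → m p = m' p) :
    insertion e l m = insertion e l m' := by
  induction l generalizing m m' with
  | nil => rfl
  | cons s l ih =>
    rw [insertion, insertion, ih (m := fun p => m (p + 1)) (m' := fun p => m' (p + 1))
      fun p i b hp => h (p + 1) i b (by simpa using hp)]
    congr 1
    obtain ⟨i, b⟩ := s
    by_cases hi : e i = 𝟙 _
    · have h1 : strandMap e e (i, b) = 𝟙 _ := by
        cases b
        · exact (congrArg _ hi).trans (dualMap_id _)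
        · exact hi
      simp [toggle, h1]
    · rw [h 0 i b (by simp) hi]

variable {e} (he : ∀ i, e i ≫ e i = e i)
include he

theorem strandMap_idem (s : Strand ι) : strandMap e e s ≫ strandMap e e s = strandMap e e s := by
  obtain ⟨i, _ | _⟩ := s
  · exact (dualMap_comp _ _).symm.trans (congrArg _ (he i))
  · exact he i

theorem insertion_comp (l : List (Strand ι)) (m m' : ℕ → Bool) :
    insertion e l m ≫ insertion e l m' = insertion e l (fun p => m p || m' p) := by
  induction l generalizing m m' with
  | nil => exact Category.id_comp _
  | cons s l ih =>
    refine (MonoidalCategory.tensorHom_comp_tensorHom _ _ _ _).trans ?_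
    rw [toggle_comp (strandMap_idem he s), ih]
    rfl

variable (e) [PivotalCategory D] [BraidedCategory D]

omit he

/-- A slice with `e` inserted at marked positions at the bottom and at the top. -/
def Slice.evalMarked {l l' : List (Strand ι)} (s : Slice ι l l') (m : ℕ ⊕ ℕ → Bool) :
    strandsObj X l ⟶ strandsObj X l' :=
  insertion e l (fun p => m (.inl p)) ≫ s.eval X ≫ insertion e l' (fun p => m (.inr p))

variable {e}
include he

/-- The function `N` records that the marked slice depends on `m` only through the disjunction of
the marks at the two ends of each strand. Moving a mark from one end to the other therefore changes
nothing. The analogous statements for the other slices serve the same purpose. -/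
theorem Slice.exists_evalMarked_over (a b : Strand ι) (l : List (Strand ι)) :
    ∃ N : Bool → Bool → (ℕ → Bool) → (strandsObj X (a :: b :: l) ⟶ strandsObj X (b :: a :: l)),
      ∀ m, (Slice.over a b l).evalMarked e m = N (m (.inl 1) || m (.inr 0))
        (m (.inl 0) || m (.inr 1)) (fun p => m (.inl (p + 2)) || m (.inr (p + 2))) := by
  refine ⟨fun u v w => (Slice.over a b l).eval X ≫
    (toggle u (strandMap e e b) ⊗ₘ (toggle v (strandMap e e a) ⊗ₘ insertion e l w)), fun m => ?_⟩
  refine (Category.assoc _ _ _).symm.trans ((congrArg (· ≫ _) (tensorHom_crossMor _ _ _ _ _ _ _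
    (BraidedCategory.braiding_naturality _ _))).trans ((Category.assoc _ _ _).trans
      (congrArg (_ ≫ ·) ?_)))
  exact tensorHom_comp_tensorHom_of_eq (toggle_comp (strandMap_idem he b) _ _)
    (tensorHom_comp_tensorHom_of_eq (toggle_comp (strandMap_idem he a) _ _)
      (insertion_comp he l _ _))

theorem Slice.exists_evalMarked_under (a b : Strand ι) (l : List (Strand ι)) :
    ∃ N : Bool → Bool → (ℕ → Bool) → (strandsObj X (a :: b :: l) ⟶ strandsObj X (b :: a :: l)),
      ∀ m, (Slice.under a b l).evalMarked e m = N (m (.inl 1) || m (.inr 0))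
        (m (.inl 0) || m (.inr 1)) (fun p => m (.inl (p + 2)) || m (.inr (p + 2))) := by
  refine ⟨fun u v w => (Slice.under a b l).eval X ≫
    (toggle u (strandMap e e b) ⊗ₘ (toggle v (strandMap e e a) ⊗ₘ insertion e l w)), fun m => ?_⟩
  refine (Category.assoc _ _ _).symm.trans ((congrArg (· ≫ _) (tensorHom_crossMor _ _ _ _ _ _ _
    (BraidedCategory.braiding_inv_naturality _ _))).trans ((Category.assoc _ _ _).trans
      (congrArg (_ ≫ ·) ?_)))
  exact tensorHom_comp_tensorHom_of_eq (toggle_comp (strandMap_idem he b) _ _)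
    (tensorHom_comp_tensorHom_of_eq (toggle_comp (strandMap_idem he a) _ _)
      (insertion_comp he l _ _))

theorem Slice.exists_evalMarked_cap (i : ι) (l : List (Strand ι)) :
    ∃ N : Bool → (ℕ → Bool) → (strandsObj X ((i, true) :: (i, false) :: l) ⟶ strandsObj X l),
      ∀ m, (Slice.cap i l).evalMarked e m = N (m (.inl 0) || m (.inl 1))
        (fun p => m (.inl (p + 2)) || m (.inr p)) := by
  refine ⟨fun u w => capMor (toggle u (e i) ▷ dual (X i) ≫ ev (X i)) (strandsObj X l) ≫
    insertion e l w, fun m => ?_⟩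
  exact (Category.assoc _ _ _).symm.trans ((congrArg (· ≫ _) (tensorHom_capMor _ _ _ _)).trans
    ((Category.assoc _ _ _).trans (congrArg₂ (· ≫ ·)
      (congrArg (capMor · _) (toggle_ev (he i) _ _)) (insertion_comp he l _ _))))

theorem Slice.exists_evalMarked_capT (i : ι) (l : List (Strand ι)) :
    ∃ N : Bool → (ℕ → Bool) → (strandsObj X ((i, false) :: (i, true) :: l) ⟶ strandsObj X l),
      ∀ m, (Slice.capT i l).evalMarked e m = N (m (.inl 0) || m (.inl 1))
        (fun p => m (.inl (p + 2)) || m (.inr p)) := by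
  refine ⟨fun u w => capMor (dual (X i) ◁ toggle u (e i) ≫ evT (X i)) (strandsObj X l) ≫
    insertion e l w, fun m => ?_⟩
  exact (Category.assoc _ _ _).symm.trans ((congrArg (· ≫ _) (tensorHom_capMor _ _ _ _)).trans
    ((Category.assoc _ _ _).trans (congrArg₂ (· ≫ ·)
      (congrArg (capMor · _) (toggle_evT (he i) _ _)) (insertion_comp he l _ _))))

theorem Slice.exists_evalMarked_cup (i : ι) (l : List (Strand ι)) :
    ∃ N : Bool → (ℕ → Bool) → (strandsObj X l ⟶ strandsObj X ((i, false) :: (i, true) :: l)),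
      ∀ m, (Slice.cup i l).evalMarked e m = N (m (.inr 0) || m (.inr 1))
        (fun p => m (.inl p) || m (.inr (p + 2))) := by
  refine ⟨fun u w => insertion e l w ≫ cupMor (coev (X i) ≫ dual (X i) ◁ toggle u (e i))
    (strandsObj X l), fun m => ?_⟩
  exact (congrArg (_ ≫ ·) (cupMor_tensorHom _ _ _ _)).trans ((Category.assoc _ _ _).symm.trans
    (congrArg₂ (· ≫ ·) (insertion_comp he l _ _)
      (congrArg (cupMor · _) (coev_toggle (he i) _ _))))

theorem Slice.exists_evalMarked_cupT (i : ι) (l : List (Strand ι)) :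
    ∃ N : Bool → (ℕ → Bool) → (strandsObj X l ⟶ strandsObj X ((i, true) :: (i, false) :: l)),
      ∀ m, (Slice.cupT i l).evalMarked e m = N (m (.inr 0) || m (.inr 1))
        (fun p => m (.inl p) || m (.inr (p + 2))) := by
  refine ⟨fun u w => insertion e l w ≫ cupMor (coevT (X i) ≫ toggle u (e i) ▷ dual (X i))
    (strandsObj X l), fun m => ?_⟩
  exact (congrArg (_ ≫ ·) (cupMor_tensorHom _ _ _ _)).trans ((Category.assoc _ _ _).symm.trans
    (congrArg₂ (· ≫ ·) (insertion_comp he l _ _)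
      (congrArg (cupMor · _) (coevT_toggle (he i) _ _))))

theorem Slice.exists_evalMarked_cons (a : Strand ι) {l l' : List (Strand ι)} (s : Slice ι l l') :
    ∃ N : Bool → (strandsObj X l ⟶ strandsObj X l') →
        (strandsObj X (a :: l) ⟶ strandsObj X (a :: l')),
      ∀ m, (Slice.cons a s).evalMarked e m = N (m (.inl 0) || m (.inr 0))
        (s.evalMarked e fun x => m (Sum.map (· + 1) (· + 1) x)) := by
  refine ⟨fun u w => toggle u (strandMap e e a) ⊗ₘ w, fun m => ?_⟩
  have h : (Slice.cons a s).eval X = 𝟙 (strandObj X a) ⊗ₘ s.eval X := (id_tensorHom _ _).symm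
  rw [Slice.evalMarked, h]
  exact (congrArg (_ ≫ ·) (tensorHom_comp_tensorHom_of_eq (Category.id_comp _) rfl)).trans
    (tensorHom_comp_tensorHom_of_eq (toggle_comp (strandMap_idem he a) _ _) rfl)

/-- Insertions can be moved along strands within a slice. -/
theorem Slice.evalMarked_update {l l' : List (Strand ι)} {s : Slice ι l l'} {x y : ℕ ⊕ ℕ}
    (h : s.Joins x y) (m : ℕ ⊕ ℕ → Bool) :
    s.evalMarked e (Function.update m x true) = s.evalMarked e (Function.update m y true) := by
  induction h generalizing m with
  | over_left a b l | over_right a b l =>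
    obtain ⟨N, hN⟩ := Slice.exists_evalMarked_over he a b l
    simp [hN]
  | over_rest a b l p =>
    obtain ⟨N, hN⟩ := Slice.exists_evalMarked_over he a b l
    simp [hN, Function.update_apply, Bool.or_left_comm, Bool.or_assoc]
  | under_left a b l | under_right a b l =>
    obtain ⟨N, hN⟩ := Slice.exists_evalMarked_under he a b l
    simp [hN]
  | under_rest a b l p =>
    obtain ⟨N, hN⟩ := Slice.exists_evalMarked_under he a b l
    simp [hN, Function.update_apply, Bool.or_left_comm, Bool.or_assoc]
  | cap i l =>
    obtain ⟨N, hN⟩ := Slice.exists_evalMarked_cap he i l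
    simp [hN]
  | cap_rest i l p =>
    obtain ⟨N, hN⟩ := Slice.exists_evalMarked_cap he i l
    simp [hN, Function.update_apply, Bool.or_left_comm, Bool.or_assoc]
  | capT i l =>
    obtain ⟨N, hN⟩ := Slice.exists_evalMarked_capT he i l
    simp [hN]
  | capT_rest i l p =>
    obtain ⟨N, hN⟩ := Slice.exists_evalMarked_capT he i l
    simp [hN, Function.update_apply, Bool.or_left_comm, Bool.or_assoc]
  | cup i l =>
    obtain ⟨N, hN⟩ := Slice.exists_evalMarked_cup he i l
    simp [hN]
  | cup_rest i l p =>
    obtain ⟨N, hN⟩ := Slice.exists_evalMarked_cup he i l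
    simp [hN, Function.update_apply, Bool.or_left_comm, Bool.or_assoc]
  | cupT i l =>
    obtain ⟨N, hN⟩ := Slice.exists_evalMarked_cupT he i l
    simp [hN]
  | cupT_rest i l p =>
    obtain ⟨N, hN⟩ := Slice.exists_evalMarked_cupT he i l
    simp [hN, Function.update_apply, Bool.or_left_comm, Bool.or_assoc]
  | cons_first a s =>
    obtain ⟨N, hN⟩ := Slice.exists_evalMarked_cons he a s
    have h : (fun x => Function.update m (.inl 0) true (Sum.map (· + 1) (· + 1) x)) =
        fun x => Function.update m (.inr 0) true (Sum.map (· + 1) (· + 1) x) := by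
      ext x
      cases x <;> simp
    rw [hN, hN, h]
    simp
  | @cons_rest a l l' s x y h ih =>
    obtain ⟨N, hN⟩ := Slice.exists_evalMarked_cons he a s
    have h : ∀ x : ℕ ⊕ ℕ, (fun z => Function.update m (Sum.map (· + 1) (· + 1) x) true
        (Sum.map (· + 1) (· + 1) z)) =
          Function.update (fun z => m (Sum.map (· + 1) (· + 1) z)) x true := fun x => by
      ext z
      cases x <;> cases z <;> simp [Function.update_apply]
    have h0 : ∀ x : ℕ ⊕ ℕ, Function.update m (Sum.map (· + 1) (· + 1) x) true (.inl 0) =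
        m (.inl 0) := fun x => by cases x <;> simp
    have h1 : ∀ x : ℕ ⊕ ℕ, Function.update m (Sum.map (· + 1) (· + 1) x) true (.inr 0) =
        m (.inr 0) := fun x => by cases x <;> simp
    rw [hN, hN, h, h, ih, h0, h0, h1, h1]

end Insertion

section TangleInsertion

variable {ι : Type} {D : Type u} [Category.{v} D] [MonoidalCategory D] [LeftRigidCategory D]
  [PivotalCategory D] [BraidedCategory D] {X : ι → D}

/-- A tangle with `e` inserted at marked positions, except at the bottom. -/
def Tangle.evalAbove (e : ∀ i, X i ⟶ X i) : {l l' : List (Strand ι)} → Tangle ι l l' →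
    (ℕ × ℕ → Bool) → (strandsObj X l ⟶ strandsObj X l')
  | _, _, .nil _, _ => 𝟙 _
  | _, _, .cons (l' := l) s t, m => s.eval X ≫ insertion e l (fun p => m (1, p)) ≫
      t.evalAbove e fun x => m (x.1 + 1, x.2)

/-- A tangle with `e` inserted at marked positions. -/
def Tangle.evalMarked (e : ∀ i, X i ⟶ X i) {l l' : List (Strand ι)} (t : Tangle ι l l')
    (m : ℕ × ℕ → Bool) : strandsObj X l ⟶ strandsObj X l' :=
  insertion e l (fun p => m (0, p)) ≫ t.evalAbove e m

variable {e : ∀ i, X i ⟶ X i}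

theorem Tangle.evalAbove_congr {l l' : List (Strand ι)} (t : Tangle ι l l') {m m' : ℕ × ℕ → Bool}
    (h : ∀ k p, m (k + 1, p) = m' (k + 1, p)) : t.evalAbove e m = t.evalAbove e m' := by
  cases t with
  | nil => rfl
  | cons s t => simp only [Tangle.evalAbove, h]

theorem Tangle.evalMarked_cons {l l' l'' : List (Strand ι)} (s : Slice ι l l')
    (t : Tangle ι l' l'') (m : ℕ × ℕ → Bool) : (Tangle.cons s t).evalMarked e m =
      insertion e l (fun p => m (0, p)) ≫ s.eval X ≫
        t.evalMarked e fun x => m (x.1 + 1, x.2) := rfl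

/-- The row above the first slice can be counted with that slice or with the rest of the tangle.
This grouping gives it to the slice, so that marks can be slid within it; `Tangle.evalMarked_cons`
gives it to the rest, for inductions. -/
theorem Tangle.evalMarked_cons' {l l' l'' : List (Strand ι)} (s : Slice ι l l')
    (t : Tangle ι l' l'') (m : ℕ × ℕ → Bool) : (Tangle.cons s t).evalMarked e m =
      s.evalMarked e (fun x => m (Sum.elim (fun p => (0, p)) (fun p => (1, p)) x)) ≫
        t.evalAbove e fun x => m (x.1 + 1, x.2) := by
  simp only [Slice.evalMarked, Category.assoc]
  rfl

theorem Tangle.evalMarked_false {l l' : List (Strand ι)} (t : Tangle ι l l') :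
    t.evalMarked e (fun _ => false) = t.eval X := by
  induction t with
  | nil l => exact (Category.comp_id _).trans (insertion_false e l)
  | cons s t ih => rw [evalMarked_cons, insertion_false, Category.id_comp, ih]; rfl

theorem Tangle.evalMarked_congr {l l' : List (Strand ι)} (t : Tangle ι l l')
    {m m' : ℕ × ℕ → Bool}
    (h : ∀ k p i b, t.strandAt k p = some (i, b) → e i ≠ 𝟙 _ → m (k, p) = m' (k, p)) :
    t.evalMarked e m = t.evalMarked e m' := by
  induction t generalizing m m' with
  | nil l => exact congrArg (· ≫ _) (insertion_congr e fun p i b => h 0 p i b)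
  | cons s t ih =>
    rw [evalMarked_cons, evalMarked_cons, insertion_congr e fun p i b => h 0 p i b,
      ih (m := fun x => m (x.1 + 1, x.2)) (m' := fun x => m' (x.1 + 1, x.2))
        fun k p i b => h (k + 1) p i b]

/-- Allows marks to be spread over a component one position at a time. -/
theorem Tangle.finite_strandAt {l l' : List (Strand ι)} (t : Tangle ι l l') :
    {x : ℕ × ℕ | t.strandAt x.1 x.2 ≠ none}.Finite := by
  have hl : ∀ l : List (Strand ι), ((fun p => ((0 : ℕ), p)) '' {p | l[p]? ≠ none}).Finite :=
    fun l => (Set.finite_lt_nat l.length).subset (fun p hp => by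
      by_contra h
      exact hp (List.getElem?_eq_none (not_lt.1 h))) |>.image _
  induction t with
  | nil l =>
    refine (hl l).subset ?_
    rintro ⟨k, p⟩ h
    cases k with
    | zero => exact ⟨p, h, rfl⟩
    | succ k => exact (h rfl).elim
  | @cons l l' l'' s t ih =>
    refine ((hl l).union (ih.image fun x => (x.1 + 1, x.2))).subset ?_
    rintro ⟨k, p⟩ h
    cases k with
    | zero => exact Or.inl ⟨p, h, rfl⟩
    | succ k => exact Or.inr ⟨(k, p), h, rfl⟩

/-- Insertions can be moved along strands. -/
theorem Tangle.evalMarked_update (he : ∀ i, e i ≫ e i = e i) {l l' : List (Strand ι)}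
    {t : Tangle ι l l'} {x y : ℕ × ℕ} (h : Relation.EqvGen t.Joins x y) (m : ℕ × ℕ → Bool) :
    t.evalMarked e (Function.update m x true) = t.evalMarked e (Function.update m y true) := by
  induction h with
  | refl => rfl
  | symm _ _ _ ih => exact ih.symm
  | trans _ _ _ _ _ ih ih' => exact ih.trans ih'
  | rel x y h =>
    induction h generalizing m with
    | @here l l' l'' s t x y h =>
      have h1 : ∀ x : ℕ ⊕ ℕ, (fun z : ℕ ⊕ ℕ => Function.update m
          (Sum.elim (fun p => ((0 : ℕ), p)) (fun p => (1, p)) x) true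
          (Sum.elim (fun p => (0, p)) (fun p => (1, p)) z)) =
          Function.update (fun z => m (Sum.elim (fun p => (0, p)) (fun p => (1, p)) z)) x true := by
        intro x
        ext z
        cases x <;> cases z <;> simp [Function.update_apply]
      have h2 : ∀ x : ℕ ⊕ ℕ, t.evalAbove e (fun z => Function.update m
          (Sum.elim (fun p => ((0 : ℕ), p)) (fun p => (1, p)) x) true (z.1 + 1, z.2)) =
          t.evalAbove e (fun z => m (z.1 + 1, z.2)) := by
        intro x
        refine Tangle.evalAbove_congr t fun k p => ?_
        cases x <;> simp
      rw [Tangle.evalMarked_cons', Tangle.evalMarked_cons', h1, h1, h2, h2,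
        Slice.evalMarked_update he h]
    | @later l l' l'' s t k p n q h ih =>
      have h1 : ∀ k p, (fun z : ℕ × ℕ => Function.update m (k + 1, p) true (z.1 + 1, z.2)) =
          Function.update (fun z => m (z.1 + 1, z.2)) (k, p) true := by
        intro k p
        ext z
        simp [Function.update_apply, Prod.ext_iff]
      have h2 : ∀ k p, (fun q : ℕ => Function.update m (k + 1, p) true (0, q)) =
          fun q => m (0, q) := by
        intro k p
        ext q
        simp
      rw [Tangle.evalMarked_cons, Tangle.evalMarked_cons, h1, h1, h2, h2, ih]

/-- An idempotent on one component can be inserted at all its positions. -/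
theorem Tangle.evalMarked_component (he : ∀ i, e i ≫ e i = e i) {l l' : List (Strand ι)}
    (t : Tangle ι l l') {c : ι} (hc : ∀ i, i ≠ c → e i = 𝟙 _) {x : ℕ × ℕ}
    (hx : ∀ k p b, t.strandAt k p = some (c, b) → Relation.EqvGen t.Joins x (k, p)) :
    t.evalMarked e (Function.update (fun _ => false) x true) = t.evalMarked e (fun _ => true) := by
  classical
  have hS : {y : ℕ × ℕ | ∃ b, t.strandAt y.1 y.2 = some (c, b)}.Finite :=
    t.finite_strandAt.subset fun y ⟨b, hb⟩ h0 => by rw [hb] at h0; cases h0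
  -- A new mark at `y` can be slid to `x`, where a mark is already present, so adding it is free.
  have h1 : ∀ T : Finset (ℕ × ℕ), (∀ y ∈ T, ∃ b, t.strandAt y.1 y.2 = some (c, b)) →
      t.evalMarked e (fun y => decide (y = x) || decide (y ∈ T)) =
        t.evalMarked e (Function.update (fun _ => false) x true) := by
    intro T
    induction T using Finset.induction_on with
    | empty =>
      intro _
      congr 1
      ext y
      simp [Function.update_apply]
    | insert y T hy ih =>
      intro hT
      obtain ⟨b, hb⟩ := hT y (Finset.mem_insert_self _ _)
      rw [← ih fun z hz => hT z (Finset.mem_insert_of_mem hz)]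
      have h2 := Tangle.evalMarked_update he (hx y.1 y.2 b hb)
        (fun z => decide (z = x) || decide (z ∈ T))
      refine Eq.trans ?_ (h2.symm.trans ?_)
      · congr 1
        ext z
        by_cases hz : z = y <;> simp [hz]
      · congr 1
        ext z
        by_cases hz : z = x <;> simp [hz]
  rw [← h1 hS.toFinset fun y hy => by simpa using hy]
  refine Tangle.evalMarked_congr t fun k p i b hi hne => ?_
  have hic : i = c := by
    by_contra h
    exact hne (hc i h)
  subst hic
  simp only [Bool.or_eq_true, decide_eq_true_eq]
  exact Or.inr (hS.mem_toFinset.2 ⟨b, hi⟩)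

end TangleInsertion

/-! ### Diagrams filled with split idempotents are diagrams labelled by retracts. -/

section Retract

variable {ι : Type} {D : Type u} [Category.{v} D] [MonoidalCategory D] [LeftRigidCategory D]
  {X Y : ι → D} {a : ∀ i, X i ⟶ Y i} {b : ∀ i, Y i ⟶ X i}

theorem dualMap_ev_retract {A B : D} (f : A ⟶ B) (g : B ⟶ A) (h : g ≫ f = 𝟙 B) :
    (g ⊗ₘ dualMap f) ≫ ev A = ev B := by
  rw [MonoidalCategory.tensorHom_def, Category.assoc, ← whiskerRight_ev, ← comp_whiskerRight_assoc,
    h, id_whiskerRight, Category.id_comp]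

theorem coev_dualMap_retract {A B : D} (f : A ⟶ B) (g : B ⟶ A) (h : g ≫ f = 𝟙 B) :
    coev A ≫ (dualMap g ⊗ₘ f) = coev B := by
  rw [MonoidalCategory.tensorHom_def, ← Category.assoc, coev_whiskerRight, Category.assoc,
    ← whiskerLeft_comp, h, whiskerLeft_id, Category.comp_id]

variable (hab : ∀ i, b i ≫ a i = 𝟙 (Y i))

section

include hab

theorem strandsMap_retract (l : List (Strand ι)) : strandsMap b a l ≫ strandsMap a b l = 𝟙 _ := by
  induction l with
  | nil => exact Category.id_comp _
  | cons s l ih =>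
    refine (tensorHom_comp_tensorHom_of_eq ?_ ih).trans (id_tensorHom_id _ _)
    obtain ⟨i, _ | _⟩ := s
    · exact (dualMap_comp _ _).symm.trans ((congrArg _ (hab i)).trans (dualMap_id _))
    · exact hab i

end

variable [PivotalCategory D]

theorem dualMap_evT_retract {A B : D} (f : A ⟶ B) (g : B ⟶ A) (h : g ≫ f = 𝟙 B) :
    (dualMap f ⊗ₘ g) ≫ evT A = evT B := by
  rw [MonoidalCategory.tensorHom_def', Category.assoc, ← whiskerLeft_evT, ← whiskerLeft_comp_assoc,
    h, whiskerLeft_id, Category.id_comp]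

theorem coevT_dualMap_retract {A B : D} (f : A ⟶ B) (g : B ⟶ A) (h : g ≫ f = 𝟙 B) :
    coevT A ≫ (f ⊗ₘ dualMap g) = coevT B := by
  rw [MonoidalCategory.tensorHom_def', ← Category.assoc, ← coevT_whiskerRight, Category.assoc,
    ← comp_whiskerRight, h, id_whiskerRight, Category.comp_id]

variable [BraidedCategory D]
include hab

/-- Evaluation of a slice in retracts of the labels. -/
theorem Slice.eval_retract {l l' : List (Strand ι)} (s : Slice ι l l') :
    strandsMap b a l ≫ s.eval X ≫ strandsMap a b l' = s.eval Y := by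
  induction s
  next s₁ s₂ l =>
    refine (Category.assoc _ _ _).symm.trans ((congrArg (· ≫ _) (tensorHom_crossMor _ _ _ _ _ _ _
      (BraidedCategory.braiding_naturality _ _))).trans ((Category.assoc _ _ _).trans ?_))
    exact (congrArg (_ ≫ ·) (strandsMap_retract hab (s₂ :: s₁ :: l))).trans (Category.comp_id _)
  next s₁ s₂ l =>
    refine (Category.assoc _ _ _).symm.trans ((congrArg (· ≫ _) (tensorHom_crossMor _ _ _ _ _ _ _
      (BraidedCategory.braiding_inv_naturality _ _))).trans ((Category.assoc _ _ _).trans ?_))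
    exact (congrArg (_ ≫ ·) (strandsMap_retract hab (s₂ :: s₁ :: l))).trans (Category.comp_id _)
  next i l =>
    refine (Category.assoc _ _ _).symm.trans ((congrArg (· ≫ _) (tensorHom_capMor _ _ _ _)).trans
      ((Category.assoc _ _ _).trans ?_))
    exact (congrArg₂ (· ≫ ·) (congrArg (capMor · _) (dualMap_ev_retract _ _ (hab i)))
      (strandsMap_retract hab l)).trans (Category.comp_id _)
  next i l =>
    refine (Category.assoc _ _ _).symm.trans ((congrArg (· ≫ _) (tensorHom_capMor _ _ _ _)).trans
      ((Category.assoc _ _ _).trans ?_))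
    exact (congrArg₂ (· ≫ ·) (congrArg (capMor · _) (dualMap_evT_retract _ _ (hab i)))
      (strandsMap_retract hab l)).trans (Category.comp_id _)
  next i l =>
    refine (congrArg (_ ≫ ·) (cupMor_tensorHom _ _ _ _)).trans ((Category.assoc _ _ _).symm.trans ?_)
    exact (congrArg₂ (· ≫ ·) (strandsMap_retract hab l)
      (congrArg (cupMor · _) (coev_dualMap_retract _ _ (hab i)))).trans (Category.id_comp _)
  next i l =>
    refine (congrArg (_ ≫ ·) (cupMor_tensorHom _ _ _ _)).trans ((Category.assoc _ _ _).symm.trans ?_)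
    exact (congrArg₂ (· ≫ ·) (strandsMap_retract hab l)
      (congrArg (cupMor · _) (coevT_dualMap_retract _ _ (hab i)))).trans (Category.id_comp _)
  next s₁ l l' s ih =>
    have h : (Slice.cons s₁ s).eval X = 𝟙 (strandObj X s₁) ⊗ₘ s.eval X := (id_tensorHom _ _).symm
    have h' : (Slice.cons s₁ s).eval Y = 𝟙 (strandObj Y s₁) ⊗ₘ s.eval Y := (id_tensorHom _ _).symm
    rw [h, h']
    refine (congrArg (_ ≫ ·) (tensorHom_comp_tensorHom_of_eq (Category.id_comp _) rfl)).trans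
      (tensorHom_comp_tensorHom_of_eq ?_ ih)
    obtain ⟨i, _ | _⟩ := s₁
    · exact (dualMap_comp _ _).symm.trans ((congrArg _ (hab i)).trans (dualMap_id _))
    · exact hab i

/-- Each marked row factors through the labels `Y`. Regrouping the factors sandwiches every slice
between an inclusion and a projection, which turns it into the slice for `Y`. -/
theorem Tangle.strandsMap_evalAbove {l l' : List (Strand ι)} (t : Tangle ι l l') :
    strandsMap b a l ≫ t.evalAbove (fun i => a i ≫ b i) (fun _ => true) =
      t.eval Y ≫ strandsMap b a l' := by
  induction t with
  | nil l => exact (Category.comp_id _).trans (Category.id_comp _).symm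
  | @cons l l' l'' s t ih =>
    rw [Tangle.evalAbove, insertion_true, Category.assoc, ih, Tangle.eval,
      ← Slice.eval_retract hab s]
    simp only [Category.assoc]

/-- The evaluation of a closed diagram with an idempotent inserted everywhere. -/
theorem Tangle.evalMarked_true (t : Tangle ι [] []) :
    (t.evalMarked (fun i => a i ≫ b i) (fun _ => true) : 𝟙_ D ⟶ 𝟙_ D) = t.eval Y := by
  have h := Tangle.strandsMap_evalAbove hab t
  exact h.trans (Category.comp_id _)

end Retract

/-! ### Additivity of the evaluation in each component -/

section Additivity

variable {ι : Type} {D : Type u} [Category.{v} D] [Preadditive D] [MonoidalCategory D]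
  [MonoidalPreadditive D] [LeftRigidCategory D] {X : ι → D} {K : Type} [Fintype K]
  {e : K → ∀ i, X i ⟶ X i} {c : ι}

theorem dualMap_sum {A B : D} (f : K → (A ⟶ B)) : dualMap (∑ k, f k) = ∑ k, dualMap (f k) := by
  simp only [dualMap, leftAdjointMate, whiskerLeft_sum, sum_whiskerRight, Preadditive.comp_sum,
    Preadditive.sum_comp]

/-- Additivity in the family `e` relies on a single marked position; with several marks cross terms
would appear. This is why the sum is inserted at one point and each summand is spread afterwards. -/
theorem sum_insertion (he : ∑ k, e k c = 𝟙 (X c)) {l : List (Strand ι)} {p : ℕ} {b : Bool}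
    (hp : l[p]? = some (c, b)) :
    ∑ k, insertion (e k) l (Function.update (fun _ => false) p true) = 𝟙 _ := by
  induction l generalizing p with
  | nil => simp at hp
  | cons s l ih =>
    cases p with
    | zero =>
      obtain rfl : s = (c, b) := by simpa using hp
      have h0 : ∀ k, insertion (e k) ((c, b) :: l) (Function.update (fun _ => false) 0 true) =
          strandMap (e k) (e k) (c, b) ▷ strandsObj X l := fun k => by
        have h1 : (fun p => Function.update (fun _ => false) 0 true (p + 1)) =
            fun _ : ℕ => false := by
          ext p
          simp
        rw [insertion, h1, insertion_false, tensorHom_id, Function.update_self]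
        rfl
      have h2 : ∑ k, strandMap (e k) (e k) (c, b) = 𝟙 (strandObj X (c, b)) := by
        cases b
        · exact (dualMap_sum _).symm.trans ((congrArg _ he).trans (dualMap_id _))
        · exact he
      rw [Finset.sum_congr rfl fun k _ => h0 k]
      exact (sum_whiskerRight _ _ _).symm.trans ((congrArg (· ▷ _) h2).trans (id_whiskerRight _ _))
    | succ p =>
      have h0 : ∀ k, insertion (e k) (s :: l) (Function.update (fun _ => false) (p + 1) true) =
          strandObj X s ◁ insertion (e k) l (Function.update (fun _ => false) p true) := fun k => by
        have h1 : (fun q => Function.update (fun _ => false) (p + 1) true (q + 1)) =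
            (Function.update (fun _ => false) p true : ℕ → Bool) := by
          ext q
          simp [Function.update_apply]
        rw [insertion, h1, ← id_tensorHom]
        rfl
      rw [Finset.sum_congr rfl fun k _ => h0 k]
      exact (whiskerLeft_sum _ _ _).symm.trans
        ((congrArg (_ ◁ ·) (ih (by simpa using hp))).trans (whiskerLeft_id _ _))

variable [PivotalCategory D] [BraidedCategory D]

theorem Tangle.sum_evalMarked (he : ∑ k, e k c = 𝟙 (X c)) {l l' : List (Strand ι)}
    (t : Tangle ι l l') {x : ℕ × ℕ} {b : Bool} (hx : t.strandAt x.1 x.2 = some (c, b)) :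
    ∑ k, t.evalMarked (e k) (Function.update (fun _ => false) x true) = t.eval X := by
  obtain ⟨n, p⟩ := x
  induction t generalizing n with
  | nil l =>
    cases n with
    | zero =>
      have h1 : (fun q => Function.update (fun _ => false) ((0 : ℕ), p) true (0, q)) =
          (Function.update (fun _ => false) p true : ℕ → Bool) := by
        ext q
        simp [Function.update_apply]
      simp only [Tangle.evalMarked, Tangle.evalAbove, Category.comp_id, h1]
      exact sum_insertion he hx
    | succ n => exact (Option.some_ne_none _ hx.symm).elim
  | cons s t ih =>
    cases n with
    | zero =>
      have h1 : (fun q => Function.update (fun _ => false) ((0 : ℕ), p) true (0, q)) =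
          (Function.update (fun _ => false) p true : ℕ → Bool) := by
        ext q
        simp [Function.update_apply]
      have h2 : (fun x : ℕ × ℕ => Function.update (fun _ => false) ((0 : ℕ), p) true
          (x.1 + 1, x.2)) = fun _ => false := by
        ext x
        simp
      simp only [Tangle.evalMarked_cons, h1, h2, Tangle.evalMarked_false]
      rw [← Preadditive.sum_comp, sum_insertion he hx, Category.id_comp]
      rfl
    | succ n =>
      have h1 : (fun q => Function.update (fun _ => false) (n + 1, p) true (0, q)) =
          fun _ : ℕ => false := by
        ext q
        simp
      have h2 : (fun x : ℕ × ℕ => Function.update (fun _ => false) (n + 1, p) true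
          (x.1 + 1, x.2)) = Function.update (fun _ => false) (n, p) true := by
        ext x
        simp [Function.update_apply, Prod.ext_iff]
      simp only [Tangle.evalMarked_cons, h1, h2, insertion_false, Category.id_comp]
      rw [← Preadditive.comp_sum, ih n hx]
      rfl

/-- The evaluation of a closed diagram is additive in the label of each component. -/
theorem Tangle.eval_decomposition [DecidableEq ι] (t : Tangle ι [] [])
    (hoccurs : ∃ k p b, t.strandAt k p = some (c, b))
    (hconn : ∀ k p b m q c', t.strandAt k p = some (c, b) → t.strandAt m q = some (c, c') →
      Relation.EqvGen t.Joins (k, p) (m, q))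
    {W : K → D} (d : Decomposition (X c) W) :
    (t.eval X : 𝟙_ D ⟶ 𝟙_ D) = ∑ k, (t.eval (Function.update X c (W k)) : 𝟙_ D ⟶ 𝟙_ D) := by
  obtain ⟨n, p, b, hnp⟩ := hoccurs
  -- Retract data for relabelling component `c` by `W k`: the given summand at `c` and identities
  -- elsewhere. The `eqToHom`s transport along `i = c`.
  have h : ∀ k i, ∃ (f : X i ⟶ Function.update X c (W k) i)
      (g : Function.update X c (W k) i ⟶ X i), g ≫ f = 𝟙 _ ∧
        (i ≠ c → f ≫ g = 𝟙 _) ∧ ∀ h : i = c, f ≫ g =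
          eqToHom (congrArg X h) ≫ (d.proj k ≫ d.incl k) ≫ eqToHom (congrArg X h.symm) := by
    intro k i
    by_cases hi : i = c
    · subst hi
      rw [Function.update_self]
      exact ⟨d.proj k, d.incl k, d.incl_proj k, fun h => (h rfl).elim, fun _ => by simp⟩
    · rw [Function.update_of_ne hi]
      exact ⟨𝟙 _, 𝟙 _, Category.id_comp _, fun _ => Category.id_comp _, fun h => (hi h).elim⟩
  choose f g hgf hne hc using h
  have hsum : ∑ k, (fun i => f k i ≫ g k i) c = 𝟙 (X c) := by
    rw [← d.total]
    exact Finset.sum_congr rfl fun k _ => by simp [hc k c rfl]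
  rw [← Tangle.sum_evalMarked (e := fun k i => f k i ≫ g k i) hsum t (x := (n, p)) hnp]
  refine Finset.sum_congr rfl fun k _ => ?_
  rw [← Tangle.evalMarked_true (hgf k) t]
  -- For each `k` the single mark is now spread over the whole component; the remaining components
  -- carry identities.
  refine Tangle.evalMarked_component (fun i => ?_) t (hne k) fun k p b' h => hconn _ _ _ _ _ _ hnp h
  rw [Category.assoc, ← Category.assoc (g k i), hgf, Category.id_comp]

end Additivity

/-! ### Expansion of a function of several variables, one variable at a time. -/

section Expansion

variable {ι J A : Type*} [Fintype J] {m : J → A → ℂ} {Z : J → A}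

theorem sum_expansion_fin {n : ℕ} {Ψ : (Fin n → A) → ℂ}
    (h : ∀ X c, Ψ X = ∑ j, m j (X c) * Ψ (Function.update X c (Z j))) (X : Fin n → A) :
    Ψ X = ∑ φ : Fin n → J, (∏ c, m (φ c) (X c)) * Ψ (fun c => Z (φ c)) := by
  induction n with
  | zero =>
    rw [Fintype.sum_unique, Finset.univ_eq_empty, Finset.prod_empty, one_mul]
    congr 1
    exact Subsingleton.elim _ _
  | succ n ih =>
    have h1 : ∀ j, Ψ (Function.update X 0 (Z j)) =
        ∑ φ : Fin n → J, (∏ c, m (φ c) (X c.succ)) * Ψ (Fin.cons (Z j) fun c => Z (φ c)) := by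
      intro j
      rw [← ih (Ψ := fun Y => Ψ (Fin.cons (Z j) Y)) (fun Y c => ?_) (fun c => X c.succ)]
      · congr 1
        refine (Fin.cons_self_tail _).symm.trans ?_
        rw [Function.update_self]
        congr 1
      · rw [h _ c.succ]
        simp only [Fin.cons_succ, Fin.cons_update]
    rw [h X 0, ← (Fin.consEquiv fun _ => J).sum_comp, Fintype.sum_prod_type]
    refine Finset.sum_congr rfl fun j _ => ?_
    rw [h1, Finset.mul_sum]
    refine Finset.sum_congr rfl fun φ _ => ?_
    rw [← mul_assoc, Fin.prod_univ_succ]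
    congr 1
    congr 1
    ext c
    refine Fin.cases ?_ (fun c => ?_) c <;> simp [Fin.consEquiv]

/-- A function that can be expanded in each variable can be expanded in all variables. -/
theorem sum_expansion [Fintype ι] [DecidableEq ι] {Ψ : (ι → A) → ℂ}
    (h : ∀ X c, Ψ X = ∑ j, m j (X c) * Ψ (Function.update X c (Z j))) (X : ι → A) :
    Ψ X = ∑ φ : ι → J, (∏ c, m (φ c) (X c)) * Ψ (fun c => Z (φ c)) := by
  let e := Fintype.equivFin ι
  have h1 := sum_expansion_fin (m := m) (Z := Z) (Ψ := fun Y => Ψ (fun i => Y (e i)))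
    (fun Y c => by
      rw [h _ (e.symm c), e.apply_symm_apply]
      refine Finset.sum_congr rfl fun j _ => ?_
      congr 2
      ext i
      by_cases hi : i = e.symm c
      · subst hi
        simp
      · rw [Function.update_of_ne hi, Function.update_of_ne]
        rintro rfl
        simp at hi) (fun c => X (e.symm c))
  simp only [e.symm_apply_apply] at h1
  rw [h1, ← (e.arrowCongr (Equiv.refl J)).sum_comp]
  refine Finset.sum_congr rfl fun φ _ => ?_
  rw [← e.prod_comp]
  simp

end Expansion

/-! ### Coloured evaluations in terms of multiplicities of simple objects. -/

section Colours

/-- The multiplicity of `Z` in a colour. -/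
noncomputable def Colour.mult {D : Type u} [Category.{v} D] [Preadditive D] [Linear ℂ D]
    (x : Colour D) (Z : D) : ℂ := x.sum fun X a => a * Module.finrank ℂ (Z ⟶ X)

theorem Colour.mult_map {C : Type u₁} [Category.{v₁} C] {D : Type u₂} [Category.{v₂} D]
    [Preadditive D] [Linear ℂ D] (F : C ⥤ D) (x : Colour C) (Z : D) :
    (x.map F).mult Z = x.sum fun X a => a * Module.finrank ℂ (Z ⟶ F.obj X) :=
  Finsupp.sum_mapDomain_index (by simp) (by intros; ring)

variable {D : Type u} [Category.{v} D] [Preadditive D] [Linear ℂ D] [MonoidalCategory D]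
  [MonoidalPreadditive D] [MonoidalLinear ℂ D] [LeftRigidCategory D] [FusionCategory D]
  [PivotalCategory D]

variable [BraidedCategory D]

/-- The evaluation of a link with components labelled by simple objects with given weights. -/
noncomputable def DottedLink.simpleEval (L : DottedLink) (u v : SimpleIndex D → ℂ) : ℂ :=
  ∑ φ : Fin L.h₁ ⊕ Fin L.h₂ → SimpleIndex D,
    (∏ c, (Sum.elim (fun _ => u) (fun _ => v) c : SimpleIndex D → ℂ) (φ c)) *
      scalar (L.diagram.eval fun c => simpleObj D (φ c))

/-- The source of the powers of the proportionality constants that the normalisation cancels. -/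
theorem DottedLink.simpleEval_smul (L : DottedLink) (a b : ℂ) (u v : SimpleIndex D → ℂ) :
    L.simpleEval (fun j => a * u j) (fun j => b * v j) =
      a ^ L.h₁ * b ^ L.h₂ * L.simpleEval u v := by
  rw [DottedLink.simpleEval, DottedLink.simpleEval, Finset.mul_sum]
  refine Finset.sum_congr rfl fun φ _ => ?_
  simp only [Fintype.prod_sum_type, Sum.elim_inl, Sum.elim_inr, Finset.prod_mul_distrib,
    Finset.prod_const, Finset.card_univ, Fintype.card_fin]
  ring

/-- Expansion of labels into simple objects. -/
theorem DottedLink.scalar_eval (L : DottedLink) (X : Fin L.h₁ ⊕ Fin L.h₂ → D) :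
    scalar (L.diagram.eval X) = ∑ φ : Fin L.h₁ ⊕ Fin L.h₂ → SimpleIndex D,
      (∏ c, (Module.finrank ℂ (simpleObj D (φ c) ⟶ X c) : ℂ)) *
        scalar (L.diagram.eval fun c => simpleObj D (φ c)) := by
  refine sum_expansion (m := fun j A => (Module.finrank ℂ (simpleObj D j ⟶ A) : ℂ))
    (Ψ := fun X => scalar (L.diagram.eval X)) (fun X c => ?_) X
  refine (congrArg scalar (Tangle.eval_decomposition L.diagram (L.occurs c)
    (fun k p b m q c' => L.connected c k p b m q c') (decomposition (X c)))).trans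
      ((scalar_sum _).trans ?_)
  refine Eq.trans (Finset.sum_congr rfl fun k _ => ?_) (sum_summandIndex (X c)
    fun j => scalar (L.diagram.eval (Function.update X c (simpleObj D j))))
  congr!

/-- The weights `m` are left general, so as to cover both multiplicities in `D` and multiplicities
after applying a functor. -/
theorem DottedLink.eval_eq_sum (L : DottedLink) (x y : Colour D) {J : Type} [Fintype J]
    (m : J → D → ℂ) (g : (Fin L.h₁ ⊕ Fin L.h₂ → J) → ℂ)
    (h : ∀ X, scalar (L.diagram.eval X) =
      ∑ φ : Fin L.h₁ ⊕ Fin L.h₂ → J, (∏ c, m (φ c) (X c)) * g φ) :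
    L.eval x y = ∑ φ : Fin L.h₁ ⊕ Fin L.h₂ → J,
      (∏ c, (Sum.elim (fun _ => x) (fun _ => y) c : Colour D).sum fun X a => a * m (φ c) X) *
        g φ := by
  classical
  simp only [DottedLink.eval, h, Finset.mul_sum]
  rw [Finset.sum_comm]
  refine Finset.sum_congr rfl fun φ _ => ?_
  simp only [Finsupp.sum]
  rw [Finset.prod_univ_sum, Finset.sum_mul]
  refine Finset.sum_congr (by congr!) fun X _ => ?_
  rw [Finset.prod_mul_distrib, mul_assoc]

/-- Different formal combinations with the same multiplicities are thus interchangeable, whatever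
representatives of the simple objects were chosen. -/
theorem DottedLink.eval_eq_simpleEval (L : DottedLink) (x y : Colour D) :
    L.eval x y =
      L.simpleEval (fun j => x.mult (simpleObj D j)) (fun j => y.mult (simpleObj D j)) := by
  rw [L.eval_eq_sum x y (fun j A => (Module.finrank ℂ (simpleObj D j ⟶ A) : ℂ)) _ L.scalar_eval]
  refine Finset.sum_congr rfl fun φ _ => ?_
  congr 1
  refine Finset.prod_congr rfl fun c _ => ?_
  cases c <;> rfl

/-- Functors that preserve the evaluation of diagrams also preserve it for colours. -/
theorem DottedLink.eval_eq_simpleEval_map {C : Type u₁} [Category.{v₁} C] [Preadditive C]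
    [Linear ℂ C] [MonoidalCategory C] [MonoidalPreadditive C] [MonoidalLinear ℂ C]
    [LeftRigidCategory C] [FusionCategory C] [PivotalCategory C] [BraidedCategory C] (H : C ⥤ D)
    (L : DottedLink) (hH : ∀ X : Fin L.h₁ ⊕ Fin L.h₂ → C,
      scalar (L.diagram.eval X) = scalar (L.diagram.eval fun c => H.obj (X c)))
    (x y : Colour C) :
    L.eval x y = L.simpleEval (fun j => (x.map H).mult (simpleObj D j))
      (fun j => (y.map H).mult (simpleObj D j)) := by
  rw [L.eval_eq_sum x y (fun j A => (Module.finrank ℂ (simpleObj D j ⟶ H.obj A) : ℂ)) _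
    fun X => (hH X).trans (L.scalar_eval _)]
  refine Finset.sum_congr rfl fun φ _ => ?_
  congr 1
  refine Finset.prod_congr rfl fun c _ => ?_
  cases c <;> exact (Colour.mult_map _ _ _).symm

end Colours

/-! ### Ribbon functors preserve evaluations of diagrams -/

section EvT

variable {C : Type u} [Category.{v} C] [MonoidalCategory C]

theorem whiskerRight_evaluation_injective {X Y A : C} (p : ExactPairing X Y) {f g : A ⟶ Y}
    (h : f ▷ X ≫ p.evaluation' = g ▷ X ≫ p.evaluation') : f = g := by
  have h1 : ∀ f : A ⟶ Y, (tensorRightHomEquiv A X Y (𝟙_ C)).symm (f ≫ (λ_ Y).inv) =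
      f ▷ X ≫ p.evaluation' := fun f => by
    change (f ≫ (λ_ Y).inv) ▷ X ≫ (α_ _ _ _).hom ≫ 𝟙_ C ◁ p.evaluation' ≫ (ρ_ (𝟙_ C)).hom = _
    rw [← unitors_equal, leftUnitor_naturality, comp_whiskerRight, Category.assoc,
      leftUnitor_tensor_hom]
    simp
  rw [← cancel_mono (λ_ Y).inv]
  exact (tensorRightHomEquiv A X Y (𝟙_ C)).symm.injective ((h1 f).trans (h.trans (h1 g).symm))

/-- A morphism between duals is determined by its effect on evaluations. So `j` is the mate of the
identity, which is also compatible with coevaluations. -/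
theorem coevaluation_whiskerLeft_of_evaluation {X Y Y' : C} (p : ExactPairing X Y)
    (p' : ExactPairing X Y') (j : Y ≅ Y') (h : j.hom ▷ X ≫ p'.evaluation' = p.evaluation') :
    p.coevaluation' ≫ X ◁ j.hom = p'.coevaluation' := by
  have h1 := @rightAdjointMate_comp_evaluation C _ _ X X ⟨Y'⟩ ⟨Y⟩ (𝟙 X)
  have h2 := @coevaluation_comp_rightAdjointMate C _ _ X X ⟨Y'⟩ ⟨Y⟩ (𝟙 X)
  rw [whiskerLeft_id, Category.id_comp] at h1
  rw [id_whiskerRight, Category.comp_id] at h2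
  have h3 : @rightAdjointMate C _ _ X X ⟨Y'⟩ ⟨Y⟩ (𝟙 X) = j.hom :=
    whiskerRight_evaluation_injective p' (h1.trans h.symm)
  rw [h3] at h2
  exact h2

variable [BraidedCategory C] [LeftRigidCategory C] [PivotalCategory C] [RibbonCategory C]

omit [PivotalCategory C] [RibbonCategory C] in
-- Naturality pulls `X` across `ev (dual X)`; by the hexagon, crossing `dual (dual X)` on one side
-- is undoing the crossing with `dual X` on the other.
theorem whisker_braiding_hom_ev (X : C) :
    dual X ◁ (β_ X (dual (dual X))).hom ≫ (α_ _ _ _).inv ≫ ev (dual X) ▷ X ≫ (λ_ X).hom =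
      (α_ _ _ _).inv ≫ (β_ X (dual X)).inv ▷ dual (dual X) ≫ (α_ _ _ _).hom ≫
        X ◁ ev (dual X) ≫ (ρ_ X).hom := by
  have h := BraidedCategory.braiding_naturality_right X (ev (dual X))
  rw [BraidedCategory.braiding_tensor_right_hom, braiding_tensorUnit_right] at h
  simp only [Category.assoc] at h
  have h1 := congrArg (fun f => (α_ _ _ _).inv ≫ (β_ X (dual X)).inv ▷ dual (dual X) ≫
    (α_ _ _ _).hom ≫ f ≫ (λ_ X).hom) h
  simpa using h1.symm

/-- After composing with `piv`, the formula `twist_eq_piv` no longer involves the pivotal structure.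
The crossing is pulled across `ev (dual X)` by `whisker_braiding_hom_ev`, and a zigzag removes the
double dual. -/
theorem twist_evT (X : C) :
    dual X ◁ (twist X).hom ≫ evT X = (β_ X (dual X)).inv ≫ ev X := by
  have h1 : (twist X).hom ≫ (piv X).hom = (ρ_ X).inv ≫ X ◁ coev (dual X) ≫
      (α_ X (dual (dual X)) (dual X)).inv ≫ (β_ X (dual (dual X))).hom ▷ dual X ≫
      (α_ (dual (dual X)) X (dual X)).hom ≫ dual (dual X) ◁ ev X ≫
      (ρ_ (dual (dual X))).hom := by
    have h : (twist X).hom = _ := RibbonCategory.twist_eq_piv X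
    rw [h]
    simp
  have h2 := whisker_braiding_hom_ev X
  have h3 : dual X ◁ coev (dual X) ⊗≫ ev (dual X) ▷ dual X = 𝟙 _ ⊗≫ 𝟙 _ :=
    (ExactPairing.coevaluation_evaluation'' (dual (dual X)) (dual X)).trans (by monoidal)
  rw [evT, ← whiskerLeft_comp_assoc, h1]
  calc
    _ = 𝟙 _ ⊗≫ (dual X ⊗ X) ◁ coev (dual X) ⊗≫ dual X ◁ (β_ X (dual (dual X))).hom ▷ dual X ⊗≫
        ((dual X ⊗ dual (dual X)) ◁ ev X ≫ ev (dual X) ▷ 𝟙_ C) ⊗≫ 𝟙 _ := by monoidal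
    _ = 𝟙 _ ⊗≫ (dual X ⊗ X) ◁ coev (dual X) ⊗≫
        (dual X ◁ (β_ X (dual (dual X))).hom ≫ (α_ _ _ _).inv ≫ ev (dual X) ▷ X ≫ (λ_ X).hom) ▷
          dual X ≫ ev X := by
      rw [whisker_exchange]
      monoidal
    _ = 𝟙 _ ⊗≫ ((dual X ⊗ X) ◁ coev (dual X) ≫
        (β_ X (dual X)).inv ▷ (dual (dual X) ⊗ dual X)) ⊗≫ X ◁ ev (dual X) ▷ dual X ⊗≫ ev X := by
      rw [h2]
      monoidal
    _ = 𝟙 _ ⊗≫ (β_ X (dual X)).inv ⊗≫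
        X ◁ (dual X ◁ coev (dual X) ⊗≫ ev (dual X) ▷ dual X) ⊗≫ ev X := by
      rw [whisker_exchange]
      monoidal
    _ = (β_ X (dual X)).inv ≫ ev X := by
      rw [h3]
      monoidal

theorem evT_eq_twist (X : C) :
    evT X = dual X ◁ (twist X).inv ≫ (β_ X (dual X)).inv ≫ ev X := by
  rw [← twist_evT, ← whiskerLeft_comp_assoc, Iso.inv_hom_id, whiskerLeft_id, Category.id_comp]

end EvT

/-! ### Transport of diagrams along monoidal and ribbon functors. -/

section Functor

open Functor.LaxMonoidal Functor.OplaxMonoidal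

variable {C : Type u₁} [Category.{v₁} C] [MonoidalCategory C]
  {D : Type u₂} [Category.{v₂} D] [MonoidalCategory D] (H : C ⥤ D) [H.Monoidal]

theorem whiskerLeft_μ_map_capMor {A B : C} (p : A ⊗ B ⟶ 𝟙_ C) (L : C) :
    H.obj A ◁ μ H B L ≫ μ H A (B ⊗ L) ≫ H.map (capMor p L) =
      capMor (μ H A B ≫ H.map p ≫ η H) (H.obj L) := by
  simp only [capMor, Functor.map_comp, Functor.Monoidal.map_whiskerRight,
    Functor.Monoidal.map_associator_inv, Functor.Monoidal.map_leftUnitor, Category.assoc,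
    Functor.Monoidal.μ_δ_assoc, Functor.Monoidal.whiskerLeft_μ_δ_assoc, comp_whiskerRight]

theorem cupMor_whiskerLeft_μ {A B : C} (p : 𝟙_ C ⟶ A ⊗ B) (L : C) :
    cupMor (ε H ≫ H.map p ≫ δ H A B) (H.obj L) ≫ H.obj A ◁ μ H B L ≫ μ H A (B ⊗ L) =
      H.map (cupMor p L) := by
  simp only [cupMor, Functor.map_comp, Functor.Monoidal.map_whiskerRight,
    Functor.Monoidal.map_associator, Functor.Monoidal.map_leftUnitor_inv, Category.assoc,
    Functor.Monoidal.μ_δ_assoc, comp_whiskerRight]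

theorem whiskerLeft_μ_map_crossMor {A B A' B' : C} (p : A ⊗ B ⟶ B' ⊗ A') (L : C) :
    H.obj A ◁ μ H B L ≫ μ H A (B ⊗ L) ≫ H.map (crossMor p L) =
      crossMor (μ H A B ≫ H.map p ≫ δ H B' A') (H.obj L) ≫
        H.obj B' ◁ μ H A' L ≫ μ H B' (A' ⊗ L) := by
  simp only [crossMor, Functor.map_comp, Functor.Monoidal.map_whiskerRight,
    Functor.Monoidal.map_associator, Functor.Monoidal.map_associator_inv, Category.assoc,
    Functor.Monoidal.μ_δ_assoc, Functor.Monoidal.whiskerLeft_μ_δ_assoc, comp_whiskerRight]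

section

variable {A B L : D} {A' B' L' : C} (f : A ⟶ H.obj A') (g : B ⟶ H.obj B') (h : L ⟶ H.obj L')

theorem tensorHom_μ_tensorHom_μ : (f ⊗ₘ ((g ⊗ₘ h) ≫ μ H B' L')) ≫ μ H A' (B' ⊗ L') =
    (f ⊗ₘ (g ⊗ₘ h)) ≫ H.obj A' ◁ μ H B' L' ≫ μ H A' (B' ⊗ L') := by
  rw [← id_tensorHom, MonoidalCategory.tensorHom_comp_tensorHom_assoc, Category.comp_id]

theorem tensorHom_μ_map_capMor (p : A' ⊗ B' ⟶ 𝟙_ C) {p' : A ⊗ B ⟶ 𝟙_ D}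
    (hp : (f ⊗ₘ g) ≫ μ H A' B' ≫ H.map p ≫ η H = p') :
    ((f ⊗ₘ ((g ⊗ₘ h) ≫ μ H B' L')) ≫ μ H A' (B' ⊗ L')) ≫ H.map (capMor p L') =
      capMor p' L ≫ h := by
  rw [tensorHom_μ_tensorHom_μ, Category.assoc, Category.assoc, whiskerLeft_μ_map_capMor,
    tensorHom_capMor, hp]

theorem tensorHom_μ_map_whiskerLeft {L₂ : D} {L₂' : C} {h : L ⟶ H.obj L'} {h₂ : L₂ ⟶ H.obj L₂'}
    {q : L' ⟶ L₂'} {q' : L ⟶ L₂} (hq : h ≫ H.map q = q' ≫ h₂) :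
    ((f ⊗ₘ h) ≫ μ H A' L') ≫ H.map (A' ◁ q) = A ◁ q' ≫ (f ⊗ₘ h₂) ≫ μ H A' L₂' := by
  rw [Category.assoc, ← μ_natural_right, ← id_tensorHom, ← id_tensorHom,
    MonoidalCategory.tensorHom_comp_tensorHom_assoc,
    MonoidalCategory.tensorHom_comp_tensorHom_assoc, hq, Category.id_comp, Category.comp_id]

theorem map_cupMor_tensorHom_μ (p : 𝟙_ C ⟶ A' ⊗ B') {p' : 𝟙_ D ⟶ A ⊗ B}
    (hp : p' ≫ (f ⊗ₘ g) = ε H ≫ H.map p ≫ δ H A' B') :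
    h ≫ H.map (cupMor p L') =
      cupMor p' L ≫ (f ⊗ₘ ((g ⊗ₘ h) ≫ μ H B' L')) ≫ μ H A' (B' ⊗ L') := by
  rw [tensorHom_μ_tensorHom_μ, ← Category.assoc, cupMor_tensorHom, hp, Category.assoc,
    cupMor_whiskerLeft_μ]

theorem tensorHom_μ_map_crossMor (p : A' ⊗ B' ⟶ B' ⊗ A') {p' : A ⊗ B ⟶ B ⊗ A}
    (hp : (f ⊗ₘ g) ≫ μ H A' B' ≫ H.map p ≫ δ H B' A' = p' ≫ (g ⊗ₘ f)) :
    ((f ⊗ₘ ((g ⊗ₘ h) ≫ μ H B' L')) ≫ μ H A' (B' ⊗ L')) ≫ H.map (crossMor p L') =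
      crossMor p' L ≫ (g ⊗ₘ ((f ⊗ₘ h) ≫ μ H A' L')) ≫ μ H B' (A' ⊗ L') := by
  rw [tensorHom_μ_tensorHom_μ, tensorHom_μ_tensorHom_μ, Category.assoc, Category.assoc,
    whiskerLeft_μ_map_crossMor, ← Category.assoc, tensorHom_crossMor _ _ _ _ _ _ _ hp,
    Category.assoc]

end

variable [LeftRigidCategory C] [LeftRigidCategory D]

/-- The comparison of duals under a monoidal functor. -/
def mapDualIso (X : C) : dual (H.obj X) ≅ H.obj (dual X) :=
  leftDualIso (LeftRigidCategory.leftDual (H.obj X)).exact (mapExactPairing H (dual X) X)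

theorem whiskerLeft_mapDualIso_ev (X : C) : H.obj X ◁ (mapDualIso H X).hom ≫
    μ H X (dual X) ≫ H.map (ev X) ≫ η H = ev (H.obj X) :=
  whiskerLeft_leftDualIso_hom (LeftRigidCategory.leftDual (H.obj X)).exact
    (mapExactPairing H (dual X) X)

theorem coev_mapDualIso_whiskerRight (X : C) : coev (H.obj X) ≫ (mapDualIso H X).hom ▷ H.obj X =
    ε H ≫ H.map (coev X) ≫ δ H (dual X) X :=
  leftDualIso_hom_whiskerRight (LeftRigidCategory.leftDual (H.obj X)).exact
    (mapExactPairing H (dual X) X)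

/-- The comparison of duals is built from `ev` alone and `H` is not assumed pivotal. Compatibility
with `evT` comes from `evT_eq_twist`, whose ingredients `H` preserves. -/
theorem mapDualIso_whiskerRight_evT [BraidedCategory C] [PivotalCategory C] [RibbonCategory C]
    [BraidedCategory D] [PivotalCategory D] [RibbonCategory D] (H : C ⥤ D) [H.Braided]
    (hH : ∀ X : C, H.map (twist X).hom = (twist (H.obj X)).hom) (X : C) :
    (mapDualIso H X).hom ▷ H.obj X ≫ μ H (dual X) X ≫ H.map (evT X) ≫ η H = evT (H.obj X) := by
  have h1 : H.map (twist X).inv = (twist (H.obj X)).inv := by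
    rw [← cancel_epi (twist (H.obj X)).hom, Iso.hom_inv_id, ← hH, ← H.map_comp, Iso.hom_inv_id,
      H.map_id]
  have h2 : μ H (dual X) X ≫ H.map (β_ X (dual X)).inv =
      (β_ (H.obj X) (H.obj (dual X))).inv ≫ μ H X (dual X) := by
    rw [Iso.eq_inv_comp, ← Category.assoc, ← Functor.LaxBraided.braided, Category.assoc,
      ← H.map_comp, Iso.hom_inv_id, H.map_id, Category.comp_id]
  rw [evT_eq_twist X, evT_eq_twist (H.obj X), H.map_comp, H.map_comp, Category.assoc,
    Category.assoc, ← μ_natural_right_assoc, h1, reassoc_of% h2, ← whisker_exchange_assoc,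
    BraidedCategory.braiding_inv_naturality_left_assoc, whiskerLeft_mapDualIso_ev]

theorem coevT_whiskerLeft_mapDualIso [BraidedCategory C] [PivotalCategory C] [RibbonCategory C]
    [BraidedCategory D] [PivotalCategory D] [RibbonCategory D] (H : C ⥤ D) [H.Braided]
    (hH : ∀ X : C, H.map (twist X).hom = (twist (H.obj X)).hom) (X : C) :
    coevT (H.obj X) ≫ H.obj X ◁ (mapDualIso H X).hom = ε H ≫ H.map (coevT X) ≫ δ H X (dual X) :=
  let := pivotalPairing X
  coevaluation_whiskerLeft_of_evaluation (pivotalPairing (H.obj X)) (mapExactPairing H X (dual X))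
    (mapDualIso H X) (mapDualIso_whiskerRight_evT H hH X)

variable {ι : Type} (X : ι → C)

/-- The comparison of objects of strands under a monoidal functor. -/
def mapStrand : ∀ s : Strand ι, strandObj (fun i => H.obj (X i)) s ⟶ H.obj (strandObj X s)
  | (_, true) => 𝟙 _
  | (i, false) => (mapDualIso H (X i)).hom

/-- The comparison of objects of lists of strands under a monoidal functor. -/
def mapStrands : ∀ l : List (Strand ι),
    strandsObj (fun i => H.obj (X i)) l ⟶ H.obj (strandsObj X l)
  | [] => ε H
  | s :: l => (mapStrand H X s ⊗ₘ mapStrands l) ≫ μ H (strandObj X s) (strandsObj X l)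

variable [BraidedCategory C] [PivotalCategory C] [RibbonCategory C]
    [BraidedCategory D] [PivotalCategory D] [RibbonCategory D]

/-- The comparison maps are natural with respect to slices; stacking slices then treats all
diagrams. -/
theorem Slice.mapStrands_eval (H : C ⥤ D) [H.Braided]
    (hH : ∀ X : C, H.map (twist X).hom = (twist (H.obj X)).hom) {l l' : List (Strand ι)}
    (s : Slice ι l l') : mapStrands H X l ≫ H.map (s.eval X) =
      s.eval (fun i => H.obj (X i)) ≫ mapStrands H X l' := by
  have hβ : ∀ A B : C, μ H A B ≫ H.map (β_ A B).hom ≫ δ H B A =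
      (β_ (H.obj A) (H.obj B)).hom := fun A B => by simp
  have hβ' : ∀ A B : C, μ H A B ≫ H.map (β_ B A).inv ≫ δ H B A =
      (β_ (H.obj B) (H.obj A)).inv := fun A B => by
    rw [← cancel_mono (μ H B A), Category.assoc, Category.assoc, Functor.Monoidal.δ_μ,
      Category.comp_id, Iso.eq_inv_comp, ← Category.assoc, ← Functor.LaxBraided.braided,
      Category.assoc, ← H.map_comp, Iso.hom_inv_id, H.map_id, Category.comp_id]
  induction s
  · next a b l =>
      refine tensorHom_μ_map_crossMor H _ _ _ (β_ _ _).hom (p' := (β_ _ _).hom) ?_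
      rw [hβ, BraidedCategory.braiding_naturality]
  · next a b l =>
      refine tensorHom_μ_map_crossMor H _ _ _ (β_ _ _).inv (p' := (β_ _ _).inv) ?_
      rw [hβ', BraidedCategory.braiding_inv_naturality]
  · next i l =>
      refine tensorHom_μ_map_capMor H (mapStrand H X (i, true)) (mapStrand H X (i, false))
        (mapStrands H X l) (ev (X i)) (p' := ev (H.obj (X i))) ?_
      refine Eq.trans ?_ (whiskerLeft_mapDualIso_ev H (X i))
      exact congrArg (· ≫ _) (id_tensorHom _ _)
  · next i l =>
      refine tensorHom_μ_map_capMor H (mapStrand H X (i, false)) (mapStrand H X (i, true))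
        (mapStrands H X l) (evT (X i)) (p' := evT (H.obj (X i))) ?_
      refine Eq.trans ?_ (mapDualIso_whiskerRight_evT H hH (X i))
      exact congrArg (· ≫ _) (tensorHom_id _ _)
  · next i l =>
      refine map_cupMor_tensorHom_μ H (mapStrand H X (i, false)) (mapStrand H X (i, true))
        (mapStrands H X l) (coev (X i)) (p' := coev (H.obj (X i))) ?_
      refine Eq.trans ?_ (coev_mapDualIso_whiskerRight H (X i))
      exact congrArg (_ ≫ ·) (tensorHom_id _ _)
  · next i l =>
      refine map_cupMor_tensorHom_μ H (mapStrand H X (i, true)) (mapStrand H X (i, false))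
        (mapStrands H X l) (coevT (X i)) (p' := coevT (H.obj (X i))) ?_
      refine Eq.trans ?_ (coevT_whiskerLeft_mapDualIso H hH (X i))
      exact congrArg (_ ≫ ·) (id_tensorHom _ _)
  · next a s ih =>
      refine tensorHom_μ_map_whiskerLeft H _ ih

theorem Tangle.mapStrands_eval (H : C ⥤ D) [H.Braided]
    (hH : ∀ X : C, H.map (twist X).hom = (twist (H.obj X)).hom) {l l' : List (Strand ι)}
    (t : Tangle ι l l') : mapStrands H X l ≫ H.map (t.eval X) =
      t.eval (fun i => H.obj (X i)) ≫ mapStrands H X l' := by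
  induction t with
  | nil l => simp [Tangle.eval]
  | cons s t ih =>
    simp only [Tangle.eval, Functor.map_comp]
    rw [reassoc_of% s.mapStrands_eval X H hH, ih, Category.assoc]

end Functor

section Scalar

variable {C : Type u₁} [Category.{v₁} C] [Preadditive C] [Linear ℂ C] [MonoidalCategory C]
  [MonoidalPreadditive C] [MonoidalLinear ℂ C] [LeftRigidCategory C] [FusionCategory C]
  [PivotalCategory C] [BraidedCategory C] [RibbonCategory C]
  {D : Type u₂} [Category.{v₂} D] [Preadditive D] [Linear ℂ D] [MonoidalCategory D]
  [MonoidalPreadditive D] [MonoidalLinear ℂ D] [LeftRigidCategory D] [FusionCategory D]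
  [PivotalCategory D] [BraidedCategory D] [RibbonCategory D]
  (H : C ⥤ D) [H.Additive] [H.Linear ℂ] [H.Braided]
  (hH : ∀ X : C, H.map (twist X).hom = (twist (H.obj X)).hom)

open Functor.LaxMonoidal Functor.OplaxMonoidal

omit [PivotalCategory C] [BraidedCategory C] [RibbonCategory C] [PivotalCategory D]
  [BraidedCategory D] [RibbonCategory D] in
theorem scalar_map (H : C ⥤ D) [H.Additive] [H.Linear ℂ] [H.Monoidal] {f : 𝟙_ C ⟶ 𝟙_ C}
    {g : 𝟙_ D ⟶ 𝟙_ D} (h : ε H ≫ H.map f = g ≫ ε H) : scalar f = scalar g := by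
  refine (scalar_eq ?_).symm
  rw [← cancel_mono (ε H), ← h, Linear.smul_comp, Category.id_comp, ← scalar_spec f, H.map_smul,
    H.map_id, Linear.comp_smul, Category.comp_id, scalar_spec]

include hH

/-- Ribbon functors preserve evaluations of closed diagrams. -/
theorem DottedLink.scalar_eval_map (L : DottedLink) (X : Fin L.h₁ ⊕ Fin L.h₂ → C) :
    scalar (L.diagram.eval X) = scalar (L.diagram.eval fun c => H.obj (X c)) :=
  scalar_map H (L.diagram.mapStrands_eval X H hH)

/-- Ribbon functors preserve dimensions. -/
theorem qdim_map_of_ribbon (X : C) : qdim (H.obj X) = qdim X := by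
  refine (scalar_map H ?_).symm
  have h1 := coevT_whiskerLeft_mapDualIso H hH X
  have h2 := whiskerLeft_mapDualIso_ev H X
  simp only [rightTrace, id_whiskerRight, Category.id_comp]
  rw [← h2, reassoc_of% h1]
  simp

end Scalar

/-! ### Transparent objects -/

section Transparent

variable {D : Type u} [Category.{v} D] [MonoidalCategory D] [BraidedCategory D]

theorem isTransparent_unit : IsTransparent (𝟙_ D) := fun Y => by
  simp

theorem IsTransparent.retract {X T : D} (hT : IsTransparent T) (r : Retract X T) :
    IsTransparent X := fun Y => by
  have : IsSplitMono (r.i ▷ Y) := ⟨⟨r.r ▷ Y, by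
    rw [← comp_whiskerRight, r.retract, id_whiskerRight]⟩⟩
  rw [← cancel_mono (r.i ▷ Y), Category.assoc, ← BraidedCategory.braiding_naturality_right,
    ← BraidedCategory.braiding_naturality_left_assoc, hT Y]
  simp

/-- By dominance every test object is a retract of some `H.obj X`, and against `H.obj X` the double
braiding is the image of a trivial one. -/
theorem isTransparent_map {E : Type u₂} [Category.{v₂} E] [MonoidalCategory E] [BraidedCategory E]
    (H : D ⥤ E) [H.Braided] (hH : IsDominant H) {Y : D} (hY : IsTransparent Y) :
    IsTransparent (H.obj Y) := fun W => by
  obtain ⟨X, ⟨r⟩⟩ := hH W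
  have h1 : (β_ (H.obj Y) (H.obj X)).hom ≫ (β_ (H.obj X) (H.obj Y)).hom = 𝟙 _ := by
    rw [← cancel_mono (Functor.LaxMonoidal.μ H Y X), Category.assoc, ← Functor.LaxBraided.braided,
      ← Functor.LaxBraided.braided_assoc, ← H.map_comp, hY X]
    simp
  have : IsSplitMono (H.obj Y ◁ r.i) := ⟨⟨H.obj Y ◁ r.r, by
    rw [← whiskerLeft_comp, r.retract, whiskerLeft_id]⟩⟩
  rw [← cancel_mono (H.obj Y ◁ r.i), Category.assoc, ← BraidedCategory.braiding_naturality_left,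
    ← BraidedCategory.braiding_naturality_right_assoc, h1]
  simp

end Transparent

/-! ### Transparency of simple objects whose image contains the unit. -/

section Descent

open Functor.LaxMonoidal Functor.OplaxMonoidal

/-- Transposition turns `m` into a morphism out of `Y` alone, where simplicity of `Y` can be used;
being annihilated by `f` survives the transposition. -/
theorem comp_map_tensorRightHomEquiv {D : Type u} [Category.{v} D] [Preadditive D]
    [MonoidalCategory D] {E : Type u₂} [Category.{v₂} E] [Preadditive E] [MonoidalCategory E]
    [MonoidalPreadditive E] (H : D ⥤ E) [H.Monoidal] {Y : D}
    (f : 𝟙_ E ⟶ H.obj Y) (X X' Z : D) [ExactPairing X X'] (m : Y ⊗ X ⟶ Z)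
    (hm : f ▷ H.obj X ≫ μ H Y X ≫ H.map m = 0) :
    f ≫ H.map (tensorRightHomEquiv Y X X' Z m) = 0 := by
  have h : f ≫ H.map (tensorRightHomEquiv Y X X' Z m) =
      (ρ_ _).inv ≫ 𝟙_ E ◁ (ε H ≫ H.map (η_ X X') ≫ δ H X X') ≫ (α_ _ _ _).inv ≫
        (f ▷ H.obj X ≫ μ H Y X ≫ H.map m) ▷ H.obj X' ≫ μ H _ _ := by
    simp only [tensorRightHomEquiv, Equiv.coe_fn_mk, Functor.map_comp,
      Functor.Monoidal.map_whiskerLeft, Functor.Monoidal.map_whiskerRight,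
      Functor.Monoidal.map_associator_inv, Functor.Monoidal.map_rightUnitor_inv, Category.assoc,
      Functor.Monoidal.μ_δ_assoc, comp_whiskerRight]
    rw [rightUnitor_inv_naturality_assoc, ← whiskerLeft_comp_assoc, ← whiskerLeft_comp_assoc,
      ← whisker_exchange_assoc, associator_inv_naturality_left_assoc, Category.assoc]
  rw [h, hm]
  simp

variable {D : Type u} [Category.{v} D] [Preadditive D] [Linear ℂ D] [MonoidalCategory D]
  [MonoidalPreadditive D] [LeftRigidCategory D] [PivotalCategory D]
  [BraidedCategory D] {E : Type u₂} [Category.{v₂} E] [Preadditive E] [MonoidalCategory E]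
  [MonoidalPreadditive E] [BraidedCategory E]

/-- By naturality, the double braiding with `Y` becomes, after precomposing with `f`, a double
braiding with the unit, which is trivial. -/
theorem whiskerRight_μ_map_braiding {D : Type u} [Category.{v} D] [Preadditive D]
    [MonoidalCategory D] [BraidedCategory D] {E : Type u₂} [Category.{v₂} E] [Preadditive E]
    [MonoidalCategory E] [MonoidalPreadditive E] [BraidedCategory E] (H : D ⥤ E)
    [H.Additive] [H.Braided] {Y : D} (f : 𝟙_ E ⟶ H.obj Y) (X : D) :
    f ▷ H.obj X ≫ μ H Y X ≫ H.map ((β_ Y X).hom ≫ (β_ X Y).hom - 𝟙 (Y ⊗ X)) = 0 := by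
  rw [H.map_sub, Preadditive.comp_sub, Preadditive.comp_sub, H.map_comp,
    Functor.LaxBraided.braided_assoc, Functor.LaxBraided.braided,
    BraidedCategory.braiding_naturality_left_assoc,
    BraidedCategory.braiding_naturality_right_assoc]
  simp

/-- Simple objects whose image contains the unit are transparent. -/
theorem IsSimpleObj.isTransparent_of_hom [FinitelySemisimple D] (H : D ⥤ E) [H.Additive]
    [H.Braided] {Y : D} (hY : IsSimpleObj Y) {f : 𝟙_ E ⟶ H.obj Y} (hf : f ≠ 0) :
    IsTransparent Y := fun X => by
  -- Transposing a factor on the right needs the duality on the other side from the chosen one.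
  let := pivotalPairing X
  let m := (β_ Y X).hom ≫ (β_ X Y).hom - 𝟙 (Y ⊗ X)
  have h1 := comp_map_tensorRightHomEquiv H f X (dual X) (Y ⊗ X) m
    (whiskerRight_μ_map_braiding H f X)
  -- A nonzero morphism out of the simple object `Y` splits, and so does its image under `H`; it
  -- could not annihilate `f ≠ 0`.
  have h2 : tensorRightHomEquiv Y X (dual X) (Y ⊗ X) m = 0 := by
    by_contra h
    obtain ⟨g, hg⟩ := hY.exists_retraction _ h
    apply hf
    rw [← Category.comp_id f, ← H.map_id, ← hg, H.map_comp, ← Category.assoc, h1, zero_comp]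
  have h3 : (0 : Y ⟶ (Y ⊗ X) ⊗ dual X) = tensorRightHomEquiv Y X (dual X) (Y ⊗ X) 0 := by
    simp [tensorRightHomEquiv]
  exact sub_eq_zero.1 ((tensorRightHomEquiv Y X (dual X) (Y ⊗ X)).injective (h2.trans h3))

end Descent

/-- Simple summands of a transparent object are transparent, hence copies of the unit when the
category is modular. -/
theorem qdim_of_isTransparent {E : Type u} [Category.{v} E] [Preadditive E] [Linear ℂ E]
    [MonoidalCategory E] [MonoidalPreadditive E] [MonoidalLinear ℂ E] [LeftRigidCategory E]
    [FusionCategory E] [PivotalCategory E] [BraidedCategory E] [RibbonCategory E]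
    (hE : IsModular E) {T : E} (hT : IsTransparent T) :
    qdim T = Module.finrank ℂ (𝟙_ E ⟶ T) * qdim (𝟙_ E) := by
  obtain ⟨i, ⟨e⟩⟩ := (FusionCategory.simple_unit (C := E)).exists_iso_simpleObj
  rw [qdim_eq_sum, Finset.sum_eq_single i, qdim_congr e, finrank_hom_congr e (Iso.refl T)]
  · intro j _ hj
    have h : Module.finrank ℂ (simpleObj E j ⟶ T) = 0 := by
      by_contra h
      obtain ⟨f, hf⟩ := finrank_hom_pos_iff.1 (Nat.pos_of_ne_zero h)
      obtain ⟨g, hg⟩ := (simpleObj_simple E j).exists_retraction f hf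
      obtain ⟨e'⟩ := hE _ (simpleObj_simple E j) (hT.retract ⟨f, g, hg⟩)
      exact hj (simpleObj_inj ⟨e' ≪≫ e⟩)
    rw [h, Nat.cast_zero, zero_mul]
  · simp

/-! ### Multiplicities and dimensions of colours -/

section Colours

theorem Colour.mult_map_eq_sum {C : Type u₁} [Category.{v₁} C] [Preadditive C] [Linear ℂ C]
    [FinitelySemisimple C] {D : Type u₂} [Category.{v₂} D] [Preadditive D] [Linear ℂ D]
    [FinitelySemisimple D] (F : C ⥤ D) [F.Additive] (x : Colour C) (Z : D) :
    (x.map F).mult Z = ∑ i, x.mult (simpleObj C i) *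
      (Module.finrank ℂ (Z ⟶ F.obj (simpleObj C i)) : ℂ) := by
  rw [Colour.mult_map]
  simp only [Colour.mult, Finsupp.sum, Finset.sum_mul]
  rw [Finset.sum_comm]
  refine Finset.sum_congr rfl fun X _ => ?_
  rw [finrank_hom_map F Z X]
  push_cast
  rw [Finset.mul_sum]
  simp only [mul_assoc]

variable {C : Type u₁} [Category.{v₁} C] [Preadditive C] [Linear ℂ C] [MonoidalCategory C]
  [MonoidalPreadditive C] [MonoidalLinear ℂ C] [LeftRigidCategory C] [FusionCategory C]
  [PivotalCategory C] {D : Type u₂} [Category.{v₂} D] [Preadditive D] [Linear ℂ D]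
  [MonoidalCategory D] [MonoidalPreadditive D] [MonoidalLinear ℂ D] [LeftRigidCategory D]
  [FusionCategory D] [PivotalCategory D]

theorem Colour.mult_congr {D : Type u} [Category.{v} D] [Preadditive D] [Linear ℂ D]
    (x : Colour D) {Z Z' : D} (e : Z ≅ Z') : x.mult Z = x.mult Z' := by
  simp only [Colour.mult, finrank_hom_congr e (Iso.refl _)]

theorem Colour.dim_eq_sum (x : Colour D) :
    x.dim = ∑ j, x.mult (simpleObj D j) * qdim (simpleObj D j) := by
  simp only [Colour.dim, Colour.mult, Finsupp.sum, Finset.sum_mul]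
  rw [Finset.sum_comm]
  refine Finset.sum_congr rfl fun X _ => ?_
  rw [qdim_eq_sum X, Finset.mul_sum]
  simp only [mul_assoc]

theorem Colour.dim_map (F : C ⥤ D) (hF : ∀ X, qdim (F.obj X) = qdim X) (x : Colour C) :
    (x.map F).dim = x.dim := by
  rw [Colour.dim, Colour.map, Finsupp.sum_mapDomain_index (by simp) (by intros; ring)]
  simp only [hF]
  rfl

open Classical in
theorem Colour.dim_transparentPart [BraidedCategory D] (x : Colour D) :
    x.transparentPart.dim = ∑ j, if IsTransparent (simpleObj D j) then
      x.mult (simpleObj D j) * qdim (simpleObj D j) else 0 := by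
  have h1 : ∀ y : Colour D, y.dim = Finsupp.linearCombination ℂ qdim y := fun _ => rfl
  rw [h1, Colour.transparentPart, Finsupp.sum]
  simp only [map_sum, apply_ite (Finsupp.linearCombination ℂ (qdim (C := D))), map_zero,
    Finsupp.linearCombination_single, smul_eq_mul]
  rw [Finset.sum_comm]
  refine Finset.sum_congr rfl fun j _ => ?_
  split_ifs
  · rw [Colour.mult, Finsupp.sum, Finset.sum_mul]
  · exact Finset.sum_const_zero

/-- Symmetry of multiplicities turns the sum into the expansion of `qdim Z`, for arbitrary `Z`. The
answer does not refer to the chosen simple representatives. -/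
theorem mult_kirbyColour (Z : C) : (kirbyColour C).mult Z = qdim Z := by
  have h1 : ∀ y : Colour C, y.mult Z =
      Finsupp.linearCombination ℂ (fun X => (Module.finrank ℂ (Z ⟶ X) : ℂ)) y := fun _ => rfl
  rw [h1, kirbyColour, map_sum, qdim_eq_sum Z]
  simp only [Finsupp.linearCombination_single, smul_eq_mul, finrank_hom_comm Z, mul_comm]

theorem mult_kirbyColour_map {D : Type u₂} [Category.{v₂} D] [Preadditive D] [Linear ℂ D]
    [MonoidalCategory D] [MonoidalPreadditive D] [MonoidalLinear ℂ D] [LeftRigidCategory D]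
    [FusionCategory D] (F : C ⥤ D) [F.Additive] (Z : D) :
    ((kirbyColour C).map F).mult Z = imageMult F Z := by
  rw [Colour.mult_map_eq_sum]
  simp only [mult_kirbyColour]
  rfl

end Colours

/-! ### The Kirby colour of a full fusion subcategory. -/

section FullSubcategory

variable {D : Type u} [Category.{v} D] [Preadditive D] [Linear ℂ D] [MonoidalCategory D]
  [MonoidalPreadditive D] [MonoidalLinear ℂ D] [LeftRigidCategory D] [FusionCategory D]
  [PivotalCategory D] (P : ObjectProperty D) [IsFusionSubcategory P]

theorem qdim_obj (X : P.FullSubcategory) : qdim X.obj = qdim X :=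
  have h : (rightTrace (𝟙 X)).hom = (qdim X • 𝟙 (𝟙_ P.FullSubcategory)).hom :=
    congrArg _ (scalar_spec _).symm
  scalar_eq h

open Classical in
-- The representatives chosen in the subcategory and in `D` are unrelated, so the two Kirby colours
-- are compared by multiplicities. Simple objects outside `P` do not occur in objects of `P`.
theorem mult_kirbyColour_map_ι (j : SimpleIndex D) :
    ((kirbyColour P.FullSubcategory).map P.ι).mult (simpleObj D j) =
      if P (simpleObj D j) then qdim (simpleObj D j) else 0 := by
  rw [Colour.mult_map]
  split_ifs with h
  · let Z : P.FullSubcategory := ⟨simpleObj D j, h⟩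
    refine Eq.trans ?_ ((mult_kirbyColour Z).trans (qdim_obj P Z).symm)
    refine Finsupp.sum_congr fun X _ => ?_
    rw [(fullHomEquiv P Z X).finrank_eq]
    rfl
  · refine Finset.sum_eq_zero fun X _ => ?_
    have h0 : Module.finrank ℂ (simpleObj D j ⟶ P.ι.obj X) = 0 := by
      by_contra h0
      obtain ⟨f, hf⟩ := finrank_hom_pos_iff.1 (Nat.pos_of_ne_zero h0)
      obtain ⟨g, hg⟩ := (simpleObj_simple D j).exists_retraction f hf
      exact h (IsFusionSubcategory.prop_retract ⟨f, g, hg⟩ X.property)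
    simp only [h0, Nat.cast_zero, mul_zero]

variable {P} in
theorem HasPositiveDimensions.fullSubcategory (hD : HasPositiveDimensions D) :
    HasPositiveDimensions P.FullSubcategory := fun X hX => by
  rw [← qdim_obj]
  refine hD X.obj fun h => hX ?_
  ext
  exact h

end FullSubcategory

/-! ### Comparison of the invariants -/

/-- Here `l` and `m` are the proportionality constants of the undotted and the dotted colour. In the
denominator `l` has exponent `(h₂ - h₁) + h₁`, as in the numerator. -/
theorem normalisation_eq {N d D T l m : ℂ} (hl : l ≠ 0) (hm : m ≠ 0) (h₁ h₂ : ℕ) :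
    m ^ h₁ * l ^ h₂ * N / ((l * d) ^ ((h₂ : ℤ) - (h₁ : ℤ)) * (m * D * (l * T)) ^ h₁) =
      N / (d ^ ((h₂ : ℤ) - (h₁ : ℤ)) * (D * T) ^ h₁) := by
  have h : (l * d) ^ ((h₂ : ℤ) - (h₁ : ℤ)) * (m * D * (l * T)) ^ h₁ =
      m ^ h₁ * l ^ h₂ * (d ^ ((h₂ : ℤ) - (h₁ : ℤ)) * (D * T) ^ h₁) := by
    rw [mul_zpow, zpow_sub₀ hl, zpow_natCast, zpow_natCast, mul_pow, mul_pow, mul_pow, mul_pow]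
    field_simp
  rw [h, mul_div_mul_left _ _ (mul_ne_zero (pow_ne_zero _ hm) (pow_ne_zero _ hl))]

/-- Here `n` is Petit's norm. On the right `h₃` cancels from the exponents of both `d` and `n`. -/
theorem petit_normalisation_eq {N d n : ℂ} (hd : d ≠ 0) (hn : n ≠ 0) (h₁ h₂ h₃ : ℕ) :
    N / (d ^ ((h₂ : ℤ) - (h₁ : ℤ)) * (n ^ 2) ^ h₁) =
      N / (d ^ h₃ * n ^ ((h₁ : ℤ) + (h₂ : ℤ) - (h₃ : ℤ))) *
        (n / d) ^ ((h₂ : ℤ) - (h₁ : ℤ) - (h₃ : ℤ)) := by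
  simp only [div_zpow, zpow_sub₀ hd, zpow_sub₀ hn, zpow_add₀ hn, zpow_natCast]
  field_simp
  rw [pow_right_comm]

section Invariants

variable {C : Type u₁} [Category.{v₁} C] [Preadditive C] [Linear ℂ C] [MonoidalCategory C]
  [MonoidalPreadditive C] [MonoidalLinear ℂ C] [LeftRigidCategory C] [FusionCategory C]
  [PivotalCategory C]
  {D : Type u₂} [Category.{v₂} D] [Preadditive D] [Linear ℂ D] [MonoidalCategory D]
  [MonoidalPreadditive D] [MonoidalLinear ℂ D] [LeftRigidCategory D] [FusionCategory D]
  [PivotalCategory D]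

theorem HasPositiveDimensions.exists_dim_kirbyColour (hC : HasPositiveDimensions C) :
    (kirbyColour C).dim ≠ 0 := by
  choose δ hδ hd using fun i => hC _ (simpleObj_simple C i).id_ne_zero
  obtain ⟨i, -⟩ := (FusionCategory.simple_unit (C := C)).exists_iso_simpleObj
  have h : (kirbyColour C).dim = ((∑ j, δ j * δ j : ℝ) : ℂ) := by
    rw [Colour.dim_eq_sum]
    simp only [mult_kirbyColour, hd]
    push_cast
    rfl
  rw [h]
  exact_mod_cast (Finset.sum_pos (fun j _ => mul_pos (hδ j) (hδ j)) ⟨i, Finset.mem_univ i⟩).ne'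

/-- A sum of squares of positive dimensions over transparent simple objects of `P`, among them the
unit. -/
theorem HasPositiveDimensions.dim_transparentPart_ne_zero [BraidedCategory D]
    (hD : HasPositiveDimensions D) (P : ObjectProperty D) [IsFusionSubcategory P] :
    ((kirbyColour P.FullSubcategory).map P.ι).transparentPart.dim ≠ 0 := by
  classical
  choose δ hδ hd using fun i => hD _ (simpleObj_simple D i).id_ne_zero
  obtain ⟨i, ⟨e⟩⟩ := (FusionCategory.simple_unit (C := D)).exists_iso_simpleObj
  have h : ((kirbyColour P.FullSubcategory).map P.ι).transparentPart.dim =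
      ((∑ j, if IsTransparent (simpleObj D j) ∧ P (simpleObj D j) then δ j * δ j else 0 : ℝ) :
        ℂ) := by
    rw [Colour.dim_transparentPart, Complex.ofReal_sum]
    refine Finset.sum_congr rfl fun j _ => ?_
    rw [mult_kirbyColour_map_ι, ite_and]
    split_ifs <;> simp [hd]
  rw [h]
  refine Complex.ofReal_ne_zero.2 (Finset.sum_pos' (fun j _ => ?_) ⟨i, Finset.mem_univ i, ?_⟩).ne'
  · split_ifs
    · exact (mul_pos (hδ j) (hδ j)).le
    · exact le_rfl
  · rw [if_pos ⟨isTransparent_unit.retract (Retract.ofIso e.symm),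
      IsFusionSubcategory.prop_retract (Retract.ofIso e.symm) P.prop_unit⟩]
    exact mul_pos (hδ i) (hδ i)

/-- The image of the Kirby colour is proportional to the Kirby colour of the image. -/
theorem exists_mult_kirbyColour_map (hC : HasPositiveDimensions C) (F : C ⥤ D) [F.Additive]
    [F.Monoidal] (hF : ∀ X, qdim (F.obj X) = qdim X) : ∃ c : ℂ, c ≠ 0 ∧
      (∀ j, ((kirbyColour C).map F).mult (simpleObj D j) =
        c * ((kirbyColour (Image F)).map (imageInclusion F)).mult (simpleObj D j)) ∧
      (kirbyColour C).dim = c * (kirbyColour (Image F)).dim := by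
  classical
  obtain ⟨c, hc, h⟩ := exists_imageMult_eq hC F hF
  have h1 : ∀ j, ((kirbyColour C).map F).mult (simpleObj D j) =
      c * ((kirbyColour (Image F)).map (imageInclusion F)).mult (simpleObj D j) := fun j => by
    rw [mult_kirbyColour_map, h, mult_kirbyColour_map_ι, mul_ite, mul_zero]
  refine ⟨c, hc, h1, ?_⟩
  rw [← Colour.dim_map F hF, ← Colour.dim_map (imageInclusion F) (qdim_obj _), Colour.dim_eq_sum,
    Colour.dim_eq_sum, Finset.mul_sum]
  exact Finset.sum_congr rfl fun j _ => by rw [h1, mul_assoc]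

theorem dichromaticInvariant_eq_imageInclusion [BraidedCategory D] (hC : HasPositiveDimensions C)
    (F : C ⥤ D) [F.Additive] [F.Monoidal] (hF : ∀ X, qdim (F.obj X) = qdim X) (L : DottedLink) :
    dichromaticInvariant F L = dichromaticInvariant (imageInclusion F) L := by
  classical
  obtain ⟨c, hc, h, hd⟩ := exists_mult_kirbyColour_map hC F hF
  have h1 : L.eval (kirbyColour D) ((kirbyColour C).map F) = 1 ^ L.h₁ * c ^ L.h₂ *
      L.eval (kirbyColour D) ((kirbyColour (Image F)).map (imageInclusion F)) := by
    rw [L.eval_eq_simpleEval, L.eval_eq_simpleEval, ← L.simpleEval_smul]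
    simp only [h, one_mul]
  have h2 : ((kirbyColour C).map F).transparentPart.dim =
      c * ((kirbyColour (Image F)).map (imageInclusion F)).transparentPart.dim := by
    rw [Colour.dim_transparentPart, Colour.dim_transparentPart, Finset.mul_sum]
    exact Finset.sum_congr rfl fun j _ => by rw [h, mul_ite, mul_zero, mul_assoc]
  rw [dichromaticInvariant, dichromaticInvariant, h1, h2, hd]
  -- The dotted colour is the same on both sides, so its constant is 1.
  refine Eq.trans ?_ (normalisation_eq hc one_ne_zero _ _)
  rw [one_mul (kirbyColour D).dim]

theorem dichromaticInvariant_eq_petitInvariant [BraidedCategory D] (hD : HasPositiveDimensions D)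
    (P : ObjectProperty D) [IsFusionSubcategory P] (L : DottedLink) :
    dichromaticInvariant P.ι L = petitInvariant P.ι L *
      (petitNorm P.ι / (kirbyColour P.FullSubcategory).dim) ^ (L.eulerChar - 2) := by
  -- Apart from its consequence that the root is nonzero, only this identity is used, so the branch
  -- of the square root is immaterial.
  have h1 : petitNorm P.ι ^ 2 =
      (kirbyColour D).dim * ((kirbyColour P.FullSubcategory).map P.ι).transparentPart.dim := by
    rw [petitNorm, one_div]
    exact Complex.cpow_nat_inv_pow _ two_ne_zero
  have h2 : petitNorm P.ι ≠ 0 := fun h => by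
    rw [h, zero_pow two_ne_zero] at h1
    exact mul_ne_zero hD.exists_dim_kirbyColour (hD.dim_transparentPart_ne_zero P) h1.symm
  have h3 : L.eulerChar - 2 = (L.h₂ : ℤ) - (L.h₁ : ℤ) - (L.h₃ : ℤ) := by
    rw [DottedLink.eulerChar]
    ring
  rw [dichromaticInvariant, petitInvariant, ← h1, h3]
  exact petit_normalisation_eq hD.fullSubcategory.exists_dim_kirbyColour h2 _ _ _

variable [BraidedCategory D] {E : Type u₃} [Category.{v₃} E] [Preadditive E] [Linear ℂ E]
  [MonoidalCategory E] [MonoidalPreadditive E] [MonoidalLinear ℂ E] [LeftRigidCategory E]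
  [FusionCategory E] [PivotalCategory E] [BraidedCategory E] [RibbonCategory E]

/-- The dimension of the transparent part is the multiplicity of the unit in the image in a
modular category. -/
theorem dim_transparentPart_eq_mult (hE : IsModular E) (H : D ⥤ E) [H.Additive] [H.Braided]
    (hH : IsDominant H) (hdim : ∀ X, qdim (H.obj X) = qdim X) (x : Colour D) :
    x.transparentPart.dim = (x.map H).mult (𝟙_ E) * qdim (𝟙_ E) := by
  classical
  rw [Colour.dim_transparentPart, Colour.mult_map_eq_sum, Finset.sum_mul]
  refine Finset.sum_congr rfl fun j _ => ?_
  split_ifs with h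
  -- The image of a transparent object is a multiple of the unit, so its dimension counts the
  -- multiplicity of the unit.
  · rw [← hdim, qdim_of_isTransparent hE (isTransparent_map H hH h), mul_assoc]
  · have h0 : Module.finrank ℂ (𝟙_ E ⟶ H.obj (simpleObj D j)) = 0 := by
      by_contra h0
      obtain ⟨f, hf⟩ := finrank_hom_pos_iff.1 (Nat.pos_of_ne_zero h0)
      exact h ((simpleObj_simple D j).isTransparent_of_hom H hf)
    rw [h0, Nat.cast_zero, mul_zero, zero_mul]

variable [RibbonCategory D]

/-- Evaluation in `D` is evaluation in `E` of the images of the colours. These are `m` times the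
Kirby colour of `E` and `l` times that of the image of `F ⋙ H`; both constants cancel. -/
theorem dichromaticInvariant_eq_of_isModularisation (hC : HasPositiveDimensions C)
    (hD : HasPositiveDimensions D) (F : C ⥤ D) [F.Additive] [F.Monoidal]
    (hF : ∀ X, qdim (F.obj X) = qdim X) (H : D ⥤ E) [H.Additive] [H.Linear ℂ] [H.Braided]
    (hH : IsModularisation H) (L : DottedLink) :
    dichromaticInvariant F L = dichromaticInvariant (imageInclusion (F ⋙ H)) L := by
  have hdim : ∀ X, qdim (H.obj X) = qdim X := qdim_map_of_ribbon H hH.map_twist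
  obtain ⟨l, hl, hl1, hl2⟩ := exists_mult_kirbyColour_map hC (F ⋙ H)
    fun X => (hdim _).trans (hF X)
  obtain ⟨m, hm, hm1⟩ := exists_imageMult_eq hD H hdim
  have hm2 : ∀ j, ((kirbyColour D).map H).mult (simpleObj E j) =
      m * (kirbyColour E).mult (simpleObj E j) := fun j => by
    rw [mult_kirbyColour_map, hm1, if_pos (show imageProperty H _ from hH.dominant _),
      mult_kirbyColour]
  have hm3 : (kirbyColour D).dim = m * (kirbyColour E).dim := by
    rw [← Colour.dim_map H hdim, Colour.dim_eq_sum, Colour.dim_eq_sum, Finset.mul_sum]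
    exact Finset.sum_congr rfl fun j _ => by rw [hm2, mul_assoc]
  have hcomp : ((kirbyColour C).map F).map H = (kirbyColour C).map (F ⋙ H) :=
    Finsupp.mapDomain_comp.symm
  have h1 : L.eval (kirbyColour D) ((kirbyColour C).map F) = m ^ L.h₁ * l ^ L.h₂ *
      L.eval (kirbyColour E) ((kirbyColour (Image (F ⋙ H))).map (imageInclusion (F ⋙ H))) := by
    rw [L.eval_eq_simpleEval_map H (L.scalar_eval_map H hH.map_twist), hcomp,
      L.eval_eq_simpleEval, ← L.simpleEval_smul]
    simp only [hl1, hm2]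
  have h2 : ((kirbyColour C).map F).transparentPart.dim = l *
      ((kirbyColour (Image (F ⋙ H))).map (imageInclusion (F ⋙ H))).transparentPart.dim := by
    obtain ⟨j, ⟨e⟩⟩ := (FusionCategory.simple_unit (C := E)).exists_iso_simpleObj
    rw [dim_transparentPart_eq_mult hH.modular H hH.dominant hdim, hcomp,
      -- The identity of `E` is itself a dominant functor to a modular category, so the same formula
      -- computes the transparent part in `E`, and both sides become multiplicities of the unit.
      dim_transparentPart_eq_mult hH.modular (𝟭 E) (fun Y => ⟨Y, ⟨Retract.refl Y⟩⟩) fun _ => rfl,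
      Colour.mult_congr _ e, hl1, ← Colour.mult_congr _ e, mul_assoc]
    congr 2
    exact congrArg (Colour.mult · _) Finsupp.mapDomain_id.symm
  rw [dichromaticInvariant, dichromaticInvariant, h1, h2, hl2, hm3, normalisation_eq hl hm]

end Invariants
end Dichromatic

theorem mainTheorem9
    {C : Type u₁} [Category.{v₁} C] [Preadditive C] [Linear ℂ C] [MonoidalCategory C]
    [MonoidalPreadditive C] [MonoidalLinear ℂ C] [LeftRigidCategory C] [PivotalCategory C]
    [DaggerCategory C] [UnitaryFusionCategory C]
    {D : Type u₂} [Category.{v₂} D] [Preadditive D] [Linear ℂ D] [MonoidalCategory D]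
    [MonoidalPreadditive D] [MonoidalLinear ℂ D] [LeftRigidCategory D] [PivotalCategory D]
    [DaggerCategory D] [UnitaryFusionCategory D] [BraidedCategory D] [RibbonCategory D]
    (hD : CentreHasTrivialTwist D)
    (F : C ⥤ D) [F.Additive] [F.Linear ℂ] [F.Monoidal] (hF : IsUnitaryFunctor F) :
    (∀ L : DottedLink,
      dichromaticInvariant F L = dichromaticInvariant (imageInclusion F) L ∧
      dichromaticInvariant F L = petitInvariant (imageInclusion F) L *
        (petitNorm (imageInclusion F) / (kirbyColour (Image F)).dim) ^ (L.eulerChar - 2)) ∧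
    (IsModularisable D →
      ∀ {E : Type u₃} [Category.{v₃} E] [Preadditive E] [Linear ℂ E] [MonoidalCategory E]
        [MonoidalPreadditive E] [MonoidalLinear ℂ E] [LeftRigidCategory E] [FusionCategory E]
        [PivotalCategory E] [BraidedCategory E] [RibbonCategory E]
        (H : D ⥤ E) [H.Additive] [H.Linear ℂ] [H.Braided], IsModularisation H →
        ∀ L : DottedLink,
          dichromaticInvariant F L = dichromaticInvariant (imageInclusion (F ⋙ H)) L) := by
  have hC : HasPositiveDimensions C := fun X hX => exists_qdim_pos hX
  have hD' : HasPositiveDimensions D := fun X hX => exists_qdim_pos hX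
  have hdim : ∀ X, qdim (F.obj X) = qdim X := hC.qdim_map hD' F
  have h := dichromaticInvariant_eq_imageInclusion hC F hdim
  exact ⟨fun L => ⟨h L, (h L).trans (dichromaticInvariant_eq_petitInvariant hD' _ L)⟩,
    fun _ => fun H => fun hH L =>
      dichromaticInvariant_eq_of_isModularisation hC hD' F hdim H hH L⟩
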